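/- **Setting.** Let $D,n\ge 1$ and let $X=(X_t)_{0\le t\le T}$ be a Markov process with state space $\mathbb R^D$ and given transition probabilities, through which $\mathbb E[\,\cdot\mid X_s=x]$ is understood for every $x\in\mathbb R^D$. Let $t_0<\dots<t_n=T$ be times in $[0,T]$, let $g:[0,T]\times\mathbb R^D\to\mathbb R$, and let $f:\mathbb R\times\mathbb R\to\mathbb R$ satisfy $|f(x_1,y_1)-f(x_2,y_2)|\le L_f(|x_1-x_2|+|y_1-y_2|)$. Let $$V_{t_n}(x)=g(T,x),\qquad V_{t_u}(x)=f\big(g(t_u,x),\mathbb E[V_{t_{u+1}}(X_{t_{u+1}})\mid X_{t_u}=x]\big)\quad(0\le u<n),$$ where all these conditional expectations are assumed to exist (integrability). Let $\mathcal X=\prod_{i=1}^D[\underline x_i,\overline x_i]$ with $\underline x_i<\overline x_i$, let $\tau$ be the componentwise affine map $\tau(z)_i=\overline x_i+\tfrac12(\underline x_i-\overline x_i)(1-z_i)$ of $[-1,1]^D$ onto $\mathcal X$, let $\overline N=(N_1,\dots,N_D)$ with $N_i\ge 1$ and $\mathcal J=\{j: 0\le j_i\le N_i\}$. For $j,k\in\mathcal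 J$ put $p_j(x)=\prod_i T_{j_i}(\tau^{-1}(x)_i)\,1_{\mathcal X}(x)$ with the Chebyshev polynomials $T_m(\cos\theta)=\cos m\theta$, $z^k=(\cos(\pi k_i/N_i))_i$ and $x^k=\tau(z^k)$, and let $\mathcal P=\mathrm{span}\{p_j:j\in\mathcal J\}$. Chebyshev interpolation of values $v(x^k)$ is $\sum_j c_jp_j$ with $c_j=\prod_i\frac{2^{1_{\{0<j_i<N_i\}}}}{N_i}\sum_{k\in\mathcal J}\big(\prod_i w_{k_i}\big)v(x^k)\prod_i T_{j_i}(z^k_i)$, where $w_{k_i}=\frac12$ if $k_i\in\{0,N_i\}$ and $w_{k_i}=1$ otherwise. $\Lambda_{\overline N}=\max_{x\in\mathcal X}\sum_{j}\prod_i|\ell_{j_i}(\tau^{-1}(x)_i)|$ is the Lebesgue constant, where $\ell_0,\dots,\ell_{N_i}$ are the Lagrange polynomials of the points $\cos(\pi m/N_i)$, $0\le m\le N_i$. Let $\Gamma^k_{t_u}(h)=\mathbb E[h(X_{t_{u+1}})\mid X_{t_u}=x^k]$, and let $\widehat\Gamma^k_{t_u}:\mathcal P\to\mathbb R$ ($0\le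 u<n$, $k\in\mathcal J$) be linear operators approximating it. The dynamic Chebyshev method computes $\widehat V_{t_n}$ as the interpolation of the values $g(T,x^k)$ and, backwards in $u$, $\widehat V_{t_u}=\sum_j c_j(t_u)p_j$ as the interpolation of the values $f\big(g(t_u,x^k),\sum_jc_j(t_{u+1})\widehat\Gamma^k_{t_u}(p_j)\big)$. One of the following holds: * (GM) the $\widehat\Gamma^k_{t_u}$ are deterministic and $|\Gamma^k_{t_u}(p)-\widehat\Gamma^k_{t_u}(p)|\le\overline\delta$ for all $u<n$, $k\in\mathcal J$ and $p\in\mathcal P$ with $\max_{\mathcal X}|p|=1$; then put $\varepsilon_{gm}=\overline\delta\ge 0$ and $\varepsilon_{t_u}=\max_{x\in\mathcal X}|V_{t_u}(x)-\widehat V_{t_u}(x)|$; * (GM*) the $\widehat\Gamma^k_{t_u}$ are random (computed from $M\ge1$ samples) and $\mathbb E|\Gamma^k_{t_u}(p)-\widehat\Gamma^k_{t_u}(p)|\le\delta^\star(M)$ for all $u<n$, $k\in\mathcal J$ and all $p=\sum_ja_jp_j$ with random coefficients $a_j$ and $\max_{x\in\mathcal X}\mathbb E|p(x)|=1$; it suffices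 to have this for coefficients that are measurable with respect to the σ-algebra generated by the operators $\widehat\Gamma^k_{t_v}$ with $v>u$. Then put $\varepsilon_{gm}=\delta^\star(M)\ge 0$ and $\varepsilon_{t_u}=\max_{x\in\mathcal X}\mathbb E|V_{t_u}(x)-\widehat V_{t_u}(x)|$. Assume further: * for $u=1,\dots,n$ the function $V_{t_u}|_{\mathcal X}$ has an analytic extension, bounded in modulus by $B_{t_u}$, to the generalized Bernstein ellipse $\mathcal B(\mathcal X,\varrho_{t_u})$, $\varrho_{t_u}\in(1,\infty)^D$, which is the product over $i$ of the images of the open regions bounded by the ellipses with foci $\pm1$ and semiaxes summing to $\varrho_{t_u,i}$ under the affine maps $z\mapsto\overline x_i+\tfrac12(\underline x_i-\overline x_i)(1-z)$; * $\big|\mathbb E[V_{t_{u+1}}(X_{t_{u+1}})1_{\mathbb R^D\setminus\mathcal X}(X_{t_{u+1}})\mid X_{t_u}=x^k]\big|\le\varepsilon_{tr}$ for all $u<n$ and $k\in\mathcal J$. **Corollary.** (a) For $u=1,\dots,n$, $$\varepsilon_{t_u}\le\big(\varepsilon_{int}(\underline\varrho,\overline N,D,\overline B)+\varepsilon_{tr}+\varepsilon_{gm}\overline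 V\big)\,\tilde C^{\,n+1-u},$$ where $$\varepsilon_{int}(\varrho,\overline N,D,B)=2^{\frac D2+1}B\Big(\sum_{i=1}^D\varrho_i^{-2N_i}\prod_{j=1}^D\frac1{1-\varrho_j^{-2}}\Big)^{1/2},$$ $\tilde C=\max\{2,\Lambda_{\overline N}L_f(1+\varepsilon_{gm})\}$, $\underline\varrho=\min_{1\le u\le n}\varrho_{t_u}$ (componentwise), $\overline B=\max_{1\le u\le n}B_{t_u}$ and $\overline V=\max_{u\le j\le n}\max_{x\in\mathcal X}|V_{t_j}(x)|$. (b) Let $c>0$. There are constants $\tilde c_1,\tilde c_2>0$, depending only on $D$, $n$, $c$, the $\varrho_{t_u}$ and the $B_{t_u}$, such that, whenever $\varepsilon_{tr}=0$, $L_f=1$ and $N_1=\dots=N_D=N\ge2$, under (GM*) with $\delta^\star(M)\le c/\sqrt M$, $M\ge 1$, $$\varepsilon_{t_u}\le\tilde c_1\,\varrho^{-N}\log(N)^{Dn}+\tilde c_2\log(N)^{Dn}M^{-1/2}\qquad(u=1,\dots,n),$$ with $\varrho=\min_i\underline\varrho_i$. Under (GM) with $\overline\delta\le c$ the same holds, for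 suitable such constants, with $M^{-1/2}$ replaced by $\overline\delta$. -/

import Mathlib

open MeasureTheory ProbabilityTheory Set
open scoped ENNReal

universe w

noncomputable section

namespace ChebDP

/-! ### Markov processes and dynamic programming problems -/

/-- `X` is a Markov process on `[0,T]` with state space `ℝ^D` on the filtered probability space
`(Ω, 𝓕, P)`, with transition probabilities `κ s t x A = P (X_t ∈ A | X_s = x)`. -/
structure IsMarkovProcess {D : ℕ} {T : ℝ} {Ω : Type w} {mΩ : MeasurableSpace Ω} (P : Measure Ω)
    (𝓕 : Filtration (Icc (0 : ℝ) T) mΩ) (X : Icc (0 : ℝ) T → Ω → (Fin D → ℝ))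
    (κ : Icc (0 : ℝ) T → Icc (0 : ℝ) T → Kernel (Fin D → ℝ) (Fin D → ℝ)) : Prop where
  prob : IsProbabilityMeasure P
  adapted : ∀ t, Measurable[𝓕 t] (X t)
  kernel_prob : ∀ s t, IsMarkovKernel (κ s t)
  markov : ∀ s t, s ≤ t → ∀ A : Set (Fin D → ℝ), MeasurableSet A →
    P[(X t ⁻¹' A).indicator (fun _ => (1 : ℝ)) | 𝓕 s] =ᵐ[P] fun ω => (κ s t (X s ω)).real A

/-- A dynamic programming problem with `n` time steps `t_0 < ⋯ < t_n = T` for a Markov process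
with state space `ℝ^D`: the value functions satisfy `V_{t_n} = g(T, ·)` and
`V_{t_u}(x) = f (g(t_u, x), E[V_{t_{u+1}}(X_{t_{u+1}}) | X_{t_u} = x])`, all these conditional
expectations being well defined, and `f` is Lipschitz continuous with constant `L`. Values of `t`
and `V` at indices above `n` play no role. -/
structure DPP (D n : ℕ) where
  T : ℝ
  Ω : Type w
  mΩ : MeasurableSpace Ω
  P : Measure Ω
  𝓕 : Filtration (Icc (0 : ℝ) T) mΩ
  X : Icc (0 : ℝ) T → Ω → (Fin D → ℝ)
  κ : Icc (0 : ℝ) T → Icc (0 : ℝ) T → Kernel (Fin D → ℝ) (Fin D → ℝ)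
  markov : IsMarkovProcess P 𝓕 X κ
  t : ℕ → Icc (0 : ℝ) T
  t_lt : ∀ u < n, t u < t (u + 1)
  t_last : (t n : ℝ) = T
  g : Icc (0 : ℝ) T → (Fin D → ℝ) → ℝ
  f : ℝ → ℝ → ℝ
  L : ℝ
  lipschitz : ∀ x₁ y₁ x₂ y₂ : ℝ, |f x₁ y₁ - f x₂ y₂| ≤ L * (|x₁ - x₂| + |y₁ - y₂|)
  V : ℕ → (Fin D → ℝ) → ℝ
  V_last : ∀ x, V n x = g (t n) x
  V_integrable : ∀ u < n, ∀ x, Integrable (V (u + 1)) (κ (t u) (t (u + 1)) x)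
  V_step : ∀ u < n, ∀ x, V u x = f (g (t u) x) (∫ y, V (u + 1) y ∂(κ (t u) (t (u + 1)) x))

/-- The conditional expectation `E[h(X_{t_{u+1}}) | X_{t_u} = x]`. -/
def DPP.condExp {D n : ℕ} (S : DPP.{w} D n) (u : ℕ) (h : (Fin D → ℝ) → ℝ) (x : Fin D → ℝ) : ℝ :=
  ∫ y, h y ∂(S.κ (S.t u) (S.t (u + 1)) x)

/-! ### Chebyshev interpolation on the box `𝒳 = [lo, hi]` -/

/-- The affine map from `[-1,1]` onto `[a,b]`. -/
def tau (a b z : ℝ) : ℝ := b + (a - b) / 2 * (1 - z)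

/-- The inverse of `tau a b` (for `a < b`). -/
def tauInv (a b x : ℝ) : ℝ := 1 - 2 * (b - x) / (b - a)

theorem tau_tauInv {a b : ℝ} (h : a < b) (x : ℝ) : tau a b (tauInv a b x) = x := by
  have h' : b - a ≠ 0 := (sub_pos.mpr h).ne'
  unfold tau tauInv
  field_simp
  ring

theorem tauInv_tau {a b : ℝ} (h : a < b) (z : ℝ) : tauInv a b (tau a b z) = z := by
  have h' : b - a ≠ 0 := (sub_pos.mpr h).ne'
  unfold tau tauInv
  field_simp
  ring

/-- The index set `𝒥` of all `j` with `0 ≤ j_i ≤ N_i`. -/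
abbrev Idx {D : ℕ} (N : Fin D → ℕ) : Type := (i : Fin D) → Fin (N i + 1)

/-- The univariate Chebyshev points `cos (π k / N)`, `k = 0, …, N`. -/
def chebNode (N : ℕ) (k : Fin (N + 1)) : ℝ := Real.cos (Real.pi * (k : ℕ) / N)

/-- The transformed Chebyshev points `x^k`. -/
def node {D : ℕ} (lo hi : Fin D → ℝ) (N : Fin D → ℕ) (k : Idx N) : Fin D → ℝ :=
  fun i => tau (lo i) (hi i) (chebNode (N i) (k i))

/-- The `j`-th Chebyshev polynomial on `𝒳`, set to zero outside of `𝒳`. -/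
def chebPoly {D : ℕ} (lo hi : Fin D → ℝ) (N : Fin D → ℕ) (j : Idx N) : (Fin D → ℝ) → ℝ :=
  (Icc lo hi).indicator fun x =>
    ∏ i, (Polynomial.Chebyshev.T ℝ ((j i : ℕ) : ℤ)).eval (tauInv (lo i) (hi i) (x i))

/-- The Chebyshev coefficient `c_j` belonging to the values `v k` at the Chebyshev points. -/
def chebCoeff {D : ℕ} (N : Fin D → ℕ) (v : Idx N → ℝ) (j : Idx N) : ℝ :=
  (∏ i, (if 0 < (j i : ℕ) ∧ (j i : ℕ) < N i then (2 : ℝ) else 1) / (N i : ℝ)) *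
    ∑ k : Idx N, (∏ i, (if (k i : ℕ) = 0 ∨ (k i : ℕ) = N i then (1 / 2 : ℝ) else 1)) * v k *
      ∏ i, (Polynomial.Chebyshev.T ℝ ((j i : ℕ) : ℤ)).eval (chebNode (N i) (k i))

/-- The Lebesgue constant of the tensorized Chebyshev points,
`max_{x ∈ 𝒳} ∑_j ∏_i |ℓ_{j_i}(τ⁻¹(x_i))|`. -/
def lebesgueConst {D : ℕ} (lo hi : Fin D → ℝ) (N : Fin D → ℕ) : ℝ :=
  sSup ((fun x : Fin D → ℝ => ∑ j : Idx N, ∏ i,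
    |(Lagrange.basis Finset.univ (chebNode (N i)) (j i)).eval
      (tauInv (lo i) (hi i) (x i))|) '' Icc lo hi)

/-- The space `𝒫_N(𝒳)` spanned by the Chebyshev polynomials on `𝒳`. -/
def chebSpace {D : ℕ} (lo hi : Fin D → ℝ) (N : Fin D → ℕ) : Submodule ℝ ((Fin D → ℝ) → ℝ) :=
  Submodule.span ℝ (range (chebPoly lo hi N))

/-- `chebPoly` as an element of `chebSpace`. -/
def chebElem {D : ℕ} (lo hi : Fin D → ℝ) (N : Fin D → ℕ) (j : Idx N) : chebSpace lo hi N :=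
  ⟨chebPoly lo hi N j, Submodule.subset_span ⟨j, rfl⟩⟩

/-! ### Bernstein ellipses and the interpolation error bound -/

/-- The open region bounded by the ellipse with foci `±1` whose semiaxes sum to `r`
(so that the sum of the distances to the foci is `r + r⁻¹` on the boundary). -/
def bernstein (r : ℝ) : Set ℂ := {z | ‖z - 1‖ + ‖z + 1‖ < r + r⁻¹}

/-- The complex affine map which extends `tau a b`. -/
def tauC (a b : ℝ) (z : ℂ) : ℂ := (b : ℂ) + ((a : ℂ) - b) / 2 * (1 - z)

/-- The generalized Bernstein ellipse around the box `[lo, hi]`. -/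
def genBernstein {D : ℕ} (lo hi ϱ : Fin D → ℝ) : Set (Fin D → ℂ) :=
  univ.pi fun i => tauC (lo i) (hi i) '' bernstein (ϱ i)

/-- `v` restricted to the box has an analytic extension, bounded by `B`, to the generalized
Bernstein ellipse with parameter `ϱ`. -/
def HasAnalyticExtension {D : ℕ} (lo hi ϱ : Fin D → ℝ) (B : ℝ) (v : (Fin D → ℝ) → ℝ) : Prop :=
  ∃ F : (Fin D → ℂ) → ℂ, AnalyticOnNhd ℂ F (genBernstein lo hi ϱ) ∧
    (∀ x ∈ Icc lo hi, F (fun i => (x i : ℂ)) = (v x : ℂ)) ∧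
    ∀ z ∈ genBernstein lo hi ϱ, ‖F z‖ ≤ B

/-- The regularity assumption: `V_{t_u}` has, for `u = 1, …, n`, an analytic extension to the
generalized Bernstein ellipse with parameter `ϱ_{t_u}` which is bounded by `B_{t_u}`. -/
def DPP.Regular {D n : ℕ} (S : DPP.{w} D n) (lo hi : Fin D → ℝ) (ϱ : ℕ → Fin D → ℝ)
    (B : ℕ → ℝ) : Prop :=
  ∀ u ∈ Icc 1 n, HasAnalyticExtension lo hi (ϱ u) (B u) (S.V u)

/-- The bound `ε_int(ϱ, N, D, B)` of the interpolation error. -/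
def epsInt {D : ℕ} (ϱ : Fin D → ℝ) (N : Fin D → ℕ) (B : ℝ) : ℝ :=
  (2 : ℝ) ^ ((D : ℝ) / 2 + 1) * B *
    √(∑ i, ϱ i ^ (-(2 * (N i : ℤ))) * ∏ j, 1 / (1 - ϱ j ^ (-2 : ℤ)))

/-- The componentwise minimum of `ϱ_{t_1}, …, ϱ_{t_n}`. -/
def rhoMin {D : ℕ} (n : ℕ) (ϱ : ℕ → Fin D → ℝ) (i : Fin D) : ℝ :=
  sInf ((fun u => ϱ u i) '' Icc 1 n)

/-- The maximum of `B_{t_1}, …, B_{t_n}`. -/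
def bMax (n : ℕ) (B : ℕ → ℝ) : ℝ := sSup (B '' Icc 1 n)

/-- `max_{u ≤ j ≤ n} max_{x ∈ 𝒳} |V_{t_j}(x)|`. -/
def DPP.vMax {D n : ℕ} (S : DPP.{w} D n) (lo hi : Fin D → ℝ) (u : ℕ) : ℝ :=
  sSup ((fun j => sSup ((fun x => |S.V j x|) '' Icc lo hi)) '' Icc u n)

/-- The truncation error is bounded by `εtr` at all Chebyshev points and all time steps. -/
def DPP.Trunc {D n : ℕ} (S : DPP.{w} D n) (lo hi : Fin D → ℝ) (N : Fin D → ℕ) (εtr : ℝ) : Prop :=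
  ∀ u < n, ∀ k : Idx N,
    |S.condExp u ((Icc lo hi)ᶜ.indicator (S.V (u + 1))) (node lo hi N k)| ≤ εtr

/-! ### The dynamic Chebyshev algorithm -/

/-- The values `V̂_{t_{n-m}}(x^k)` which the algorithm computes at the Chebyshev points in its
`m`-th step, when it uses `G u k j` as generalized moment of `p_j` at time `t_u` and point `x^k`. -/
def DPP.nodal {D n : ℕ} (S : DPP.{w} D n) (lo hi : Fin D → ℝ) (N : Fin D → ℕ)
    (G : ℕ → Idx N → Idx N → ℝ) : ℕ → Idx N → ℝ
  | 0 => fun k => S.g (S.t n) (node lo hi N k)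
  | m + 1 => fun k => S.f (S.g (S.t (n - (m + 1))) (node lo hi N k))
      (∑ j, chebCoeff N (S.nodal lo hi N G m) j * G (n - (m + 1)) k j)

/-- The approximation `V̂_{t_u} = ∑_j c_j(t_u) p_j`, `u ≤ n`, computed by the algorithm which uses
the operators `Γ u k` in place of the conditional expectations given `X_{t_u} = x^k`. -/
def DPP.approx {D n : ℕ} (S : DPP.{w} D n) (lo hi : Fin D → ℝ) (N : Fin D → ℕ)
    (Γ : ℕ → Idx N → (chebSpace lo hi N →ₗ[ℝ] ℝ)) (u : ℕ) (x : Fin D → ℝ) : ℝ :=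
  ∑ j, chebCoeff N (S.nodal lo hi N (fun u k j => Γ u k (chebElem lo hi N j)) (n - u)) j *
    chebPoly lo hi N j x

/-! ### Deterministic and stochastic approximation of the generalized moments -/

/-- Condition (GM): deterministic operators whose distance to the conditional expectations, in
the operator norm with respect to the maximum norm on `𝒳`, is at most `δ`. -/
def DPP.GM {D n : ℕ} (S : DPP.{w} D n) (lo hi : Fin D → ℝ) (N : Fin D → ℕ)
    (Γ : ℕ → Idx N → (chebSpace lo hi N →ₗ[ℝ] ℝ)) (δ : ℝ) : Prop :=
  ∀ u < n, ∀ k : Idx N, ∀ p : chebSpace lo hi N,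
    (⨆ x ∈ Icc lo hi, ‖(p : (Fin D → ℝ) → ℝ) x‖ₑ) = 1 →
      |S.condExp u p (node lo hi N k) - Γ u k p| ≤ δ

/-- The error `max_{x ∈ 𝒳} |V_{t_u}(x) - V̂_{t_u}(x)|` in the deterministic case. -/
def DPP.error {D n : ℕ} (S : DPP.{w} D n) (lo hi : Fin D → ℝ) (N : Fin D → ℕ)
    (Γ : ℕ → Idx N → (chebSpace lo hi N →ₗ[ℝ] ℝ)) (u : ℕ) : ℝ≥0∞ :=
  ⨆ x ∈ Icc lo hi, ‖S.V u x - S.approx lo hi N Γ u x‖ₑ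

/-- The σ-algebra generated by the random operators of the time steps after `t_u`, which the
algorithm has used when it arrives at `t_u`. -/
def laterSigma {D : ℕ} (n : ℕ) (lo hi : Fin D → ℝ) (N : Fin D → ℕ) {Ω' : Type w}
    (Γ : ℕ → Idx N → Ω' → (chebSpace lo hi N →ₗ[ℝ] ℝ)) (u : ℕ) : MeasurableSpace Ω' :=
  ⨆ v ∈ Ioo u n, ⨆ k : Idx N, ⨆ j : Idx N,
    MeasurableSpace.comap (fun ω => Γ v k ω (chebElem lo hi N j)) inferInstance

/-- Condition (GM*): random operators whose distance to the conditional expectations is at most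
`δ` in the operator norm `sup E|Γ(p) - Γ̂(p)|`, the supremum over polynomials `p = ∑_j a_j p_j` with
stochastic coefficients and `max_{x ∈ 𝒳} E|p(x)| = 1`. The coefficients need only range over the
random variables that are functions of the random operators of later time steps; to ask for the
bound for all random coefficients would be a stronger condition. -/
def DPP.GMStar {D n : ℕ} (S : DPP.{w} D n) (lo hi : Fin D → ℝ) (N : Fin D → ℕ)
    {Ω' : Type w} {mΩ' : MeasurableSpace Ω'} (Q : Measure Ω')
    (Γ : ℕ → Idx N → Ω' → (chebSpace lo hi N →ₗ[ℝ] ℝ)) (δ : ℝ) : Prop :=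
  (∀ u < n, ∀ k : Idx N, ∀ p, Measurable fun ω => Γ u k ω p) ∧
  ∀ u < n, ∀ k : Idx N, ∀ a : Idx N → Ω' → ℝ,
    (∀ j, Measurable[laterSigma n lo hi N Γ u] (a j)) →
    (⨆ x ∈ Icc lo hi, ∫⁻ ω, ‖∑ j, a j ω * chebPoly lo hi N j x‖ₑ ∂Q) = 1 →
      ∫⁻ ω, ‖S.condExp u (fun y => ∑ j, a j ω * chebPoly lo hi N j y) (node lo hi N k) -
        Γ u k ω (∑ j, a j ω • chebElem lo hi N j)‖ₑ ∂Q ≤ ENNReal.ofReal δ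

/-- The error `max_{x ∈ 𝒳} E|V_{t_u}(x) - V̂_{t_u}(x)|` in the stochastic case. -/
def DPP.errorStar {D n : ℕ} (S : DPP.{w} D n) (lo hi : Fin D → ℝ) (N : Fin D → ℕ)
    {Ω' : Type w} {mΩ' : MeasurableSpace Ω'} (Q : Measure Ω')
    (Γ : ℕ → Idx N → Ω' → (chebSpace lo hi N →ₗ[ℝ] ℝ)) (u : ℕ) : ℝ≥0∞ :=
  ⨆ x ∈ Icc lo hi, ∫⁻ ω, ‖S.V u x - S.approx lo hi N (fun v k => Γ v k ω) u x‖ₑ ∂Q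

/-- `(ε_int(ϱ_min, N, D, B_max) + ε_tr + ε_gm V̄) · max{2, Λ L_f (1 + ε_gm)} ^ (n + 1 - u)`. -/
def DPP.bound {D n : ℕ} (S : DPP.{w} D n) (lo hi : Fin D → ℝ) (N : Fin D → ℕ)
    (ϱ : ℕ → Fin D → ℝ) (B : ℕ → ℝ) (εtr εgm : ℝ) (u : ℕ) : ℝ :=
  (epsInt (rhoMin n ϱ) N (bMax n B) + εtr + εgm * S.vMax lo hi u) *
    max 2 (lebesgueConst lo hi N * S.L * (1 + εgm)) ^ (n + 1 - u)

end ChebDP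

end

namespace ChebDP

/-! ### Chebyshev expansions on Bernstein ellipses -/

/-! The proof has two halves, an interpolation estimate with the exact constant of `epsInt` and a
linear recursion for the error.

Interpolation. On an ellipse, `G ∘ joukowski` is holomorphic in an annulus. Cauchy's theorem and
Bessel's inequality give a weighted ℓ² bound on the Chebyshev coefficients of `G`, with weights in
powers of `x = ρ⁻²` (`exists_chebyshev_expansion`). By Cauchy-Schwarz, a combination of point values
of `G` is then bounded by a weighted square sum of its values on the `T_j` (`norm_functional_le`).
Interpolation replaces `T_j` by its alias of degree at most `N`, so these values are explicit
cosines. The univariate results are `‖I G‖ ≤ B √(2 / (1 - x))` (`norm_interp_le`) and `‖G - I G‖ ≤ B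
√(4 x ^ N (1 + x) / (1 - x))` (`norm_sub_interp_le`). Cauchy-Schwarz gives them while `x ^ N` is
small. When `x ^ N` is large, `N` is small compared with `1 / (1 - x)`, and a sharp logarithmic
bound of the Lebesgue constant suffices. The two estimates are shaped for induction on the
dimension: since `1 + (1 + x) / (1 - x) = 2 / (1 - x)`, one more application of Cauchy-Schwarz adds
a variable and reproduces `epsInt` without loss (`tensorInterp_bounds`).

Recursion. An error at time `t_u` is an interpolation error plus the Lebesgue constant times the
error at the nodes. By the Lipschitz condition the nodal error is at most `L` times the sum of the
truncation error, the error one step later, and the moment error. The last is `δ` times the size of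
the approximating polynomial, which is at most the later error plus `V̄`. Hence `b ↦ A + Λ L ((1 +
δ) b + εtr + δ V̄)`, and the claimed bound dominates its iterates because `C̃ ≥ 2`
(`DPP.GMStar.errorStar_le`). Deterministic operators are random ones on a one-point space. Part (b)
follows since the Lebesgue constant is `O(log(N) ^ D)` and `V̄` is at most the bound of the analytic
extensions. -/

theorem isOpen_bernstein (r : ℝ) : IsOpen (bernstein r) :=
  isOpen_lt (by fun_prop) continuous_const

/-- The Joukowski map. -/
noncomputable def joukowski (w : ℂ) : ℂ := (w + w⁻¹) / 2

/-- Since `J(w) ∓ 1 = (w ∓ 1)² / (2w)`, the parallelogram law evaluates the sum: circles go to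
ellipses with foci `±1`. -/
theorem norm_joukowski_foci {w : ℂ} (hw : w ≠ 0) :
    ‖joukowski w - 1‖ + ‖joukowski w + 1‖ = ‖w‖ + ‖w‖⁻¹ := by
  have h1 : joukowski w - 1 = (w - 1) ^ 2 / (2 * w) := by
    unfold joukowski; field_simp; ring
  have h2 : joukowski w + 1 = (w + 1) ^ 2 / (2 * w) := by
    unfold joukowski; field_simp; ring
  have h3 := parallelogram_law_with_norm ℝ w 1
  have h4 : ‖w‖ ≠ 0 := norm_ne_zero_iff.mpr hw
  rw [h1, h2, norm_div, norm_div, norm_pow, norm_pow, norm_mul, Complex.norm_two]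
  simp only [norm_one] at h3
  field_simp
  nlinarith [h3]

theorem add_inv_lt_add_inv {r s : ℝ} (hr : 1 ≤ r) (hrs : r < s) : r + r⁻¹ < s + s⁻¹ := by
  have hr0 : 0 < r := by linarith
  have hs0 : 0 < s := by linarith
  have : s + s⁻¹ - (r + r⁻¹) = (s - r) * (r * s - 1) / (r * s) := by
    field_simp; ring
  have h2 : 0 < (s - r) * (r * s - 1) / (r * s) := by
    apply div_pos (mul_pos (by linarith) (by nlinarith)) (by positivity)
  linarith

theorem joukowski_mem_bernstein {ρ : ℝ} {w : ℂ} (h1 : ρ⁻¹ < ‖w‖) (h2 : ‖w‖ < ρ)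
    (hρ : 1 < ρ) : joukowski w ∈ bernstein ρ := by
  have hw0 : 0 < ‖w‖ := lt_trans (by positivity) h1
  rw [bernstein, mem_ofPred_eq, norm_joukowski_foci (norm_pos_iff.mp hw0)]
  rcases le_total 1 ‖w‖ with h | h
  · exact add_inv_lt_add_inv h h2
  · have h3 : 1 ≤ ‖w‖⁻¹ := (one_le_inv₀ hw0).mpr h
    have h4 : ‖w‖⁻¹ < ρ := inv_lt_of_inv_lt₀ (by linarith) h1
    have := add_inv_lt_add_inv h3 h4
    rw [inv_inv] at this
    linarith

theorem ofReal_mem_bernstein {ρ : ℝ} (hρ : 1 < ρ) {t : ℝ} (ht : t ∈ Icc (-1 : ℝ) 1) :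
    (t : ℂ) ∈ bernstein ρ := by
  have h := add_inv_lt_add_inv le_rfl hρ
  have h1 : ‖(t : ℂ) - 1‖ = 1 - t := by
    rw [← Complex.ofReal_one, ← Complex.ofReal_sub, Complex.norm_real, Real.norm_eq_abs,
      abs_of_nonpos (by linarith [ht.2])]; ring
  have h2 : ‖(t : ℂ) + 1‖ = 1 + t := by
    rw [← Complex.ofReal_one, ← Complex.ofReal_add, Complex.norm_real, Real.norm_eq_abs,
      abs_of_nonneg (by linarith [ht.1])]; ring
  rw [bernstein, mem_ofPred_eq, h1, h2]
  norm_num at h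
  linarith

instance : Fact (0 < 2 * Real.pi) := ⟨Real.two_pi_pos⟩

theorem sum_sq_fourierCoeff_le {f : C(AddCircle (2 * Real.pi), ℂ)} {B : ℝ}
    (hf : ∀ t, ‖f t‖ ≤ B) (s : Finset ℤ) : ∑ k ∈ s, ‖fourierCoeff f k‖ ^ 2 ≤ B ^ 2 := by
  have h := hasSum_sq_fourierCoeff (ContinuousMap.toLp (E := ℂ) 2 AddCircle.haarAddCircle ℂ f)
  simp_rw [fourierCoeff_toLp] at h
  refine (sum_le_hasSum s (fun _ _ => by positivity) h).trans ?_
  have h2 : ∀ᵐ t ∂(AddCircle.haarAddCircle (T := 2 * Real.pi)),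
      ‖(ContinuousMap.toLp (E := ℂ) 2 AddCircle.haarAddCircle ℂ f) t‖ ^ 2 ≤ B ^ 2 := by
    filter_upwards [ContinuousMap.coeFn_toLp (p := 2) (𝕜 := ℂ) AddCircle.haarAddCircle f] with t ht
    rw [ht]
    exact pow_le_pow_left₀ (norm_nonneg _) (hf t) 2
  calc _ ≤ ∫ _, B ^ 2 ∂(AddCircle.haarAddCircle (T := 2 * Real.pi)) := by
        refine integral_mono_of_nonneg (Filter.Eventually.of_forall fun _ => by positivity)
          (integrable_const _) h2
    _ = B ^ 2 := by simp

/-- The function `G ∘ joukowski` on the circle of radius `r`. -/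
noncomputable def circleFun (G : ℂ → ℂ) (r : ℝ) (t : AddCircle (2 * Real.pi)) : ℂ :=
  G (joukowski (r * fourier 1 t))

theorem norm_mul_fourier {r : ℝ} (hr : 0 ≤ r) (t : AddCircle (2 * Real.pi)) :
    ‖(r : ℂ) * fourier 1 t‖ = r := by
  rw [norm_mul, Complex.norm_real, Real.norm_of_nonneg hr, fourier_apply, Circle.norm_coe, mul_one]

theorem joukowski_circle_mem {ρ r : ℝ} (hr : 1 ≤ r) (hrρ : r < ρ)
    (t : AddCircle (2 * Real.pi)) : joukowski (r * fourier 1 t) ∈ bernstein ρ := by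
  have h := norm_mul_fourier (zero_le_one.trans hr) t
  refine joukowski_mem_bernstein ?_ (h.trans_lt hrρ) (hr.trans_lt hrρ)
  rw [h]
  exact (inv_lt_one_of_one_lt₀ (hr.trans_lt hrρ)).trans_le hr

theorem continuous_circleFun {ρ : ℝ} {G : ℂ → ℂ} (hG : DifferentiableOn ℂ G (bernstein ρ))
    {r : ℝ} (hr : 1 ≤ r) (hrρ : r < ρ) : Continuous (circleFun G r) := by
  refine hG.continuousOn.comp_continuous ?_ (joukowski_circle_mem hr hrρ)
  have h : ∀ t : AddCircle (2 * Real.pi), (r : ℂ) * fourier 1 t ≠ 0 := fun t => by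
    rw [← norm_ne_zero_iff, norm_mul_fourier (zero_le_one.trans hr)]
    linarith
  unfold joukowski
  have hc : Continuous fun t : AddCircle (2 * Real.pi) => (r : ℂ) * fourier 1 t := by fun_prop
  exact (hc.add (hc.inv₀ h)).div_const 2

theorem circleFun_coe (G : ℂ → ℂ) (r θ : ℝ) :
    circleFun G r (θ : AddCircle (2 * Real.pi)) = G (joukowski (circleMap 0 r θ)) := by
  unfold circleFun
  rw [fourier_coe_apply, circleMap]
  congr 3
  rw [zero_add]
  congr 2
  have : (Real.pi : ℂ) ≠ 0 := by exact_mod_cast Real.pi_ne_zero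
  push_cast
  field_simp

theorem fourierCoeff_circleFun (G : ℂ → ℂ) {r : ℝ} (hr : 0 < r) (k : ℤ) :
    (∮ w in C(0, r), (w - 0)⁻¹ • (G (joukowski w) * w ^ (-k))) =
      2 * Real.pi * Complex.I * ((r : ℂ) ^ (-k) * fourierCoeff (circleFun G r) k) := by
  rw [fourierCoeff_eq_intervalIntegral _ k 0, zero_add]
  unfold circleIntegral
  have hpi : (Real.pi : ℂ) ≠ 0 := by exact_mod_cast Real.pi_ne_zero
  have : ∀ θ : ℝ, deriv (circleMap 0 r) θ •
      ((circleMap 0 r θ - 0)⁻¹ • (G (joukowski (circleMap 0 r θ)) * circleMap 0 r θ ^ (-k))) =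
      Complex.I * (r : ℂ) ^ (-k) *
        (fourier (-k) (θ : AddCircle (2 * Real.pi)) • circleFun G r (θ : AddCircle _)) := by
    intro θ
    rw [circleFun_coe, fourier_coe_apply, deriv_circleMap, sub_zero]
    have h0 : circleMap 0 r θ ≠ 0 := circleMap_ne_center hr.ne'
    have h1 : circleMap 0 r θ ^ (-k) = (r : ℂ) ^ (-k) *
        Complex.exp (2 * Real.pi * Complex.I * ((-k : ℤ) : ℂ) * θ / ((2 * Real.pi : ℝ) : ℂ)) := by
      rw [circleMap, zero_add, mul_zpow, ← Complex.exp_int_mul]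
      congr 2
      push_cast
      field_simp
    rw [h1]
    simp only [smul_eq_mul]
    field_simp
  simp_rw [this]
  rw [intervalIntegral.integral_const_mul]
  simp only [Complex.real_smul]
  push_cast
  field_simp

/-- As contour integrals, the Fourier coefficients do not depend on the radius up to the factor `r ^
k`, by Cauchy's theorem in the annulus between the two circles. -/
theorem fourierCoeff_circleFun_eq {ρ : ℝ} {G : ℂ → ℂ} (hG : DifferentiableOn ℂ G (bernstein ρ))
    {r : ℝ} (hr : 1 ≤ r) (hrρ : r < ρ) (k : ℤ) :
    fourierCoeff (circleFun G r) k = (r : ℂ) ^ k * fourierCoeff (circleFun G 1) k := by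
  have hρ : 1 < ρ := hr.trans_lt hrρ
  have hd : ∀ w : ℂ, 1 ≤ ‖w‖ → ‖w‖ ≤ r →
      DifferentiableAt ℂ (fun w => G (joukowski w) * w ^ (-k)) w := by
    intro w h1 h2
    have hw0 : w ≠ 0 := norm_pos_iff.mp (by linarith)
    have hmem : joukowski w ∈ bernstein ρ :=
      joukowski_mem_bernstein ((inv_lt_one_of_one_lt₀ hρ).trans_le h1) (h2.trans_lt hrρ) hρ
    have hJ : DifferentiableAt ℂ joukowski w := by
      unfold joukowski
      exact (differentiableAt_id.add (differentiableAt_inv hw0)).div_const 2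
    refine DifferentiableAt.mul ?_ (differentiableAt_zpow.mpr (Or.inl hw0))
    exact (hG.differentiableAt ((isOpen_bernstein ρ).mem_nhds hmem)).comp w hJ
  have h := Complex.circleIntegral_sub_center_inv_smul_eq_of_differentiable_on_annulus_off_countable
    (c := 0) (r := 1) (R := r) one_pos hr (f := fun w => G (joukowski w) * w ^ (-k))
    countable_empty
    (fun w hw => (hd w (by simpa using hw.2) (by simpa using hw.1)).continuousAt.continuousWithinAt)
    (fun w hw => hd w (by simpa using (le_of_lt (not_le.mp fun h => hw.1.2 (by simpa using h))))
      (le_of_lt (by simpa using hw.1.1)))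
  rw [fourierCoeff_circleFun G (zero_lt_one.trans_le hr), fourierCoeff_circleFun G one_pos] at h
  have h2 := mul_left_cancel₀ Complex.two_pi_I_ne_zero h
  have hr0 : (r : ℂ) ≠ 0 := by exact_mod_cast (zero_lt_one.trans_le hr).ne'
  simp only [Complex.ofReal_one, one_zpow, one_mul] at h2
  rw [← h2, zpow_neg, mul_inv_cancel_left₀ (zpow_ne_zero _ hr0)]

theorem sum_sq_coeff_mul_zpow_le {ρ B : ℝ} {G : ℂ → ℂ} (hρ : 1 < ρ)
    (hG : DifferentiableOn ℂ G (bernstein ρ)) (hB : ∀ z ∈ bernstein ρ, ‖G z‖ ≤ B)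
    (s : Finset ℤ) : ∑ k ∈ s, ‖fourierCoeff (circleFun G 1) k‖ ^ 2 * ρ ^ (2 * k) ≤ B ^ 2 := by
  have hlt : ∀ r ∈ Ico 1 ρ,
      ∑ k ∈ s, ‖fourierCoeff (circleFun G 1) k‖ ^ 2 * r ^ (2 * k) ≤ B ^ 2 := by
    intro r hr
    have h := sum_sq_fourierCoeff_le (f := ⟨circleFun G r, continuous_circleFun hG hr.1 hr.2⟩)
      (fun t => hB _ (joukowski_circle_mem hr.1 hr.2 t)) s
    refine le_of_eq_of_le (Finset.sum_congr rfl fun k _ => ?_) h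
    rw [ContinuousMap.coe_mk, fourierCoeff_circleFun_eq hG hr.1 hr.2, norm_mul, mul_pow, norm_zpow,
      Complex.norm_real, Real.norm_of_nonneg (zero_le_one.trans hr.1), mul_comm, mul_comm 2 k,
      zpow_mul]
    norm_cast
  have hcont : ContinuousAt (fun r : ℝ =>
      ∑ k ∈ s, ‖fourierCoeff (circleFun G 1) k‖ ^ 2 * r ^ (2 * k)) ρ := by
    apply tendsto_finsetSum
    intro k _
    exact continuousAt_const.mul (continuousAt_zpow₀ _ _ (Or.inl (by linarith)))
  -- `G` is controlled only on the open region, so the Bessel inequality holds for `r < ρ` and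
  -- passes to the limit for a fixed finite sum.
  refine le_of_tendsto (hcont.tendsto.mono_left (nhdsWithin_le_nhds (s := Iio ρ))) ?_
  filter_upwards [Ico_mem_nhdsLT hρ] with r hr using hlt r hr

/-- The Joukowski map is invariant under `w ↦ w⁻¹`, which makes the function on the unit circle
even. -/
theorem fourierCoeff_circleFun_neg (G : ℂ → ℂ) (k : ℤ) :
    fourierCoeff (circleFun G 1) (-k) = fourierCoeff (circleFun G 1) k := by
  unfold fourierCoeff
  rw [← integral_neg_eq_self]
  refine integral_congr_ae (Filter.Eventually.of_forall fun t => ?_)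
  have h1 : ∀ n : ℤ, fourier n (-t) = fourier (-n) t := fun n => by
    simp [fourier_apply]
  have h2 : circleFun G 1 (-t) = circleFun G 1 t := by
    unfold circleFun joukowski
    have h3 : ∀ t : AddCircle (2 * Real.pi), fourier (-1) t = (fourier 1 t)⁻¹ := fun t => by
      rw [fourier_neg, fourier_apply, ← Circle.coe_inv_eq_conj, Circle.coe_inv]
    rw [h1, h3]
    simp [add_comm]
  simp only [h1, h2, neg_neg]

/-- The weights of the Chebyshev coefficients; `x = ρ⁻²` for the ellipse with parameter `ρ`. -/
noncomputable def coeffWeight (x : ℝ) (j : ℕ) : ℝ :=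
  if j = 0 then 1 else 4 * x ^ j / (1 + x ^ (2 * j))

theorem coeffWeight_pos {x : ℝ} (hx : 0 < x) (j : ℕ) : 0 < coeffWeight x j := by
  unfold coeffWeight
  split_ifs <;> positivity

theorem coeffWeight_le {x : ℝ} (hx : 0 < x) (j : ℕ) : coeffWeight x j ≤ 4 * x ^ j := by
  unfold coeffWeight
  split_ifs with h
  · subst h; norm_num
  · exact div_le_self (by positivity) (by linarith [pow_pos hx (2 * j)])

/-- Pairs `k` with `-k`, so that the inequality over finite sets of integers can be read as one over
Chebyshev indices. -/
theorem exists_sum_symm_eq (f : ℤ → ℝ) (n : ℕ) : ∃ s : Finset ℤ, s ⊆ Finset.Ioo (-(n : ℤ)) n ∧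
    ∑ j ∈ Finset.range n, (if j = 0 then f 0 else f j + f (-j)) = ∑ k ∈ s, f k := by
  induction n with
  | zero => exact ⟨∅, by simp, by simp⟩
  | succ n ih =>
    obtain ⟨s, hs, h⟩ := ih
    rcases Nat.eq_zero_or_pos n with rfl | hn
    · exact ⟨{0}, by simp, by simp⟩
    have h1 : (n : ℤ) ∉ s := fun h => by simpa using hs h
    have h2 : -(n : ℤ) ∉ s := fun h => by simpa using hs h
    refine ⟨insert (n : ℤ) (insert (-(n : ℤ)) s), ?_, ?_⟩
    · intro k hk
      simp only [Finset.mem_insert] at hk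
      simp only [Finset.mem_Ioo]
      rcases hk with rfl | rfl | hk
      · omega
      · omega
      · have := hs hk
        simp only [Finset.mem_Ioo] at this
        omega
    · rw [Finset.sum_range_succ, h, Finset.sum_insert, Finset.sum_insert h2, if_neg hn.ne']
      · ring
      · simp only [Finset.mem_insert, not_or]
        exact ⟨by omega, h1⟩

theorem exists_chebyshev_expansion {ρ B : ℝ} {G : ℂ → ℂ} (hρ : 1 < ρ)
    (hG : DifferentiableOn ℂ G (bernstein ρ)) (hB : ∀ z ∈ bernstein ρ, ‖G z‖ ≤ B) :
    ∃ a : ℕ → ℂ, (∀ θ : ℝ, HasSum (fun j => a j * (Real.cos (j * θ) : ℝ)) (G (Real.cos θ : ℝ))) ∧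
      ∀ n, ∑ j ∈ Finset.range n, ‖a j‖ ^ 2 / coeffWeight (ρ ^ (-2 : ℤ)) j ≤ B ^ 2 := by
  have hρ0 : 0 < ρ := by linarith
  have hB0 : 0 ≤ B := (norm_nonneg _).trans
    (hB _ (ofReal_mem_bernstein hρ (t := 0) (by simp)))
  set b : ℤ → ℂ := fourierCoeff (circleFun G 1) with hb
  have hneg : ∀ k, b (-k) = b k := fourierCoeff_circleFun_neg G
  have hbound : ∀ k : ℤ, ‖b k‖ ≤ B * ρ ^ (-k) := by
    intro k
    have h := sum_sq_coeff_mul_zpow_le hρ hG hB {k}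
    rw [Finset.sum_singleton, mul_comm 2 k, zpow_mul] at h
    norm_cast at h
    rw [← mul_pow] at h
    have h2 := abs_le_of_sq_le_sq h hB0
    rw [zpow_neg, ← div_eq_mul_inv, le_div_iff₀ (by positivity)]
    exact (le_abs_self _).trans h2
  have hsummable : Summable b := by
    have hgeo : Summable fun n : ℕ => B * ρ⁻¹ ^ n :=
      (summable_geometric_of_lt_one (by positivity) (inv_lt_one_of_one_lt₀ hρ)).mul_left B
    have h1 : Summable fun n : ℕ => b n := .of_norm_bounded hgeo fun n => by
      simpa using hbound n
    exact Summable.of_nat_of_neg h1 (by simpa only [hneg] using h1)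
  -- Merging the frequencies `j` and `-j` doubles all coefficients except the constant one. Hence
  -- `‖a j‖² (ρ^(2j) + ρ^(-2j)) / 4` appears for `j > 0` and `‖a 0‖²` for `j = 0`, which is the
  -- reason for the special value of `coeffWeight` at `0`.
  refine ⟨fun j => if j = 0 then b 0 else 2 * b j, fun θ => ?_, fun n => ?_⟩
  · have h := has_pointwise_sum_fourier_series_of_summable
      (f := ⟨circleFun G 1, continuous_circleFun hG le_rfl hρ⟩) hsummable (θ : AddCircle _)
    have h2 := h.nat_add_neg
    simp only [ContinuousMap.coe_mk, circleFun_coe] at h2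
    have hJ : joukowski (circleMap 0 (1 : ℝ) θ) = (Real.cos θ : ℝ) := by
      rw [joukowski, circleMap, Complex.ofReal_cos, Complex.cos, Complex.ofReal_one, zero_add,
        one_mul, ← Complex.exp_neg, neg_mul]
    rw [hJ] at h2
    have h3 := h2.sub (hasSum_ite_eq (0 : ℕ) (b 0))
    have hfun : (fun j : ℕ => (if j = 0 then b 0 else 2 * b j) * ((Real.cos (j * θ) : ℝ) : ℂ)) =
        fun j : ℕ => (b j • fourier (j : ℤ) (θ : AddCircle (2 * Real.pi)) +
          b (-j) • fourier (-(j : ℤ)) (θ : AddCircle (2 * Real.pi))) -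
          if j = 0 then b 0 else 0 := by
      funext j
      rcases Nat.eq_zero_or_pos j with rfl | hj
      · simp
      · have hpi : (Real.pi : ℂ) ≠ 0 := by exact_mod_cast Real.pi_ne_zero
        have e1 : (fourier (j : ℤ) (θ : AddCircle (2 * Real.pi)) : ℂ) =
            Complex.exp (j * θ * Complex.I) := by
          rw [fourier_coe_apply]; congr 1; push_cast; field_simp
        have e2 : (fourier (-(j : ℤ)) (θ : AddCircle (2 * Real.pi)) : ℂ) =
            Complex.exp (-(j * θ * Complex.I)) := by
          rw [fourier_coe_apply]; congr 1; push_cast; field_simp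
        rw [if_neg hj.ne', if_neg hj.ne', e1, e2, hneg, Complex.ofReal_cos, Complex.cos]
        simp only [smul_eq_mul]
        push_cast
        ring_nf
    rw [hfun]
    have h4 : G (Real.cos θ : ℝ) + fourierCoeff (circleFun G 1) 0 •
        fourier 0 (θ : AddCircle (2 * Real.pi)) - b 0 = G (Real.cos θ : ℝ) := by
      rw [fourier_zero, smul_eq_mul, mul_one, hb, add_sub_cancel_right]
    rw [h4] at h3
    exact h3
  · obtain ⟨s, -, hs⟩ := exists_sum_symm_eq (fun k => ‖b k‖ ^ 2 * ρ ^ (2 * k)) n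
    refine le_of_eq_of_le ?_ (hs.trans_le (sum_sq_coeff_mul_zpow_le hρ hG hB s))
    refine Finset.sum_congr rfl fun j _ => ?_
    unfold coeffWeight
    rcases eq_or_ne j 0 with hj | hj
    · simp [hj]
    · simp only [if_neg hj]
      rw [norm_mul, mul_pow, Complex.norm_two, hneg]
      have h1 : (ρ ^ (-2 : ℤ)) ^ j = (ρ ^ (2 * (j : ℤ)))⁻¹ := by
        rw [← zpow_natCast, ← zpow_mul, ← zpow_neg, neg_mul]
      have h2 : (ρ ^ (-2 : ℤ)) ^ (2 * j) = (ρ ^ (2 * (j : ℤ)))⁻¹ ^ 2 := by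
        rw [mul_comm 2 j, pow_mul, h1]
      have h3 : ρ ^ (2 * -(j : ℤ)) = (ρ ^ (2 * (j : ℤ)))⁻¹ := by
        rw [← zpow_neg, mul_neg]
      rw [h2, h1, h3]
      have h4 : 0 < ρ ^ (2 * (j : ℤ)) := by positivity
      field_simp
      ring

/-- Cauchy-Schwarz for linear functionals of holomorphic functions on a Bernstein ellipse. -/
theorem norm_functional_le {ρ B C : ℝ} {G : ℂ → ℂ} (hρ : 1 < ρ)
    (hG : DifferentiableOn ℂ G (bernstein ρ)) (hB : ∀ z ∈ bernstein ρ, ‖G z‖ ≤ B)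
    {ι : Type*} (s : Finset ι) (c : ι → ℝ) (θ : ι → ℝ) (hC : 0 ≤ C)
    (h : ∀ n, ∑ j ∈ Finset.range n, coeffWeight (ρ ^ (-2 : ℤ)) j *
      (∑ i ∈ s, c i * Real.cos (j * θ i)) ^ 2 ≤ C ^ 2) :
    ‖∑ i ∈ s, (c i : ℂ) * G (Real.cos (θ i) : ℝ)‖ ≤ B * C := by
  have hB0 : 0 ≤ B := (norm_nonneg _).trans
    (hB _ (ofReal_mem_bernstein hρ (t := 0) (by simp)))
  have hx : 0 < ρ ^ (-2 : ℤ) := by positivity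
  obtain ⟨a, ha, hs⟩ := exists_chebyshev_expansion hρ hG hB
  have hsum : HasSum (fun j => ∑ i ∈ s, (c i : ℂ) * (a j * (Real.cos (j * θ i) : ℝ)))
      (∑ i ∈ s, (c i : ℂ) * G (Real.cos (θ i) : ℝ)) :=
    hasSum_sum fun i _ => (ha (θ i)).mul_left _
  refine le_of_tendsto hsum.tendsto_sum_nat.norm (Filter.Eventually.of_forall fun n => ?_)
  have h1 : ∀ j, ∑ i ∈ s, (c i : ℂ) * (a j * (Real.cos (j * θ i) : ℝ)) =
      a j * ((∑ i ∈ s, c i * Real.cos (j * θ i) : ℝ) : ℂ) := fun j => by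
    push_cast
    rw [Finset.mul_sum]
    exact Finset.sum_congr rfl fun i _ => by ring
  calc _ ≤ ∑ j ∈ Finset.range n, ‖a j‖ * |∑ i ∈ s, c i * Real.cos (j * θ i)| := by
        refine (norm_sum_le _ _).trans (Finset.sum_le_sum fun j _ => ?_)
        rw [h1, norm_mul, Complex.norm_real, Real.norm_eq_abs]
    _ = ∑ j ∈ Finset.range n, (‖a j‖ / √(coeffWeight (ρ ^ (-2 : ℤ)) j)) *
          (√(coeffWeight (ρ ^ (-2 : ℤ)) j) * |∑ i ∈ s, c i * Real.cos (j * θ i)|) := by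
        refine Finset.sum_congr rfl fun j _ => ?_
        have := Real.sqrt_pos.mpr (coeffWeight_pos hx j)
        generalize √(coeffWeight (ρ ^ (-2 : ℤ)) j) = q at this ⊢
        field_simp
    _ ≤ √(∑ j ∈ Finset.range n, (‖a j‖ / √(coeffWeight (ρ ^ (-2 : ℤ)) j)) ^ 2) *
          √(∑ j ∈ Finset.range n, (√(coeffWeight (ρ ^ (-2 : ℤ)) j) *
            |∑ i ∈ s, c i * Real.cos (j * θ i)|) ^ 2) := Real.sum_mul_le_sqrt_mul_sqrt _ _ _
    _ ≤ B * C := by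
        gcongr
        · refine Real.sqrt_le_iff.mpr ⟨hB0, le_of_eq_of_le (Finset.sum_congr rfl fun j _ => ?_) (hs n)⟩
          rw [div_pow, Real.sq_sqrt (coeffWeight_pos hx j).le]
        · refine Real.sqrt_le_iff.mpr ⟨hC, le_of_eq_of_le (Finset.sum_congr rfl fun j _ => ?_) (h n)⟩
          rw [mul_pow, Real.sq_sqrt (coeffWeight_pos hx j).le, sq_abs]

/-! ### Chebyshev points, aliasing and the Lagrange basis -/

theorem chebNode_injective {N : ℕ} (hN : 1 ≤ N) : Function.Injective (chebNode N) := by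
  intro a b h
  have hN0 : (0 : ℝ) < N := by exact_mod_cast hN
  have hmem : ∀ k : Fin (N + 1), Real.pi * (k : ℕ) / N ∈ Set.Icc 0 Real.pi := fun k => by
    have : ((k : ℕ) : ℝ) ≤ N := by exact_mod_cast Nat.lt_succ_iff.mp k.2
    constructor
    · positivity
    · rw [div_le_iff₀ hN0]
      exact mul_le_mul_of_nonneg_left this Real.pi_pos.le
  have h1 := Real.injOn_cos (hmem a) (hmem b) h
  have hpi := Real.pi_ne_zero
  field_simp at h1
  exact Fin.ext (by exact_mod_cast h1)

theorem sum_eval_mul_basis {N : ℕ} (hN : 1 ≤ N) {p : Polynomial ℝ}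
    (hp : p.degree < (N + 1 : ℕ)) (z : ℝ) :
    ∑ k, p.eval (chebNode N k) * (Lagrange.basis Finset.univ (chebNode N) k).eval z = p.eval z := by
  conv_rhs => rw [Lagrange.eq_interpolate (s := Finset.univ) (v := chebNode N)
    (chebNode_injective hN).injOn (f := p) (by simpa using hp)]
  rw [Lagrange.interpolate_apply, Polynomial.eval_finsetSum]
  simp

theorem T_degree_lt {N : ℕ} {m : ℤ} (hm : |m| ≤ N) :
    (Polynomial.Chebyshev.T ℝ m).degree < (N + 1 : ℕ) := by
  rw [Polynomial.Chebyshev.degree_T]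
  have : m.natAbs < N + 1 := by have := abs_le.mp hm; omega
  exact_mod_cast this

/-- Aliasing: interpolation of `T_j` gives `T_m` if `j - m` is a multiple of `2 N`. -/
theorem sum_cos_mul_basis {N : ℕ} (hN : 1 ≤ N) (j q : ℤ) (hm : |j - 2 * q * N| ≤ N) (θ : ℝ) :
    ∑ k : Fin (N + 1), Real.cos (j * (Real.pi * (k : ℕ) / N)) *
      (Lagrange.basis Finset.univ (chebNode N) k).eval (Real.cos θ) =
      Real.cos ((j - 2 * q * N) * θ) := by
  have h := sum_eval_mul_basis hN (T_degree_lt hm) (Real.cos θ)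
  rw [Polynomial.Chebyshev.T_real_cos] at h
  push_cast at h
  rw [← h]
  refine Finset.sum_congr rfl fun k _ => ?_
  rw [chebNode, Polynomial.Chebyshev.T_real_cos]
  congr 1
  have hN0 : (N : ℝ) ≠ 0 := by positivity
  have : ((j - 2 * q * N : ℤ) : ℝ) * (Real.pi * (k : ℕ) / N) =
      j * (Real.pi * (k : ℕ) / N) - ((q * k : ℤ) : ℝ) * (2 * Real.pi) := by
    push_cast
    field_simp
  rw [this, Real.cos_sub_int_mul_two_pi]

/-- The kernel of trigonometric interpolation at `2 N` points. -/
noncomputable def dker (N : ℕ) (α : ℝ) : ℝ :=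
  ∑ j ∈ Finset.range (N + 1), (if 0 < j ∧ j < N then 2 else 1) * Real.cos (j * α)

theorem sum_range_ends {N : ℕ} (hN : 1 ≤ N) (a b : ℝ) (g : ℕ → ℝ) :
    ∑ j ∈ Finset.range (N + 1), (if 0 < j ∧ j < N then a else b) * g j =
      a * ∑ j ∈ Finset.range N, g j + (b - a) * g 0 + b * g N := by
  obtain ⟨M, rfl⟩ : ∃ M, N = M + 1 := ⟨N - 1, by omega⟩
  rw [Finset.sum_range_succ, Finset.sum_range_succ', Finset.sum_range_succ' (fun j => g j)]
  have : ∑ k ∈ Finset.range M, (if 0 < k + 1 ∧ k + 1 < M + 1 then a else b) * g (k + 1) =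
      a * ∑ k ∈ Finset.range M, g (k + 1) := by
    rw [Finset.mul_sum]
    refine Finset.sum_congr rfl fun k hk => ?_
    rw [if_pos ⟨by omega, by simpa using hk⟩]
  rw [this]
  simp
  ring

theorem dker_eq {N : ℕ} (hN : 1 ≤ N) (α : ℝ) :
    dker N α = 2 * ∑ j ∈ Finset.range N, Real.cos (j * α) - 1 + Real.cos (N * α) := by
  unfold dker
  rw [sum_range_ends hN]
  simp
  ring

/-- Closed form `dker N α = sin(N α) cot(α / 2)`, by telescoping, written without division. -/
theorem sin_mul_dker {N : ℕ} (hN : 1 ≤ N) (α : ℝ) :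
    Real.sin (α / 2) * dker N α = Real.sin (N * α) * Real.cos (α / 2) := by
  have h : ∀ n : ℕ, Real.sin (α / 2) * (2 * ∑ j ∈ Finset.range n, Real.cos (j * α) - 1) =
      Real.sin (n * α - α / 2) := by
    intro n
    induction n with
    | zero => simp
    | succ n ih =>
      rw [Finset.sum_range_succ]
      have e : Real.sin (((n + 1 : ℕ) : ℝ) * α - α / 2) = Real.sin (n * α - α / 2) +
          2 * Real.sin (α / 2) * Real.cos (n * α) := by
        have e1 : ((n + 1 : ℕ) : ℝ) * α - α / 2 = n * α + α / 2 := by push_cast; ring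
        rw [e1, Real.sin_add, Real.sin_sub]; ring
      rw [e, ← ih]; ring
  rw [dker_eq hN, mul_add, h, Real.sin_sub]
  ring

theorem dker_zero {N : ℕ} (hN : 1 ≤ N) : dker N 0 = 2 * N := by
  rw [dker_eq hN]
  simp

theorem dker_periodic (N : ℕ) : Function.Periodic (dker N) (2 * Real.pi) := by
  intro α
  unfold dker
  refine Finset.sum_congr rfl fun j _ => ?_
  rw [mul_add, Real.cos_add_nat_mul_two_pi]

theorem dker_neg (N : ℕ) (α : ℝ) : dker N (-α) = dker N α := by
  unfold dker
  refine Finset.sum_congr rfl fun j _ => ?_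
  rw [mul_neg, Real.cos_neg]

theorem dker_node {N : ℕ} (hN : 1 ≤ N) {m : ℤ} (h0 : m ≠ 0) (hm : |m| < 2 * N) :
    dker N (Real.pi * m / N) = 0 := by
  have h := sin_mul_dker hN (Real.pi * m / N)
  have hN0 : (0 : ℝ) < N := by exact_mod_cast hN
  have h1 : (N : ℝ) * (Real.pi * m / N) = m * Real.pi := by field_simp
  rw [h1, Real.sin_int_mul_pi, zero_mul, mul_eq_zero] at h
  refine h.resolve_left fun h2 => ?_
  obtain ⟨n, hn⟩ := Real.sin_eq_zero_iff.mp h2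
  have h3 : (m : ℝ) = 2 * N * n := by
    have hpi := Real.pi_pos
    field_simp at hn
    linarith
  have h4 : m = 2 * N * n := by exact_mod_cast h3
  have h5 : n ≠ 0 := by rintro rfl; simp at h4; exact h0 h4
  have h6 : 1 ≤ |n| := Int.one_le_abs h5
  rw [h4, abs_mul, abs_of_nonneg (by positivity : (0 : ℤ) ≤ 2 * N)] at hm
  nlinarith

/-- The weights of the trapezoidal rule. -/
noncomputable def trapWeight (N k : ℕ) : ℝ := if k = 0 ∨ k = N then 1 / 2 else 1

theorem trapWeight_pos (N k : ℕ) : 0 < trapWeight N k := by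
  unfold trapWeight; split_ifs <;> norm_num

/-- The kernel vanishes at the nonzero multiples of `π / N` modulo `2π`. For `m = k` only the first
kernel contributes, except at the two end points, where both do; the weight `1 / 2` compensates. -/
theorem trapWeight_mul_dker {N : ℕ} (hN : 1 ≤ N) (k m : Fin (N + 1)) :
    trapWeight N k / (2 * N) * (dker N (Real.pi * (m : ℕ) / N - Real.pi * (k : ℕ) / N) +
      dker N (Real.pi * (m : ℕ) / N + Real.pi * (k : ℕ) / N)) = if m = k then 1 else 0 := by
  have hN0 : (0 : ℝ) < N := by exact_mod_cast hN
  have hk := Nat.lt_succ_iff.mp k.2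
  have hm := Nat.lt_succ_iff.mp m.2
  have e1 : Real.pi * (m : ℕ) / N - Real.pi * (k : ℕ) / N =
      Real.pi * (((m : ℕ) - (k : ℕ) : ℤ) : ℝ) / N := by push_cast; ring
  have e2 : Real.pi * (m : ℕ) / N + Real.pi * (k : ℕ) / N =
      Real.pi * (((m : ℕ) + (k : ℕ) : ℤ) : ℝ) / N := by push_cast; ring
  rw [e1, e2]
  split_ifs with h
  · subst h
    have e3 : dker N (Real.pi * (((m : ℕ) - (m : ℕ) : ℤ) : ℝ) / N) = 2 * N := by
      rw [sub_self]; simp [dker_zero hN]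
    rw [e3]
    unfold trapWeight
    split_ifs with h0
    · have e4 : dker N (Real.pi * (((m : ℕ) + (m : ℕ) : ℤ) : ℝ) / N) = 2 * N := by
        rcases h0 with h0 | h0
        · rw [h0]; simp [dker_zero hN]
        · rw [h0, ← dker_zero hN, ← dker_periodic N 0]
          congr 1
          push_cast
          field_simp
          ring
      rw [e4]
      field_simp
      norm_num
    · rw [dker_node hN]
      · field_simp; ring
      · omega
      · rw [abs_of_nonneg] <;> omega
  · have h' : (m : ℕ) ≠ (k : ℕ) := fun e => h (Fin.ext e)
    rw [dker_node hN, dker_node hN]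
    · simp
    · omega
    · rw [abs_of_nonneg] <;> omega
    · omega
    · rw [abs_lt]; omega

theorem sum_T_mul_T_cos {N : ℕ} (hN : 1 ≤ N) (k : Fin (N + 1)) (θ : ℝ) :
    ∑ j : Fin (N + 1), (if 0 < (j : ℕ) ∧ (j : ℕ) < N then (2 : ℝ) else 1) / N *
      trapWeight N k * (Polynomial.Chebyshev.T ℝ ((j : ℕ) : ℤ)).eval (chebNode N k) *
      (Polynomial.Chebyshev.T ℝ ((j : ℕ) : ℤ)).eval (Real.cos θ) =
      trapWeight N k / (2 * N) * (dker N (θ - Real.pi * (k : ℕ) / N) +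
        dker N (θ + Real.pi * (k : ℕ) / N)) := by
  have hN0 : (0 : ℝ) < N := by exact_mod_cast hN
  unfold dker
  rw [← Finset.sum_add_distrib, Finset.mul_sum, Finset.sum_range]
  refine Finset.sum_congr rfl fun j _ => ?_
  rw [chebNode, Polynomial.Chebyshev.T_real_cos, Polynomial.Chebyshev.T_real_cos, mul_sub,
    Real.cos_sub, mul_add ((j : ℕ) : ℝ) θ, Real.cos_add]
  push_cast
  field_simp
  ring

/-- The Lagrange polynomials of the Chebyshev points in terms of Chebyshev polynomials. -/
theorem sum_T_mul_T {N : ℕ} (hN : 1 ≤ N) (k : Fin (N + 1)) (z : ℝ) :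
    ∑ j : Fin (N + 1), (if 0 < (j : ℕ) ∧ (j : ℕ) < N then (2 : ℝ) else 1) / N *
      trapWeight N k * (Polynomial.Chebyshev.T ℝ ((j : ℕ) : ℤ)).eval (chebNode N k) *
      (Polynomial.Chebyshev.T ℝ ((j : ℕ) : ℤ)).eval z =
      (Lagrange.basis Finset.univ (chebNode N) k).eval z := by
  set p : Polynomial ℝ := ∑ j : Fin (N + 1),
    Polynomial.C ((if 0 < (j : ℕ) ∧ (j : ℕ) < N then (2 : ℝ) else 1) / N *
      trapWeight N k * (Polynomial.Chebyshev.T ℝ ((j : ℕ) : ℤ)).eval (chebNode N k)) *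
      Polynomial.Chebyshev.T ℝ ((j : ℕ) : ℤ) with hp
  have hpe : ∀ z, p.eval z = ∑ j : Fin (N + 1),
      (if 0 < (j : ℕ) ∧ (j : ℕ) < N then (2 : ℝ) else 1) / N *
      trapWeight N k * (Polynomial.Chebyshev.T ℝ ((j : ℕ) : ℤ)).eval (chebNode N k) *
      (Polynomial.Chebyshev.T ℝ ((j : ℕ) : ℤ)).eval z := fun z => by
    rw [hp, Polynomial.eval_finsetSum]
    simp
  have hdeg : p.degree < (N + 1 : ℕ) := by
    rw [hp, ← Polynomial.mem_degreeLT]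
    refine Submodule.sum_mem _ fun j _ => ?_
    rw [← Polynomial.smul_eq_C_mul]
    refine Submodule.smul_mem _ _ (Polynomial.mem_degreeLT.mpr (T_degree_lt ?_))
    have := j.2
    rw [abs_of_nonneg] <;> omega
  rw [← hpe, ← sum_eval_mul_basis hN hdeg z]
  have : ∀ m, p.eval (chebNode N m) = if m = k then 1 else 0 := fun m => by
    rw [hpe, show chebNode N m = Real.cos (Real.pi * (m : ℕ) / N) from rfl, sum_T_mul_T_cos hN, trapWeight_mul_dker hN]
  simp [this]

theorem basis_eval_cos {N : ℕ} (hN : 1 ≤ N) (k : Fin (N + 1)) (θ : ℝ) :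
    (Lagrange.basis Finset.univ (chebNode N) k).eval (Real.cos θ) =
      trapWeight N k / (2 * N) * (dker N (θ - Real.pi * (k : ℕ) / N) +
        dker N (θ + Real.pi * (k : ℕ) / N)) := by
  rw [← sum_T_mul_T hN, sum_T_mul_T_cos hN]

/-! ### Sharp upper bounds for the Lebesgue function -/

theorem sum_trapWeight_mul {N : ℕ} (hN : 1 ≤ N) (g : ℕ → ℝ) :
    ∑ k ∈ Finset.range (N + 1), trapWeight N k * g k =
      ∑ k ∈ Finset.range N, g k - g 0 / 2 + g N / 2 := by
  have h := sum_range_ends hN 1 (1 / 2) g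
  have h2 : ∑ k ∈ Finset.range (N + 1), trapWeight N k * g k =
      ∑ j ∈ Finset.range (N + 1), (if 0 < j ∧ j < N then (1 : ℝ) else 1 / 2) * g j := by
    refine Finset.sum_congr rfl fun k hk => ?_
    have := Finset.mem_range.mp hk
    congr 1
    unfold trapWeight
    split_ifs with h1 h2 <;> first | rfl | omega
  rw [h2, h]
  ring

theorem sum_range_two_mul {N : ℕ} (hN : 1 ≤ N) {f : ℝ → ℝ} (hf : Function.Periodic f (2 * Real.pi))
    (θ : ℝ) : ∑ k ∈ Finset.range (2 * N), f (θ + Real.pi * k / N) =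
      ∑ k ∈ Finset.range N, (f (θ + Real.pi * k / N) + f (θ - Real.pi * (k + 1) / N)) := by
  have hN0 : (0 : ℝ) < N := by exact_mod_cast hN
  rw [two_mul, Finset.sum_range_add, Finset.sum_add_distrib]
  congr 1
  rw [← Finset.sum_range_reflect]
  refine Finset.sum_congr rfl fun k hk => ?_
  have hk' := Finset.mem_range.mp hk
  rw [← hf (θ - Real.pi * (k + 1) / N)]
  congr 1
  have : ((N + (N - 1 - k) : ℕ) : ℝ) = 2 * N - (k + 1) := by
    have : N + (N - 1 - k) + (k + 1) = 2 * N := by omega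
    rw [eq_sub_iff_add_eq]
    exact_mod_cast this
  rw [this]
  field_simp
  ring

/-- After the triangle inequality in `basis_eval_cos`, the angles `±π k / N` run through the `2 N`
equidistant points of the circle; the half weights prevent `0` and `π` from being counted twice. -/
theorem sum_abs_basis_le {N : ℕ} (hN : 1 ≤ N) (θ : ℝ) :
    ∑ k, |(Lagrange.basis Finset.univ (chebNode N) k).eval (Real.cos θ)| ≤
      (∑ k ∈ Finset.range (2 * N), |dker N (θ + Real.pi * k / N)|) / (2 * N) := by
  have hN0 : (0 : ℝ) < N := by exact_mod_cast hN
  have hper : Function.Periodic (fun t => |dker N t|) (2 * Real.pi) := fun t => by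
    simp only [dker_periodic N t]
  rw [sum_range_two_mul hN hper]
  have h1 : ∀ k : Fin (N + 1), |(Lagrange.basis Finset.univ (chebNode N) k).eval (Real.cos θ)| ≤
      (trapWeight N k * (|dker N (θ - Real.pi * (k : ℕ) / N)| +
        |dker N (θ + Real.pi * (k : ℕ) / N)|)) / (2 * N) := fun k => by
    have := trapWeight_pos N k
    have hw : 0 ≤ trapWeight N k / (2 * N) := by positivity
    rw [basis_eval_cos hN, abs_mul, abs_of_nonneg hw]
    exact (mul_le_mul_of_nonneg_left (abs_add_le _ _) hw).trans (le_of_eq (by ring))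
  refine (Finset.sum_le_sum fun k _ => h1 k).trans ?_
  rw [← Finset.sum_div]
  refine le_of_eq ?_
  congr 1
  have h2 := sum_trapWeight_mul hN (fun k => |dker N (θ - Real.pi * k / N)| +
    |dker N (θ + Real.pi * k / N)|)
  rw [Finset.sum_range] at h2
  rw [h2]
  have h3 : Real.pi * (N : ℝ) / N = Real.pi := by field_simp
  have h4 : |dker N (θ + Real.pi)| = |dker N (θ - Real.pi)| := by
    rw [← dker_periodic N (θ - Real.pi)]; ring_nf
  have h5 : ∑ k ∈ Finset.range N, |dker N (θ - Real.pi * (k + 1) / N)| =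
      ∑ k ∈ Finset.range N, |dker N (θ - Real.pi * k / N)| - |dker N θ| +
        |dker N (θ - Real.pi)| := by
    have h6 := Finset.sum_range_succ (fun k : ℕ => |dker N (θ - Real.pi * k / N)|) N
    rw [Finset.sum_range_succ'] at h6
    simp only [h3, Nat.cast_zero, mul_zero, zero_div, sub_zero, Nat.cast_add, Nat.cast_one] at h6
    linarith
  rw [Finset.sum_add_distrib, Finset.sum_add_distrib, h5, h3, h4]
  simp
  ring

/-- This is `y cot y ≤ 1 - y² / 3`. The difference of the two sides vanishes at `0` and has
derivative `y / 3 * (sin y - y cos y) ≥ 0`. The quadratic term is what yields the `-π / 12` in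
`lebesgueBound`. -/
theorem mul_cos_le_sin_mul {y : ℝ} (h0 : 0 ≤ y) (h1 : y ≤ Real.pi / 2) :
    y * Real.cos y ≤ Real.sin y * (1 - y ^ 2 / 3) := by
  have hpi := Real.pi_pos
  have htan : ∀ x ∈ Ioo 0 (Real.pi / 2), x * Real.cos x ≤ Real.sin x := fun x hx => by
    have h := (Real.lt_tan hx.1 hx.2).le
    have hc : 0 < Real.cos x := Real.cos_pos_of_mem_Ioo ⟨by linarith [hx.1], hx.2⟩
    rwa [Real.tan_eq_sin_div_cos, le_div_iff₀ hc] at h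
  have hder : ∀ x, HasDerivAt (fun y : ℝ => Real.sin y * (1 - y ^ 2 / 3) - y * Real.cos y)
      (x / 3 * (Real.sin x - x * Real.cos x)) x := fun x => by
    have h := ((Real.hasDerivAt_sin x).mul
      (((hasDerivAt_id x).pow 2).div_const 3 |>.const_sub 1)).sub
      ((hasDerivAt_id x).mul (Real.hasDerivAt_cos x))
    refine h.congr_deriv ?_
    simp
    ring
  have hmono : MonotoneOn (fun y : ℝ => Real.sin y * (1 - y ^ 2 / 3) - y * Real.cos y)
      (Icc 0 (Real.pi / 2)) := by
    refine monotoneOn_of_deriv_nonneg (convex_Icc _ _)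
      (fun x _ => (hder x).continuousAt.continuousWithinAt)
      (fun x _ => (hder x).differentiableAt.differentiableWithinAt) fun x hx => ?_
    rw [interior_Icc] at hx
    rw [(hder x).deriv]
    exact mul_nonneg (by linarith [hx.1]) (sub_nonneg.mpr (htan x hx))
  have := hmono ⟨le_rfl, by positivity⟩ ⟨h0, h1⟩ h0
  simp at this
  linarith

theorem abs_dker_le {N : ℕ} (hN : 1 ≤ N) {t : ℝ} (h0 : 0 < t) (h1 : t ≤ Real.pi) :
    |dker N t| ≤ |Real.sin (N * t)| * (2 / t - t / 6) := by
  have hs : 0 < Real.sin (t / 2) := Real.sin_pos_of_pos_of_lt_pi (by linarith) (by linarith)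
  have hc : 0 ≤ Real.cos (t / 2) := Real.cos_nonneg_of_mem_Icc ⟨by linarith, by linarith⟩
  have h2 := mul_cos_le_sin_mul (y := t / 2) (by linarith) (by linarith)
  have h3 : Real.sin (t / 2) * |dker N t| = |Real.sin (N * t)| * Real.cos (t / 2) := by
    have := congrArg abs (sin_mul_dker hN t)
    rwa [abs_mul, abs_mul, abs_of_pos hs, abs_of_nonneg hc] at this
  refine le_of_mul_le_mul_left ?_ hs
  rw [h3, mul_left_comm]
  refine mul_le_mul_of_nonneg_left ?_ (abs_nonneg _)
  have h4 : Real.sin (t / 2) * (2 / t - t / 6) =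
      Real.sin (t / 2) * (1 - (t / 2) ^ 2 / 3) * (2 / t) := by
    field_simp
    ring
  rw [h4]
  calc Real.cos (t / 2) = t / 2 * Real.cos (t / 2) * (2 / t) := by field_simp
    _ ≤ _ := by gcongr

theorem sin_pi_mul_le {u : ℝ} (h0 : 0 ≤ u) (h1 : u ≤ 1) :
    Real.sin (Real.pi * u) ≤ 4 * (u * (1 - u)) := by
  wlog hu : u ≤ 1 / 2 generalizing u
  · have h := this (u := 1 - u) (by linarith) (by linarith) (by linarith)
    rw [mul_sub, mul_one, Real.sin_pi_sub] at h
    linarith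
  have hpi := Real.pi_pos
  -- half-angle formula and the chord of `sin` on `[0, π / 4]`
  have hq : √2 * (1 - 2 * u) / 2 ≤ Real.sin (Real.pi / 4 * (1 - 2 * u)) := by
    have h := strictConcaveOn_sin_Icc.concaveOn.2 (⟨le_rfl, hpi.le⟩ : (0 : ℝ) ∈ Icc 0 Real.pi)
      (⟨by positivity, by linarith⟩ : Real.pi / 4 ∈ Icc 0 Real.pi)
      (by linarith : 0 ≤ 2 * u) (by linarith : 0 ≤ 1 - 2 * u) (by ring)
    simp only [smul_eq_mul, Real.sin_zero, mul_zero, zero_add, Real.sin_pi_div_four] at h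
    rw [mul_comm (Real.pi / 4)]
    linarith
  have h2 : Real.sin (Real.pi * u) = 1 - 2 * Real.sin (Real.pi / 4 * (1 - 2 * u)) ^ 2 := by
    rw [← Real.cos_pi_div_two_sub]
    have e : Real.pi / 2 - Real.pi * u = 2 * (Real.pi / 4 * (1 - 2 * u)) := by ring
    rw [e, Real.cos_two_mul]
    have := Real.sin_sq_add_cos_sq (Real.pi / 4 * (1 - 2 * u))
    linarith
  have h3 : (√2 * (1 - 2 * u) / 2) ^ 2 ≤ Real.sin (Real.pi / 4 * (1 - 2 * u)) ^ 2 :=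
    pow_le_pow_left₀ (by have : 0 ≤ 1 - 2 * u := by linarith
                         positivity) hq 2
  have h4 : (√2 * (1 - 2 * u) / 2) ^ 2 = (1 - 2 * u) ^ 2 / 2 := by
    rw [div_pow, mul_pow, Real.sq_sqrt (by norm_num)]; ring
  rw [h2]
  nlinarith

/-- An upper bound for the Lebesgue constant of `N + 1` Chebyshev points. -/
noncomputable def lebesgueBound (N : ℕ) : ℝ :=
  if N = 1 then 1 else
    4 / Real.pi * ∑ k ∈ Finset.range N, 1 / (2 * k + 1 : ℝ) - Real.pi / 12

/-- With `q = u (1 - u)`, the bound `sin(π u) ≤ 4 q` leaves `4 q (2k + 1) / (k (k + 1) + q)`. This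
increases in `q ≤ 1 / 4` and attains the right-hand side at `u = 1 / 2`. -/
theorem sin_mul_add_inv_le {u : ℝ} (h0 : 0 < u) (h1 : u < 1) (k : ℕ) :
    Real.sin (Real.pi * u) * (1 / (k + u) + 1 / (k + 1 - u)) ≤ 4 / (2 * k + 1) := by
  have hk : (0 : ℝ) ≤ k := Nat.cast_nonneg k
  have ha : 0 < k + u := by linarith
  have hb : 0 < k + 1 - u := by linarith
  have hs := sin_pi_mul_le h0.le h1.le
  calc _ ≤ 4 * (u * (1 - u)) * (1 / (k + u) + 1 / (k + 1 - u)) := by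
        gcongr
    _ ≤ _ := by
        rw [div_add_div _ _ ha.ne' hb.ne', mul_div_assoc', div_le_div_iff₀ (by positivity)
          (by positivity)]
        nlinarith [mul_nonneg hk (sq_nonneg (2 * u - 1)), sq_nonneg (2 * u - 1),
          mul_nonneg (mul_nonneg hk hk) (sq_nonneg (2 * u - 1))]

/-- The worst offset is the midpoint `u = 1 / 2`. All terms of the sum are maximal there, but
`-sin(π u) π / 12` is minimal there, so it has to be estimated jointly with one of them. -/
theorem sum_basis_offset_le {N : ℕ} (hN : 2 ≤ N) {u : ℝ} (h0 : 0 < u) (h1 : u < 1) :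
    Real.sin (Real.pi * u) * ((∑ k ∈ Finset.range N, (1 / (k + u) + 1 / (k + 1 - u))) / Real.pi -
      Real.pi / 12) ≤ lebesgueBound N := by
  have hpi := Real.pi_pos
  have hpi4 := Real.pi_lt_d2
  have hs := sin_pi_mul_le h0.le h1.le
  obtain ⟨M, rfl⟩ : ∃ M, N = M + 2 := ⟨N - 2, by omega⟩
  have hrest : ∀ g : ℕ → ℝ, ∑ k ∈ Finset.range (M + 2), g k =
      ∑ k ∈ Finset.range M, g (k + 2) + g 1 + g 0 := fun g => by
    rw [Finset.sum_range_succ', Finset.sum_range_succ']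
  rw [lebesgueBound, if_neg (by omega), hrest, hrest]
  have hA : ∀ k : ℕ, Real.sin (Real.pi * u) * (1 / (k + u) + 1 / (k + 1 - u)) / Real.pi ≤
      4 / Real.pi * (1 / (2 * k + 1)) := fun k => by
    have := div_le_div_of_nonneg_right (sin_mul_add_inv_le h0 h1 k) hpi.le
    refine this.trans (le_of_eq ?_)
    field_simp
  -- The term `k = 1` absorbs `-π / 12`; this is where `N ≥ 2` is needed. The bracket is
  -- nonnegative, so `sin(π u) ≤ 4 q` applies to it as a whole.
  have hB : Real.sin (Real.pi * u) * ((1 / ((1 : ℕ) + u) + 1 / ((1 : ℕ) + 1 - u)) / Real.pi -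
      Real.pi / 12) ≤ 4 / Real.pi * (1 / (2 * (1 : ℕ) + 1)) - Real.pi / 12 := by
    set q := u * (1 - u) with hq
    have hq0 : 0 < q := mul_pos h0 (by linarith)
    have hq1 : q ≤ 1 / 4 := by nlinarith [sq_nonneg (2 * u - 1)]
    have e : 1 / (((1 : ℕ) : ℝ) + u) + 1 / (((1 : ℕ) : ℝ) + 1 - u) = 3 / (2 + q) := by
      have : (2 - u) ≠ 0 := by linarith
      have : (1 + u) ≠ 0 := by linarith
      have h2q : 2 + u * (1 - u) ≠ 0 := by nlinarith
      rw [hq]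
      push_cast
      rw [show (1 : ℝ) + 1 - u = 2 - u by ring]
      field_simp
      ring
    have hpos : 0 ≤ 3 / (2 + q) / Real.pi - Real.pi / 12 := by
      rw [sub_nonneg, div_div, div_le_div_iff₀ (by norm_num) (by positivity)]
      have : Real.pi * Real.pi ≤ 10 := by nlinarith
      nlinarith
    rw [e]
    refine (mul_le_mul_of_nonneg_right hs hpos).trans ?_
    have key : 4 / Real.pi * (1 / (2 * ((1 : ℕ) : ℝ) + 1)) - Real.pi / 12 -
        4 * q * (3 / (2 + q) / Real.pi - Real.pi / 12) =
        (1 / 4 - q) * (32 - Real.pi ^ 2 * (2 + q)) / (3 * Real.pi * (2 + q)) := by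
      field_simp
      push_cast
      ring
    have : 0 ≤ (1 / 4 - q) * (32 - Real.pi ^ 2 * (2 + q)) / (3 * Real.pi * (2 + q)) := by
      have : Real.pi ^ 2 * (2 + q) ≤ 32 := by nlinarith
      exact div_nonneg (mul_nonneg (by linarith) (by linarith)) (by positivity)
    linarith
  have hC : ∑ k ∈ Finset.range M, Real.sin (Real.pi * u) *
      (1 / (((k + 2 : ℕ) : ℝ) + u) + 1 / (((k + 2 : ℕ) : ℝ) + 1 - u)) / Real.pi ≤
      ∑ k ∈ Finset.range M, 4 / Real.pi * (1 / (2 * ((k + 2 : ℕ) : ℝ) + 1)) :=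
    Finset.sum_le_sum fun k _ => hA (k + 2)
  rw [← Finset.sum_div, ← Finset.mul_sum, ← Finset.mul_sum] at hC
  have h00 := hA 0
  refine le_of_eq_of_le ?_ ((add_le_add (add_le_add hC hB) h00).trans_eq ?_)
  · ring
  · ring

/-- Modulo `2π` the `2 N` points lie at distances `π (k + u) / N` and `π (k + 1 - u) / N` from `0`,
all at most `π`, and `|sin(N ·)|` equals `sin(π u)` at each. The linear terms of `abs_dker_le` sum
to `π N / 6`, hence to `π / 12` after division by `2 N`. -/
theorem sum_abs_dker_le {N : ℕ} (hN : 2 ≤ N) {u : ℝ} (h0 : 0 < u) (h1 : u < 1) :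
    (∑ k ∈ Finset.range (2 * N), |dker N (Real.pi / N * u + Real.pi * k / N)|) / (2 * N) ≤
      lebesgueBound N := by
  have hpi := Real.pi_pos
  have hN0 : (0 : ℝ) < N := by positivity
  have hper : Function.Periodic (fun t => |dker N t|) (2 * Real.pi) := fun t => by
    simp only [dker_periodic N t]
  rw [sum_range_two_mul (by omega) hper]
  have hsin : 0 ≤ Real.sin (Real.pi * u) :=
    Real.sin_nonneg_of_nonneg_of_le_pi (by positivity) (by nlinarith)
  have hk : ∀ k ∈ Finset.range N, |dker N (Real.pi / N * u + Real.pi * k / N)| +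
      |dker N (Real.pi / N * u - Real.pi * (k + 1) / N)| ≤
      Real.sin (Real.pi * u) * ((1 / (k + u) + 1 / (k + 1 - u)) * (2 * N / Real.pi) -
        Real.pi / (6 * N) * (2 * k + 1)) := fun k hk => by
    have hkN : (k : ℝ) + 1 ≤ N := by exact_mod_cast Finset.mem_range.mp hk
    have hk0 : (0 : ℝ) ≤ k := Nat.cast_nonneg k
    have ha : 0 < k + u := by linarith
    have hb : 0 < k + 1 - u := by linarith
    have e1 : Real.pi / N * u + Real.pi * k / N = Real.pi / N * (k + u) := by ring
    have e2 : Real.pi / N * u - Real.pi * (k + 1) / N = -(Real.pi / N * (k + 1 - u)) := by ring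
    have hle : ∀ c : ℝ, c ≤ N → Real.pi / N * c ≤ Real.pi := fun c hc => by
      rw [div_mul_eq_mul_div, div_le_iff₀ hN0]
      gcongr
    have d1 := abs_dker_le (N := N) (by omega) (t := Real.pi / N * (k + u)) (by positivity)
      (hle _ (by linarith))
    have d2 := abs_dker_le (N := N) (by omega) (t := Real.pi / N * (k + 1 - u)) (by positivity)
      (hle _ (by linarith))
    have s1 : |Real.sin (N * (Real.pi / N * (k + u)))| = Real.sin (Real.pi * u) := by
      have : (N : ℝ) * (Real.pi / N * (k + u)) = Real.pi * u + k * Real.pi := by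
        field_simp; ring
      rw [this, Real.sin_add_nat_mul_pi, abs_mul, abs_pow, abs_neg, abs_one, one_pow, one_mul,
        abs_of_nonneg hsin]
    have s2 : |Real.sin (N * (Real.pi / N * (k + 1 - u)))| = Real.sin (Real.pi * u) := by
      have : (N : ℝ) * (Real.pi / N * (k + 1 - u)) =
          -(Real.pi * u) + ((k + 1 : ℕ) : ℝ) * Real.pi := by
        push_cast; field_simp; ring
      rw [this, Real.sin_add_nat_mul_pi, abs_mul, abs_pow, abs_neg, abs_one, one_pow, one_mul,
        Real.sin_neg, abs_neg, abs_of_nonneg hsin]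
    rw [e1, e2, dker_neg]
    rw [s1] at d1
    rw [s2] at d2
    refine (add_le_add d1 d2).trans (le_of_eq ?_)
    rw [← mul_add]
    congr 1
    field_simp
    ring
  have hodd : ∀ n : ℕ, ∑ k ∈ Finset.range n, (2 * (k : ℝ) + 1) = (n : ℝ) ^ 2 := fun n => by
    induction n with
    | zero => simp
    | succ n ih => rw [Finset.sum_range_succ, ih]; push_cast; ring
  refine le_trans ?_ (sum_basis_offset_le hN h0 h1)
  rw [div_le_iff₀ (by positivity)]
  refine (Finset.sum_le_sum hk).trans (le_of_eq ?_)
  rw [← Finset.mul_sum, Finset.sum_sub_distrib, ← Finset.sum_mul, ← Finset.mul_sum, hodd]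
  field_simp
  ring

theorem one_le_lebesgueBound {N : ℕ} (hN : 1 ≤ N) : 1 ≤ lebesgueBound N := by
  unfold lebesgueBound
  split_ifs with h
  · exact le_rfl
  have hpi := Real.pi_pos
  have hpi4 := Real.pi_lt_d2
  have h2 : (4 / 3 : ℝ) ≤ ∑ k ∈ Finset.range N, 1 / (2 * k + 1 : ℝ) := by
    calc (4 / 3 : ℝ) = ∑ k ∈ Finset.range 2, 1 / (2 * k + 1 : ℝ) := by
          norm_num [Finset.sum_range_succ]
      _ ≤ _ := Finset.sum_le_sum_of_subset_of_nonneg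
          (Finset.range_subset_range.mpr (by omega)) fun _ _ _ => by positivity
  have h3 : 4 / Real.pi * (4 / 3) ≤ 4 / Real.pi * ∑ k ∈ Finset.range N, 1 / (2 * k + 1 : ℝ) := by
    gcongr
  have h4 : (5 / 4 : ℝ) ≤ 4 / Real.pi := by
    rw [div_le_div_iff₀ (by norm_num) hpi]; linarith
  linarith

theorem sum_abs_basis_le_lebesgueBound {N : ℕ} (hN : 1 ≤ N) (θ : ℝ) :
    ∑ k, |(Lagrange.basis Finset.univ (chebNode N) k).eval (Real.cos θ)| ≤ lebesgueBound N := by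
  have hpi := Real.pi_pos
  have hN0 : (0 : ℝ) < N := by exact_mod_cast hN
  refine (sum_abs_basis_le hN θ).trans ?_
  rcases hN.eq_or_lt with rfl | hN2
  · have h : ∀ t, |dker 1 t| = 1 + Real.cos t := fun t => by
      have h1 : dker 1 t = 1 + Real.cos t := by rw [dker_eq le_rfl]; simp; ring
      rw [h1, abs_of_nonneg (by linarith [Real.neg_one_le_cos t])]
    simp [Finset.sum_range_succ, h, lebesgueBound, Real.cos_add_pi]
    linarith
  set S : ℝ → ℝ := fun t => ∑ k ∈ Finset.range (2 * N), |dker N (t + Real.pi * k / N)| with hS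
  -- A shift by `π / N` permutes the points, so `θ` may be moved into `[0, π / N)`. At `θ = 0` only
  -- one kernel value survives and the sum is `1`.
  have hper : Function.Periodic S (Real.pi / N) := fun t => by
    have h1 := Finset.sum_range_succ (fun k : ℕ => |dker N (t + Real.pi * k / N)|) (2 * N)
    rw [Finset.sum_range_succ'] at h1
    have h2 : |dker N (t + Real.pi * (2 * N : ℕ) / N)| = |dker N (t + Real.pi * (0 : ℕ) / N)| := by
      rw [← dker_periodic N (t + Real.pi * (0 : ℕ) / N)]
      congr 2
      push_cast
      field_simp
      ring
    rw [h2] at h1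
    have h3 := add_right_cancel h1
    simp only [hS]
    rw [← h3]
    refine Finset.sum_congr rfl fun k _ => ?_
    congr 2
    push_cast
    ring
  obtain ⟨y, hy, hSy⟩ := hper.exists_mem_Ico₀ (by positivity) θ
  change S θ / (2 * N) ≤ _
  rw [hSy]
  rcases hy.1.eq_or_lt with rfl | hy0
  · have h0 : S 0 = 2 * N := by
      simp only [hS, zero_add]
      rw [Finset.sum_eq_single 0]
      · simp [dker_zero hN]
      · intro k hk hk0
        have := dker_node hN (m := k) (by exact_mod_cast hk0) (by
          rw [abs_of_nonneg (by positivity)]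
          exact_mod_cast Finset.mem_range.mp hk)
        rw [Int.cast_natCast] at this
        rw [this, abs_zero]
      · intro h; simp at h; omega
    rw [h0, div_self (by positivity)]
    exact one_le_lebesgueBound hN
  · have hu : Real.pi / N * (y / (Real.pi / N)) = y := by field_simp
    have := sum_abs_dker_le hN2 (u := y / (Real.pi / N)) (by positivity)
      ((div_lt_one (by positivity)).mpr hy.2)
    rwa [hu] at this

/-! ### Numerical comparison of the Lebesgue bound with `x` and `N` -/

theorem lebesgueBound_le {N : ℕ} (hN : 2 ≤ N) : lebesgueBound N ≤
    127324 / 100000 * ∑ k ∈ Finset.range N, 1 / (2 * k + 1 : ℝ) - 2617 / 10000 := by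
  have hpi := Real.pi_gt_d6
  rw [lebesgueBound, if_neg (by omega)]
  have h : 4 / Real.pi ≤ 127324 / 100000 := by
    rw [div_le_div_iff₀ (by linarith) (by norm_num)]; linarith
  have h2 : 0 ≤ ∑ k ∈ Finset.range N, 1 / (2 * k + 1 : ℝ) :=
    Finset.sum_nonneg fun _ _ => by positivity
  have := mul_le_mul_of_nonneg_right h h2
  linarith

/-- The logarithmic bound is compared with linear functions by induction on `N`. The slopes are
dictated by the case distinctions below: `2976 / 1000 = 8 * 372 / 1000` and `8 / 10 = 2 / (5 / 2)`.
-/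
theorem lebesgueBound_sq_bounds {N : ℕ} (hN : 2 ≤ N) :
    (1 + lebesgueBound N) ^ 2 ≤ 2976 / 1000 * N ∧ lebesgueBound N ^ 2 ≤ 8 / 10 * N + 1 := by
  set l : ℕ → ℝ := fun N => 127324 / 100000 * ∑ k ∈ Finset.range N, 1 / (2 * k + 1 : ℝ) -
    2617 / 10000 with hl
  have hstep : ∀ n, l (n + 1) = l n + 127324 / 100000 / (2 * n + 1) := fun n => by
    simp only [hl, Finset.sum_range_succ]; ring
  have h2 : l 2 = 127324 / 100000 * (4 / 3) - 2617 / 10000 := by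
    simp only [hl, Finset.sum_range_succ, Finset.sum_range_zero]; norm_num
  have h3 : l 3 = l 2 + 127324 / 500000 := by rw [hstep]; norm_num
  have hpos : ∀ n, 2 ≤ n → 0 ≤ l n := fun n hn => by
    induction n, hn using Nat.le_induction with
    | base => rw [h2]; norm_num
    | succ n hn ih => rw [hstep]; positivity
  have main : ∀ n, 2 ≤ n → (1 + l n) ^ 2 ≤ 2976 / 1000 * n := fun n hn => by
    induction n, hn using Nat.le_induction with
    | base => rw [h2]; norm_num
    | succ n hn ih =>
      have hn' : (2 : ℝ) ≤ n := by exact_mod_cast hn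
      have hp := hpos n hn
      rw [hstep]
      set d : ℝ := 127324 / 100000 / (2 * n + 1) with hd
      have hd1 : d * (2 * n + 1) = 127324 / 100000 := by rw [hd]; field_simp
      have hd0 : 0 < d := by positivity
      have hd2 : d ≤ 3 / 10 := by nlinarith
      have ham : 2 * (1 + l n) ≤ (1 + l n) ^ 2 / 2 + 2 := by nlinarith [sq_nonneg (1 + l n - 2)]
      have h5 : d * (2 * (1 + l n)) ≤ d * (1488 / 1000 * n + 2) :=
        mul_le_mul_of_nonneg_left (by linarith) hd0.le
      push_cast
      nlinarith
  have main2 : ∀ n, 3 ≤ n → l n ^ 2 ≤ 8 / 10 * n + 1 := fun n hn => by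
    induction n, hn using Nat.le_induction with
    | base => rw [h3, h2]; norm_num
    | succ n hn ih =>
      have hn' : (3 : ℝ) ≤ n := by exact_mod_cast hn
      have hp := hpos n (by omega)
      rw [hstep]
      set d : ℝ := 127324 / 100000 / (2 * n + 1) with hd
      have hd1 : d * (2 * n + 1) = 127324 / 100000 := by rw [hd]; field_simp
      have hd0 : 0 < d := by positivity
      have hd2 : d ≤ 2 / 10 := by nlinarith
      have ham : 2 * l n ≤ l n ^ 2 / 2 + 2 := by nlinarith [sq_nonneg (l n - 2)]
      have h5 : d * (2 * l n) ≤ d * (4 / 10 * n + 5 / 2) :=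
        mul_le_mul_of_nonneg_left (by linarith) hd0.le
      push_cast
      nlinarith
  -- The second induction starts at `3`, where the increments are at most `2 / 10`; `N = 2` is
  -- checked separately.
  have h0 : 0 ≤ lebesgueBound N := zero_le_one.trans (one_le_lebesgueBound (by omega))
  have hle : lebesgueBound N ≤ l N := lebesgueBound_le hN
  refine ⟨(pow_le_pow_left₀ (by linarith) (by linarith) 2).trans (main N hN), ?_⟩
  refine (pow_le_pow_left₀ h0 hle 2).trans ?_
  rcases hN.eq_or_lt with rfl | h
  · rw [h2]; norm_num
  · exact main2 N h

/-- If `x ^ N` is not too small, then `x` is close to `1`. -/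
theorem mul_le_of_lt_pow {x c m : ℝ} (hx0 : 0 < x) (hx1 : x < 1) (N : ℕ) (h : c < x ^ N)
    (hm : Real.exp (-m) ≤ c) :
    2 * N ≤ m * ((1 + x) / (1 - x)) := by
  -- With `a = (1 - x) / x`, the inequality `log(1 + a) ≥ 2a / (a + 2)` reads `-log x ≥ 2 (1 - x) /
  -- (1 + x)`.
  have h1 := Real.le_log_one_add_of_nonneg (x := (1 - x) / x)
    (div_nonneg (by linarith) hx0.le)
  have e1 : 1 + (1 - x) / x = x⁻¹ := by field_simp; ring
  have e2 : 2 * ((1 - x) / x) / ((1 - x) / x + 2) = 2 * (1 - x) / (1 + x) := by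
    have h3 : (1 - x) / x + 2 = (1 + x) / x := by field_simp; ring
    rw [h3, ← mul_div_assoc, div_div_div_cancel_right₀ hx0.ne']
  rw [e1, e2, Real.log_inv] at h1
  have h2 : -m < N * Real.log x := by
    rw [← Real.log_pow, ← Real.log_exp (-m)]
    exact Real.log_lt_log (Real.exp_pos _) (hm.trans_lt h)
  have h3 : (N : ℝ) * (2 * (1 - x) / (1 + x)) ≤ m := by
    have := mul_le_mul_of_nonneg_left h1 (Nat.cast_nonneg N)
    linarith
  have hx2 : 0 < 1 - x := by linarith
  rw [mul_div_assoc', le_div_iff₀ hx2]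
  rw [mul_div_assoc', div_le_iff₀ (by linarith)] at h3
  linarith

/-- As `exp(-5/2) ≤ 1/12`, the hypothesis forces `8 N / 10 ≤ (1 + x) / (1 - x)`, and adding `1`
gives the claim. -/
theorem lebesgueBound_sq_le {x : ℝ} {N : ℕ} (hN : 1 ≤ N) (hx0 : 0 < x) (hx1 : x < 1)
    (h : 1 / 12 < x ^ N) : lebesgueBound N ^ 2 ≤ 2 / (1 - x) := by
  have hx2 : 0 < 1 - x := by linarith
  rcases hN.eq_or_lt with rfl | hN2
  · rw [lebesgueBound, if_pos rfl, le_div_iff₀ hx2]; linarith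
  have he : Real.exp (-(5 / 2)) ≤ 1 / 12 := by
    rw [Real.exp_neg, one_div]
    apply inv_anti₀ (by norm_num)
    have h1 := Real.exp_one_gt_d9
    have h2 : Real.exp (5 / 2) ^ 2 = Real.exp 1 ^ 5 := by
      rw [← Real.exp_nat_mul, ← Real.exp_nat_mul]; norm_num
    have h3 : (2.718 : ℝ) ^ 5 ≤ Real.exp 1 ^ 5 := pow_le_pow_left₀ (by norm_num) (by linarith) 5
    refine (sq_le_sq₀ (by norm_num) (Real.exp_pos _).le).mp ?_
    rw [h2]
    refine le_trans ?_ h3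
    norm_num
  have h1 := mul_le_of_lt_pow hx0 hx1 N h he
  have h2 := (lebesgueBound_sq_bounds hN2).2
  have h3 : 2 / (1 - x) = (1 + x) / (1 - x) + 1 := by field_simp; ring
  linarith

/-- As `exp(-1) ≤ 372/1000`, the hypothesis forces `2 N ≤ (1 + x) / (1 - x)`. For `N = 1` the claim
is `1 ≤ x (1 + x) / (1 - x)`, true from `x = √2 - 1 < 42/100` on. -/
theorem one_add_lebesgueBound_sq_le {x : ℝ} {N : ℕ} (hN : 1 ≤ N) (hx0 : 0 < x) (hx1 : x < 1)
    (h : 372 / 1000 < x ^ N) (h1 : N = 1 → 42 / 100 < x) :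
    (1 + lebesgueBound N) ^ 2 ≤ 4 * x ^ N * (1 + x) / (1 - x) := by
  have hx2 : 0 < 1 - x := by linarith
  rcases hN.eq_or_lt with rfl | hN2
  · rw [lebesgueBound, if_pos rfl, le_div_iff₀ hx2]
    nlinarith [h1 rfl]
  have he : Real.exp (-1) ≤ 372 / 1000 := by
    have h1 := Real.exp_one_gt_d9
    rw [Real.exp_neg, inv_le_comm₀ (Real.exp_pos _) (by norm_num)]
    norm_num at h1 ⊢
    linarith
  have h2 := mul_le_of_lt_pow hx0 hx1 N h he
  have h3 := (lebesgueBound_sq_bounds hN2).1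
  have h4 : 372 / 1000 * (4 * ((1 + x) / (1 - x))) ≤ x ^ N * (4 * ((1 + x) / (1 - x))) := by
    gcongr
  have h5 : 4 * x ^ N * (1 + x) / (1 - x) = x ^ N * (4 * ((1 + x) / (1 - x))) := by ring
  rw [h5]
  linarith

/-- The Lagrange polynomials of the Chebyshev points. -/
noncomputable abbrev chebCardinal (N : ℕ) (k : Fin (N + 1)) (t : ℝ) : ℝ :=
  (Lagrange.basis Finset.univ (chebNode N) k).eval t

/-! ### The interpolation functional on holomorphic functions -/

/-- Used with `c = -1` for the interpolation error and with `c = -1/2` for the interpolant itself.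
The natural-number quotient is the `q` for which `j - 2 q N` lies in `(-N, N]`, the degree of the
alias up to sign. -/
theorem norm_add_interp_le {ρ B C : ℝ} {G : ℂ → ℂ} (hρ : 1 < ρ)
    (hG : DifferentiableOn ℂ G (bernstein ρ)) (hB : ∀ z ∈ bernstein ρ, ‖G z‖ ≤ B)
    {N : ℕ} (hN : 1 ≤ N) (c θ : ℝ) (hC : 0 ≤ C)
    (h : ∀ n, ∑ j ∈ Finset.range n, coeffWeight (ρ ^ (-2 : ℤ)) j *
      (c * Real.cos (j * θ) +
        Real.cos ((j - 2 * ((j + N - 1) / (2 * N) : ℕ) * N) * θ)) ^ 2 ≤ C ^ 2) :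
    ‖(c : ℂ) * G (Real.cos θ : ℝ) + ∑ k : Fin (N + 1),
      (chebCardinal N k (Real.cos θ) : ℂ) *
        G (chebNode N k : ℝ)‖ ≤ B * C := by
  have := norm_functional_le hρ hG hB (ι := Option (Fin (N + 1))) Finset.univ
    (fun i => i.elim c fun k => chebCardinal N k (Real.cos θ))
    (fun i => i.elim θ fun k => Real.pi * (k : ℕ) / N) hC (fun n => by
      refine le_of_eq_of_le (Finset.sum_congr rfl fun j _ => ?_) (h n)
      congr 2
      rw [Fintype.sum_option]
      simp only [Option.elim]
      congr 1
      have hj : |(j : ℤ) - 2 * ((j + N - 1) / (2 * N) : ℕ) * N| ≤ N := by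
        have h1 := Nat.div_add_mod (j + N - 1) (2 * N)
        have h2 := Nat.mod_lt (j + N - 1) (y := 2 * N) (by omega)
        set q := (j + N - 1) / (2 * N)
        set r := (j + N - 1) % (2 * N)
        have h3 : (2 * N * q + r : ℤ) = j + N - 1 := by
          zify [show 1 ≤ j + N by omega] at h1
          exact h1
        have h4 : (j : ℤ) - 2 * q * N = r - N + 1 := by linarith
        rw [h4, abs_le]
        omega
      have := sum_cos_mul_basis hN j ((j + N - 1) / (2 * N) : ℕ) hj θ
      rw [Int.cast_natCast, Int.cast_natCast] at this
      rw [← this]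
      exact Finset.sum_congr rfl fun k _ => mul_comm _ _)
  rw [Fintype.sum_option] at this
  exact this

theorem sum_ite_pow_le {x : ℝ} (hx0 : 0 < x) (hx1 : x < 1) {a b : ℕ} (hab : a ≤ b) (n : ℕ) :
    ∑ j ∈ Finset.range n, (if a ≤ j ∧ j < b then x ^ j else 0) ≤ (x ^ a - x ^ b) / (1 - x) := by
  rw [← Finset.sum_filter, ← geom_sum_Ico' hx1.ne hab]
  refine Finset.sum_le_sum_of_subset_of_nonneg (fun j hj => ?_) fun _ _ _ => by positivity
  simp only [Finset.mem_filter] at hj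
  exact Finset.mem_Ico.mpr hj.2

theorem sum_ite_pow_le' {x : ℝ} (hx0 : 0 < x) (hx1 : x < 1) (a n : ℕ) :
    ∑ j ∈ Finset.range n, (if a ≤ j then x ^ j else 0) ≤ x ^ a / (1 - x) := by
  have h := sum_ite_pow_le hx0 hx1 (Nat.le_add_right a n) n
  have h2 : ∑ j ∈ Finset.range n, (if a ≤ j then x ^ j else 0) =
      ∑ j ∈ Finset.range n, (if a ≤ j ∧ j < a + n then x ^ j else 0) := by
    refine Finset.sum_congr rfl fun j hj => ?_
    have := Finset.mem_range.mp hj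
    by_cases ha : a ≤ j
    · rw [if_pos ha, if_pos ⟨ha, by omega⟩]
    · rw [if_neg ha, if_neg (fun h => ha h.1)]
  rw [h2]
  refine h.trans ?_
  have : 0 < 1 - x := by linarith
  gcongr
  linarith [pow_pos hx0 (a + n)]

/-- For `j ≤ N` interpolation reproduces `T_j`, so the functional has value `cos(j θ) / 2`, with
square at most `1 / 4` instead of `1`; aliased indices contribute at most `9 / 4`, and occur only
beyond `N`. -/
theorem interp_sq_sum_le {x : ℝ} (hx0 : 0 < x) (hx1 : x < 1) {N : ℕ} (hN : 1 ≤ N)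
    (θ : ℝ) (n : ℕ) :
    ∑ j ∈ Finset.range n, coeffWeight x j *
      (-(1 / 2) * Real.cos (j * θ) +
        Real.cos ((j - 2 * ((j + N - 1) / (2 * N) : ℕ) * N) * θ)) ^ 2 ≤
      (1 + (4 + 32 * x ^ N) * (x / (1 - x))) / 4 := by
  have hx2 : 0 < 1 - x := by linarith
  have hcos : ∀ t, Real.cos t ^ 2 ≤ 1 := fun t => Real.cos_sq_le_one t
  have h1 : ∀ j : ℕ, j ≤ N → (-(1 / 2) * Real.cos (j * θ) +
      Real.cos ((j - 2 * ((j + N - 1) / (2 * N) : ℕ) * N) * θ)) ^ 2 ≤ 1 / 4 := fun j hj => by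
    rw [Nat.div_eq_of_lt (by omega)]
    simp only [CharP.cast_eq_zero, mul_zero, zero_mul, sub_zero]
    nlinarith [hcos (j * θ)]
  have h2 : ∀ j : ℕ, (-(1 / 2) * Real.cos (j * θ) +
      Real.cos ((j - 2 * ((j + N - 1) / (2 * N) : ℕ) * N) * θ)) ^ 2 ≤ 9 / 4 := fun j => by
    set a := Real.cos (j * θ)
    set b := Real.cos ((j - 2 * ((j + N - 1) / (2 * N) : ℕ) * N) * θ)
    nlinarith [hcos (j * θ), hcos ((j - 2 * ((j + N - 1) / (2 * N) : ℕ) * N) * θ),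
      sq_nonneg (a + b)]
  have hterm : ∀ j : ℕ, coeffWeight x (j + 1) *
      (-(1 / 2) * Real.cos ((j + 1 : ℕ) * θ) +
        Real.cos (((j + 1 : ℕ) - 2 * (((j + 1) + N - 1) / (2 * N) : ℕ) * N) * θ)) ^ 2 ≤
      x * x ^ j + 8 * x * (if N ≤ j then x ^ j else 0) := fun j => by
    have hw := coeffWeight_le hx0 (j + 1)
    have hw0 := (coeffWeight_pos hx0 (j + 1)).le
    have hp : 0 < x ^ (j + 1) := by positivity
    split_ifs with h
    · refine (mul_le_mul hw (h2 (j + 1)) (sq_nonneg _) (by positivity)).trans (le_of_eq ?_)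
      ring
    · refine (mul_le_mul hw (h1 (j + 1) (by omega)) (sq_nonneg _) (by positivity)).trans
        (le_of_eq ?_)
      ring
  have h0 : coeffWeight x 0 * (-(1 / 2) * Real.cos ((0 : ℕ) * θ) +
        Real.cos (((0 : ℕ) - 2 * ((0 + N - 1) / (2 * N) : ℕ) * N) * θ)) ^ 2 ≤ 1 / 4 := by
    have : coeffWeight x 0 = 1 := by simp [coeffWeight]
    rw [this, one_mul]
    exact h1 0 (by omega)
  calc _ ≤ ∑ j ∈ Finset.range (n + 1), coeffWeight x j *
      (-(1 / 2) * Real.cos (j * θ) +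
        Real.cos ((j - 2 * ((j + N - 1) / (2 * N) : ℕ) * N) * θ)) ^ 2 :=
        Finset.sum_le_sum_of_subset_of_nonneg (Finset.range_subset_range.mpr (Nat.le_succ n))
          fun j _ _ => mul_nonneg (coeffWeight_pos hx0 j).le (sq_nonneg _)
    _ ≤ ∑ j ∈ Finset.range n, (x * x ^ j + 8 * x * (if N ≤ j then x ^ j else 0)) + 1 / 4 := by
        rw [Finset.sum_range_succ']
        exact add_le_add (Finset.sum_le_sum fun j _ => hterm j) h0
    _ ≤ x * (1 / (1 - x)) + 8 * x * (x ^ N / (1 - x)) + 1 / 4 := by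
        rw [Finset.sum_add_distrib, ← Finset.mul_sum, ← Finset.mul_sum]
        have ha := sum_ite_pow_le' hx0 hx1 0 n
        simp only [zero_le, if_true, pow_zero] at ha
        have hb := sum_ite_pow_le' hx0 hx1 N n
        gcongr
    _ = _ := by ring

theorem zpow_neg_two_bounds {ρ : ℝ} (hρ : 1 < ρ) :
    0 < ρ ^ (-2 : ℤ) ∧ ρ ^ (-2 : ℤ) < 1 :=
  ⟨by positivity, zpow_lt_one_of_neg₀ hρ (by norm_num)⟩

theorem cos_arccos_eq {t : ℝ} (ht : t ∈ Icc (-1 : ℝ) 1) : Real.cos (Real.arccos t) = t :=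
  Real.cos_arccos ht.1 ht.2

theorem chebNode_mem (N : ℕ) (k : Fin (N + 1)) : chebNode N k ∈ Icc (-1 : ℝ) 1 :=
  ⟨Real.neg_one_le_cos _, Real.cos_le_one _⟩

theorem norm_interp_le_lebesgueBound {ρ B : ℝ} {G : ℂ → ℂ} (hρ : 1 < ρ)
    (hB : ∀ z ∈ bernstein ρ, ‖G z‖ ≤ B) {N : ℕ} (hN : 1 ≤ N) {t : ℝ} (ht : t ∈ Icc (-1 : ℝ) 1) :
    ‖∑ k : Fin (N + 1), (chebCardinal N k t : ℂ) *
        G (chebNode N k : ℝ)‖ ≤ B * lebesgueBound N := by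
  have hB0 : 0 ≤ B := (norm_nonneg _).trans
    (hB _ (ofReal_mem_bernstein hρ (t := 0) (by simp)))
  have h := sum_abs_basis_le_lebesgueBound hN (Real.arccos t)
  rw [cos_arccos_eq ht] at h
  calc _ ≤ ∑ k : Fin (N + 1), |chebCardinal N k t| * B := by
        refine (norm_sum_le _ _).trans (Finset.sum_le_sum fun k _ => ?_)
        rw [norm_mul, Complex.norm_real, Real.norm_eq_abs]
        exact mul_le_mul_of_nonneg_left (hB _ (ofReal_mem_bernstein hρ (chebNode_mem N k)))
          (abs_nonneg _)
    _ = B * ∑ k : Fin (N + 1), |chebCardinal N k t| := by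
        rw [← Finset.sum_mul, mul_comm]
    _ ≤ _ := mul_le_mul_of_nonneg_left h hB0

/-- Interpolation is bounded from the bounded holomorphic functions to the continuous ones. -/
theorem norm_interp_le {ρ B : ℝ} {G : ℂ → ℂ} (hρ : 1 < ρ)
    (hG : DifferentiableOn ℂ G (bernstein ρ)) (hB : ∀ z ∈ bernstein ρ, ‖G z‖ ≤ B)
    {N : ℕ} (hN : 1 ≤ N) {t : ℝ} (ht : t ∈ Icc (-1 : ℝ) 1) :
    ‖∑ k : Fin (N + 1), (chebCardinal N k t : ℂ) *
        G (chebNode N k : ℝ)‖ ≤ B * √(2 / (1 - ρ ^ (-2 : ℤ))) := by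
  obtain ⟨hx0, hx1⟩ := zpow_neg_two_bounds hρ
  have hB0 : 0 ≤ B := (norm_nonneg _).trans
    (hB _ (ofReal_mem_bernstein hρ (t := 0) (by simp)))
  set x : ℝ := ρ ^ (-2 : ℤ) with hx
  have hx2 : 0 < 1 - x := by linarith
  rcases lt_or_ge (1 / 12) (x ^ N) with hp | hp
  -- For `x ^ N > 1 / 12` the Lebesgue constant suffices. Otherwise `I G` is split as `(I G - G / 2)
  -- + G / 2`: Cauchy-Schwarz for `I G` alone would be too lossy as `x` tends to `1`, whereas `G /
  -- 2` is bounded by `B / 2` directly.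
  · refine (norm_interp_le_lebesgueBound hρ hB hN ht).trans (mul_le_mul_of_nonneg_left ?_ hB0)
    exact Real.le_sqrt_of_sq_le (lebesgueBound_sq_le hN hx0 hx1 hp)
  · set C : ℝ := √(1 + (4 + 32 * x ^ N) * (x / (1 - x))) / 2 with hC
    have hrad : 0 ≤ 1 + (4 + 32 * x ^ N) * (x / (1 - x)) := by positivity
    have h := norm_add_interp_le hρ hG hB hN (-(1 / 2)) (Real.arccos t) (C := C) (by positivity)
      (fun n => by
        rw [hC, div_pow, Real.sq_sqrt hrad]
        refine (interp_sq_sum_le hx0 hx1 hN _ n).trans (le_of_eq (by ring)))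
    rw [cos_arccos_eq ht] at h
    set I := ∑ k : Fin (N + 1), (chebCardinal N k t : ℂ) *
        G (chebNode N k : ℝ)
    have hGt : ‖(1 / 2 : ℂ) * G t‖ ≤ B / 2 := by
      rw [norm_mul]
      have := hB _ (ofReal_mem_bernstein hρ ht)
      norm_num
      linarith
    have e : I = (((-(1 / 2) : ℝ) : ℂ) * G t + I) + (1 / 2 : ℂ) * G t := by push_cast; ring
    have h2 : ‖I‖ ≤ B * C + B / 2 := by
      rw [e]
      exact (norm_add_le _ _).trans (add_le_add h hGt)
    refine h2.trans ?_
    rw [← mul_one_div, ← mul_add]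
    refine mul_le_mul_of_nonneg_left ?_ hB0
    -- arithmetic-geometric mean
    set s : ℝ := 1 / (1 - x) with hs
    have hs1 : x / (1 - x) = s - 1 := by rw [hs]; field_simp; ring
    have hs0 : 1 < s := by rw [hs, lt_div_iff₀ hx2]; linarith
    have hq : 2 / (1 - x) = 2 * s := by rw [hs]; ring
    rw [hq]
    set r := √(2 * s) with hr
    have hr2 : r ^ 2 = 2 * s := Real.sq_sqrt (by linarith)
    have hr1 : 1 ≤ r := Real.one_le_sqrt.mpr (by linarith)
    -- With `x ^ N ≤ 1 / 12` the coefficient is at most `4 + 32 / 12 = 20 / 3`, and the remaining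
    -- inequality is `(r - 3)² + 1 ≥ 0` up to a factor.
    have hC2 : √(1 + (4 + 32 * x ^ N) * (x / (1 - x))) ≤ 2 * r - 1 := by
      refine Real.sqrt_le_iff.mpr ⟨by linarith, ?_⟩
      rw [hs1]
      have : (4 + 32 * x ^ N) * (s - 1) ≤ 20 / 3 * (s - 1) :=
        mul_le_mul_of_nonneg_right (by linarith) (by linarith)
      nlinarith [sq_nonneg (r - 3)]
    rw [hC]
    linarith

/-! ### The square sum of the interpolation error -/

theorem hasSum_sin_sq_mul_pow {r : ℝ} (hr0 : 0 ≤ r) (hr1 : r < 1) (θ : ℝ) :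
    HasSum (fun i : ℕ => Real.sin (i * θ) ^ 2 * r ^ i)
      (1 / 2 * (1 / (1 - r) - (1 - r * Real.cos (2 * θ)) /
        (1 - 2 * r * Real.cos (2 * θ) + r ^ 2))) := by
  set z : ℂ := r * Complex.exp ((2 * θ : ℝ) * Complex.I) with hz
  have hzn : ‖z‖ < 1 := by
    rw [hz, norm_mul, Complex.norm_exp_ofReal_mul_I, mul_one, Complex.norm_real,
      Real.norm_eq_abs, abs_of_nonneg hr0]
    exact hr1
  have h1 := Complex.hasSum_re (hasSum_geometric_of_norm_lt_one hzn)
  have h2 : ∀ i : ℕ, (z ^ i).re = Real.cos (2 * (i * θ)) * r ^ i := fun i => by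
    rw [hz, mul_pow, ← Complex.exp_nat_mul, ← Complex.ofReal_pow, Complex.re_ofReal_mul,
      show (i : ℂ) * ((2 * θ : ℝ) * Complex.I) = ((2 * (i * θ) : ℝ) : ℂ) * Complex.I by
        push_cast; ring, Complex.exp_ofReal_mul_I_re, mul_comm]
  have h3 : ((1 - z)⁻¹).re = (1 - r * Real.cos (2 * θ)) /
      (1 - 2 * r * Real.cos (2 * θ) + r ^ 2) := by
    have hre : z.re = r * Real.cos (2 * θ) := by
      rw [hz, Complex.re_ofReal_mul, Complex.exp_ofReal_mul_I_re]
    have him : z.im = r * Real.sin (2 * θ) := by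
      rw [hz, Complex.im_ofReal_mul, Complex.exp_ofReal_mul_I_im]
    rw [Complex.inv_re, Complex.normSq_apply, Complex.sub_re, Complex.sub_im, Complex.one_re,
      Complex.one_im, hre, him]
    congr 1
    linear_combination r ^ 2 * Real.sin_sq_add_cos_sq (2 * θ)
  have h4 := ((hasSum_geometric_of_lt_one hr0 hr1).sub h1).mul_left (1 / 2)
  rw [h3] at h4
  rw [one_div (1 - r)]
  refine (congrArg (HasSum · _) (funext fun i => ?_)).mpr h4
  rw [h2, Real.sin_sq_eq_half_sub]
  ring

/-- Comparison of the Poisson kernel at `x` and at `x ^ 3`. -/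
theorem poisson_cube_le {x b c : ℝ} (hx0 : 0 < x) (hx1 : x < 1) (hb : 3 * b ≤ 1)
    (hc : |c| ≤ 1) :
    b * ((1 - (x ^ 3) ^ 2) / (1 - 2 * x ^ 3 * c + (x ^ 3) ^ 2)) ≤
      (1 - x ^ 2) / (1 - 2 * x * c + x ^ 2) := by
  obtain ⟨hc1, hc2⟩ := abs_le.mp hc
  have pos : ∀ y : ℝ, 0 < y → y < 1 → 0 < 1 - 2 * y * c + y ^ 2 := fun y hy0 hy1 => by
    nlinarith [mul_nonneg hy0.le (sub_nonneg.mpr hc2), sq_pos_of_pos (sub_pos.mpr hy1)]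
  have hx3 : x ^ 3 < 1 := pow_lt_one₀ hx0.le hx1 (by norm_num)
  rw [mul_div_assoc', div_le_div_iff₀ (pos _ (by positivity) hx3) (pos _ hx0 hx1)]
  -- After cancelling `1 - x²`, both sides are affine in `c`, so the end points `c = 1` (`e1`) and
  -- `c = -1` (`e2`) suffice. The factor `3` is needed at `c = -1`, through `1 + x + x² ≤ 3 (1 - x +
  -- x²)`.
  have key : b * (1 + x ^ 2 + x ^ 4) * (1 - 2 * x * c + x ^ 2) ≤ 1 - 2 * x ^ 3 * c + x ^ 6 := by
    have e1 : b * (1 + x ^ 2 + x ^ 4) * (1 - x) ^ 2 ≤ (1 - x ^ 3) ^ 2 := by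
      have : b * (1 - x + x ^ 2) ≤ 1 + x + x ^ 2 := by nlinarith [sq_nonneg (1 - x)]
      have h2 : 0 ≤ (1 - x) ^ 2 * (1 + x + x ^ 2) := by positivity
      nlinarith [mul_le_mul_of_nonneg_left this h2]
    have e2 : b * (1 + x ^ 2 + x ^ 4) * (1 + x) ^ 2 ≤ (1 + x ^ 3) ^ 2 := by
      have h1 : 0 ≤ 1 - x + x ^ 2 := by nlinarith
      have : b * (1 + x + x ^ 2) ≤ 1 - x + x ^ 2 := by
        have : 3 * b * (1 + x + x ^ 2) ≤ 1 * (1 + x + x ^ 2) := by gcongr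
        nlinarith [sq_nonneg (1 - x)]
      have h2 : 0 ≤ (1 + x) ^ 2 * (1 - x + x ^ 2) := by positivity
      nlinarith [mul_le_mul_of_nonneg_left this h2]
    nlinarith [mul_le_mul_of_nonneg_left e1 (show 0 ≤ 1 + c by linarith),
      mul_le_mul_of_nonneg_left e2 (show 0 ≤ 1 - c by linarith)]
  have h0 : 0 ≤ 1 - x ^ 2 := by nlinarith
  calc _ = (1 - x ^ 2) * (b * (1 + x ^ 2 + x ^ 4) * (1 - 2 * x * c + x ^ 2)) := by ring
    _ ≤ (1 - x ^ 2) * (1 - 2 * x ^ 3 * c + x ^ 6) := mul_le_mul_of_nonneg_left key h0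
    _ = _ := by ring

/-- Each sine series is a constant minus a quarter of a Poisson kernel at `2 θ`. The kernels at `x`
and `x ^ 3` enter with opposite signs, and by `poisson_cube_le` their combination can be dropped,
which leaves a bound uniform in `θ`. -/
theorem sum_sin_sq_mul_le {x p a : ℝ} (hx0 : 0 < x) (hx1 : x < 1) (hp : 0 < p) (ha : 0 < a)
    (hap : 3 * (a * p ^ 2) ≤ 1) (θ : ℝ) (m : ℕ) :
    ∑ i ∈ Finset.range m, Real.sin (i * θ) ^ 2 * (p * x ^ i - a * p ^ 3 * (x ^ 3) ^ i) ≤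
      p / 2 * ((1 + x) / (2 * (1 - x)) - a * p ^ 2 * ((1 + x ^ 3) / (2 * (1 - x ^ 3)))) := by
  have hx3 : x ^ 3 < 1 := pow_lt_one₀ hx0.le hx1 (by norm_num)
  have h := ((hasSum_sin_sq_mul_pow hx0.le hx1 θ).mul_left p).sub
    ((hasSum_sin_sq_mul_pow (pow_pos hx0 3).le hx3 θ).mul_left (a * p ^ 3))
  have hnn : ∀ i : ℕ, 0 ≤ Real.sin (i * θ) ^ 2 * (p * x ^ i - a * p ^ 3 * (x ^ 3) ^ i) :=
    fun i => by
      refine mul_nonneg (sq_nonneg _) ?_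
      have h1 : (x ^ 3) ^ i ≤ x ^ i := by
        refine pow_le_pow_left₀ (by positivity) ?_ i
        nlinarith [mul_nonneg hx0.le (show 0 ≤ 1 - x ^ 2 by nlinarith)]
      have h2 : a * p ^ 2 * (x ^ 3) ^ i ≤ 1 * x ^ i :=
        mul_le_mul (by linarith) h1 (by positivity) (by norm_num)
      nlinarith [mul_le_mul_of_nonneg_left h2 hp.le]
  have h2 := sum_le_hasSum (Finset.range m) (fun i _ => by
    have := hnn i; linarith) h
  have hP := poisson_cube_le hx0 hx1 hap
    (Real.abs_cos_le_one (2 * θ))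
  have hx2 : 1 - x ≠ 0 := by linarith
  have hx4 : 1 - x ^ 3 ≠ 0 := by linarith
  set c := Real.cos (2 * θ) with hc
  have hcb := abs_le.mp (Real.abs_cos_le_one (2 * θ))
  have split : ∀ y : ℝ, 0 < y → y < 1 → 1 / (1 - y) - (1 - y * c) / (1 - 2 * y * c + y ^ 2) =
      (1 + y) / (2 * (1 - y)) - (1 - y ^ 2) / (1 - 2 * y * c + y ^ 2) / 2 := fun y hy0 hy1 => by
    have h1 : 0 < 1 - 2 * y * c + y ^ 2 := by
      nlinarith [mul_nonneg hy0.le (sub_nonneg.mpr hcb.2), sq_pos_of_pos (sub_pos.mpr hy1)]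
    have h2 : 1 - y ≠ 0 := by linarith
    generalize hd : 1 - 2 * y * c + y ^ 2 = d at h1
    field_simp
    rw [← hd]
    ring
  rw [split x hx0 hx1, split _ (pow_pos hx0 3) hx3] at h2
  refine le_trans (le_of_eq (Finset.sum_congr rfl fun i _ => by ring)) (h2.trans ?_)
  have := mul_le_mul_of_nonneg_left hP hp.le
  nlinarith

/-- The interpolation error of Chebyshev polynomials in terms of sines. -/
theorem cos_sub_cos_alias_sq (a b : ℝ) :
    (-1 * Real.cos a + Real.cos (a - 2 * b)) ^ 2 =
      4 * Real.sin b ^ 2 * Real.sin (a - b) ^ 2 := by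
  have h1 : Real.cos a = Real.cos (a - b) * Real.cos b - Real.sin (a - b) * Real.sin b := by
    rw [← Real.cos_add]; ring_nf
  have h2 : Real.cos (a - 2 * b) =
      Real.cos (a - b) * Real.cos b + Real.sin (a - b) * Real.sin b := by
    rw [← Real.cos_sub]; ring_nf
  rw [h1, h2]; ring

/-- With `y = x ^ j ≤ p` one has `y / (1 + y²) = y - y³ / (1 + y²) ≤ y - a y³`. Keeping the cubic
correction, a geometric sequence again, gains what later pays for the remote aliases. -/
theorem coeffWeight_le_sub {x p a : ℝ} (hx0 : 0 < x) (hx1 : x < 1) {N j : ℕ} (hN : 1 ≤ N)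
    (hj : N ≤ j) (hp : p = x ^ N) (ha : a = 1 / (1 + p ^ 2)) :
    coeffWeight x j ≤ 4 * (p * x ^ (j - N) - a * p ^ 3 * (x ^ 3) ^ (j - N)) := by
  obtain ⟨i, rfl⟩ := Nat.exists_eq_add_of_le hj
  rw [coeffWeight, if_neg (by omega), Nat.add_sub_cancel_left, hp, ← pow_add]
  have e : (x ^ N) ^ 3 * (x ^ 3) ^ i = (x ^ (N + i)) ^ 3 := by
    rw [← pow_mul, ← pow_mul, ← pow_add, ← pow_mul]; ring_nf
  have e2 : x ^ (2 * (N + i)) = (x ^ (N + i)) ^ 2 := by rw [← pow_mul]; ring_nf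
  rw [mul_assoc a, e, e2]
  set y := x ^ (N + i) with hy
  have hy0 : 0 < y := by positivity
  have hyp : y ≤ p := by rw [hp]; exact pow_le_pow_of_le_one hx0.le hx1.le (by omega)
  have ha' : a * (1 + y ^ 2) ≤ 1 := by
    rw [ha, div_mul_eq_mul_div, div_le_one (by positivity)]
    nlinarith
  rw [div_le_iff₀ (by positivity)]
  nlinarith [mul_le_mul_of_nonneg_left ha' (pow_pos hy0 3).le]

/-- The squared error at `j` is `4 sin²(q N θ) sin²((j - q N) θ)`. The blocks `q = 1` and `q = 2`
have `sin²(q N θ)` equal to `S` and `4 S (1 - S)`; from `q = 3` on, the sines are bounded by `1`.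
The first sum is extended to all `j ≥ N`, which only adds nonnegative terms. -/
theorem coeffWeight_mul_error_sq_le {x p a S : ℝ} (hx0 : 0 < x) (hx1 : x < 1) {N : ℕ} (hN : 1 ≤ N)
    (hp : p = x ^ N) (ha : a = 1 / (1 + p ^ 2)) (θ : ℝ) (hS : S = Real.sin (N * θ) ^ 2) (j : ℕ) :
    coeffWeight x j *
      (-1 * Real.cos (j * θ) +
        Real.cos ((j - 2 * ((j + N - 1) / (2 * N) : ℕ) * N) * θ)) ^ 2 ≤
      16 * S * (if N ≤ j then Real.sin ((j - N : ℕ) * θ) ^ 2 *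
        (p * x ^ (j - N) - a * p ^ 3 * (x ^ 3) ^ (j - N)) else 0) +
      64 * S * (1 - S) * (if 3 * N + 1 ≤ j ∧ j < 5 * N + 1 then x ^ j else 0) +
      16 * (if 5 * N + 1 ≤ j then x ^ j else 0) := by
  have hS0 : 0 ≤ S := hS ▸ sq_nonneg _
  have hS1 : S ≤ 1 := hS ▸ Real.sin_sq_le_one _
  have hss : ∀ t, Real.sin t ^ 2 ≤ 1 := Real.sin_sq_le_one
  have hE : ∀ j : ℕ, (-1 * Real.cos (j * θ) +
        Real.cos ((j - 2 * ((j + N - 1) / (2 * N) : ℕ) * N) * θ)) ^ 2 =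
      4 * Real.sin (((j + N - 1) / (2 * N) : ℕ) * N * θ) ^ 2 *
        Real.sin (j * θ - ((j + N - 1) / (2 * N) : ℕ) * N * θ) ^ 2 := fun j => by
    rw [← cos_sub_cos_alias_sq]; ring_nf
  rw [hE]
  have hw0 := (coeffWeight_pos hx0 j).le
  have hw := coeffWeight_le hx0 j
  have hb1 : 0 ≤ (if N ≤ j then Real.sin ((j - N : ℕ) * θ) ^ 2 *
      (p * x ^ (j - N) - a * p ^ 3 * (x ^ 3) ^ (j - N)) else 0) := by
    split_ifs with hj
    · have := coeffWeight_le_sub hx0 hx1 hN hj hp ha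
      exact mul_nonneg (sq_nonneg _) (by linarith)
    · exact le_rfl
  have hb1' := mul_nonneg (by positivity : 0 ≤ 16 * S) hb1
  rcases le_or_gt j N with h1 | h1
  · rw [Nat.div_eq_of_lt (by omega), if_neg (by omega : ¬ (3 * N + 1 ≤ j ∧ j < 5 * N + 1)),
      if_neg (by omega : ¬ (5 * N + 1 ≤ j))]
    simpa using hb1'
  rcases le_or_gt j (3 * N) with h2 | h2
  · have hq : (j + N - 1) / (2 * N) = 1 :=
      Nat.div_eq_of_lt_le (by omega) (by omega)
    rw [hq, if_neg (by omega : ¬ (3 * N + 1 ≤ j ∧ j < 5 * N + 1)),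
      if_neg (by omega : ¬ (5 * N + 1 ≤ j)), if_pos h1.le]
    have hc : (j : ℝ) * θ - (1 : ℕ) * N * θ = (j - N : ℕ) * θ := by
      rw [Nat.cast_sub h1.le]; push_cast; ring
    rw [hc, Nat.cast_one, one_mul, ← hS]
    have := mul_le_mul_of_nonneg_right (coeffWeight_le_sub hx0 hx1 hN h1.le hp ha)
      (by positivity : 0 ≤ 4 * S * Real.sin ((j - N : ℕ) * θ) ^ 2)
    linarith
  rcases le_or_gt j (5 * N) with h3 | h3
  · have hq : (j + N - 1) / (2 * N) = 2 :=
      Nat.div_eq_of_lt_le (by omega) (by omega)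
    rw [hq, if_pos (by omega : (3 * N + 1 ≤ j ∧ j < 5 * N + 1)),
      if_neg (by omega : ¬ (5 * N + 1 ≤ j))]
    have h4 : Real.sin ((2 : ℕ) * N * θ) ^ 2 = 4 * S * (1 - S) := by
      rw [Nat.cast_ofNat, mul_assoc, Real.sin_two_mul, hS, mul_pow, mul_pow, Real.cos_sq']
      ring
    rw [h4]
    have h5 : 0 ≤ S * (1 - S) := mul_nonneg hS0 (by linarith)
    have h6 := mul_le_mul hw (hss (j * θ - (2 : ℕ) * N * θ)) (sq_nonneg _) (by positivity)
    have := mul_le_mul_of_nonneg_left h6 h5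
    linarith
  · rw [if_neg (by omega : ¬ (3 * N + 1 ≤ j ∧ j < 5 * N + 1)),
      if_pos (by omega : (5 * N + 1 ≤ j))]
    have h6 := mul_le_mul (hss (((j + N - 1) / (2 * N) : ℕ) * N * θ))
      (hss (j * θ - ((j + N - 1) / (2 * N) : ℕ) * N * θ)) (sq_nonneg _) zero_le_one
    have h7 := mul_le_mul hw h6 (by positivity) (by positivity)
    linarith


/-- The inequalities that close `error_sq_sum_le`, in its notation: the Poisson comparison is
applicable, `R ≤ g`, and `K + R ≤ A`. Here `g` is the gain from the cubic correction, `R` comes from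
`j > 5 N`, and `K` from the block `q = 2`. -/
theorem error_remainder_bounds {x p a : ℝ} (hx0 : 0 < x) (hx1 : x < 1) {N : ℕ} (hN : 1 ≤ N)
    (hp : p = x ^ N) (ha : a = 1 / (1 + p ^ 2))
    (h : x ^ N ≤ 372 / 1000 ∨ N = 1 ∧ x ≤ 42 / 100) :
    3 * (a * p ^ 2) ≤ 1 ∧
    2 * p ^ 4 * (x / (1 - x)) ≤ a * p ^ 2 * ((1 + x ^ 3) / (2 * (1 - x ^ 3))) ∧
    8 * p ^ 2 * (1 - p ^ 2) * (x / (1 - x)) + 2 * p ^ 4 * (x / (1 - x)) ≤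
      (1 + x) / (2 * (1 - x)) := by
  rw [← hp] at h
  have hp0 : 0 < p := by rw [hp]; positivity
  have hx2 : 0 < 1 - x := by linarith
  have hx3 : 0 < 1 - x ^ 3 := by nlinarith [pow_lt_one₀ hx0.le hx1 (show 3 ≠ 0 by norm_num)]
  have hpx : p ≤ x := by
    rw [hp]; exact (pow_le_pow_of_le_one hx0.le hx1.le hN).trans (pow_one x).le
  have hp42 : p ≤ 42 / 100 := by
    rcases h with h | ⟨h, h'⟩
    · linarith
    · exact hpx.trans h'
  have hp2 : p ^ 2 ≤ 1764 / 10000 := by nlinarith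
  have hap : 3 * (a * p ^ 2) ≤ 1 := by
    rw [ha, div_mul_eq_mul_div, mul_div_assoc', div_le_one (by positivity)]
    linarith
  have c1 : 4 * p ^ 2 * (1 + p ^ 2) * (x * (1 + x + x ^ 2)) ≤ 1 + x ^ 3 := by
    rcases h with h | ⟨h, h'⟩
    · have hq : p ^ 2 ≤ 138384 / 1000000 := by nlinarith
      have : 4 * p ^ 2 * (1 + p ^ 2) ≤ 631 / 1000 := by nlinarith [sq_nonneg p]
      have h2 := mul_le_mul_of_nonneg_right this (by positivity : 0 ≤ x * (1 + x + x ^ 2))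
      nlinarith [pow_pos hx0 2, pow_pos hx0 3, mul_pos hx0 hx2]
    · have : 4 * p ^ 2 * (1 + p ^ 2) ≤ 831 / 1000 := by nlinarith [sq_nonneg p]
      have h2 := mul_le_mul_of_nonneg_right this (by positivity : 0 ≤ x * (1 + x + x ^ 2))
      nlinarith [pow_pos hx0 2, pow_pos hx0 3, mul_pos hx0 hx2]
  have c2 : 2 * x * (8 * p ^ 2 - 6 * p ^ 4) ≤ 1 + x := by
    have e : p ^ 4 = p ^ 2 * p ^ 2 := by ring
    rcases h with h | ⟨h, h'⟩
    · have hq : p ^ 2 ≤ 138384 / 1000000 := by nlinarith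
      have : 8 * p ^ 2 - 6 * p ^ 4 ≤ 1 := by rw [e]; nlinarith [sq_nonneg p]
      nlinarith [mul_le_mul_of_nonneg_left this hx0.le]
    · have : 8 * p ^ 2 - 6 * p ^ 4 ≤ 142 / 100 := by rw [e]; nlinarith [sq_nonneg p]
      nlinarith [mul_le_mul_of_nonneg_left this hx0.le]
  set A := (1 + x) / (2 * (1 - x)) with hA
  set g := a * p ^ 2 * ((1 + x ^ 3) / (2 * (1 - x ^ 3))) with hg
  set R := 2 * p ^ 4 * (x / (1 - x)) with hR
  set K := 8 * p ^ 2 * (1 - p ^ 2) * (x / (1 - x)) with hK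
  refine ⟨hap, ?_, ?_⟩
  · have e1 : R = 2 * p ^ 4 * x * (1 + x + x ^ 2) / (1 - x ^ 3) := by
      rw [hR, show 1 - x ^ 3 = (1 - x) * (1 + x + x ^ 2) by ring]
      field_simp
    have e2 : g = p ^ 2 * (1 + x ^ 3) / (2 * (1 + p ^ 2)) / (1 - x ^ 3) := by
      rw [hg, ha]; field_simp
    rw [e1, e2]
    refine div_le_div_of_nonneg_right ?_ hx3.le
    rw [le_div_iff₀ (by positivity)]
    nlinarith [mul_le_mul_of_nonneg_left c1 (sq_nonneg p)]
  · have e1 : K + R = (2 * x * (8 * p ^ 2 - 6 * p ^ 4)) / (2 * (1 - x)) := by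
      rw [hK, hR]; field_simp; ring
    rw [e1, hA]
    exact div_le_div_of_nonneg_right c2 (by linarith)

theorem error_sq_sum_le {x : ℝ} (hx0 : 0 < x) (hx1 : x < 1) {N : ℕ} (hN : 1 ≤ N)
    (h : x ^ N ≤ 372 / 1000 ∨ N = 1 ∧ x ≤ 42 / 100) (θ : ℝ) (n : ℕ) :
    ∑ j ∈ Finset.range n, coeffWeight x j *
      (-1 * Real.cos (j * θ) +
        Real.cos ((j - 2 * ((j + N - 1) / (2 * N) : ℕ) * N) * θ)) ^ 2 ≤
      4 * x ^ N * (1 + x) / (1 - x) := by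
  set p := x ^ N with hp
  set a := 1 / (1 + p ^ 2) with ha
  set S := Real.sin (N * θ) ^ 2 with hS
  have hp0 : 0 < p := by positivity
  have hx2 : 0 < 1 - x := by linarith
  have ha0 : 0 < a := by positivity
  have hS0 : 0 ≤ S := sq_nonneg _
  have hS1 : S ≤ 1 := Real.sin_sq_le_one _
  have hterm := coeffWeight_mul_error_sq_le hx0 hx1 hN hp ha θ hS
  obtain ⟨hap, hRg, hKR⟩ := error_remainder_bounds hx0 hx1 hN hp ha h
  have hp1 : p ≤ 1 := hp ▸ pow_le_one₀ hx0.le hx1.le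
  have hp2 : p ^ 2 ≤ 1 := by nlinarith
  set A := (1 + x) / (2 * (1 - x)) with hA
  set g := a * p ^ 2 * ((1 + x ^ 3) / (2 * (1 - x ^ 3))) with hg
  set R := 2 * p ^ 4 * (x / (1 - x)) with hR
  set K := 8 * p ^ 2 * (1 - p ^ 2) * (x / (1 - x)) with hK
  have hR0 : 0 ≤ R := by positivity
  have hK0 : 0 ≤ K := mul_nonneg (mul_nonneg (by positivity) (by linarith)) (by positivity)
  have b1 : ∑ j ∈ Finset.range n, (if N ≤ j then Real.sin ((j - N : ℕ) * θ) ^ 2 *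
        (p * x ^ (j - N) - a * p ^ 3 * (x ^ 3) ^ (j - N)) else 0) ≤ p / 2 * (A - g) := by
    refine le_trans ?_ (sum_sin_sq_mul_le hx0 hx1 hp0 ha0 hap θ (n - N))
    rw [← Finset.sum_filter]
    refine le_of_eq (Finset.sum_nbij' (fun j => j - N) (fun i => i + N) ?_ ?_ ?_ ?_ ?_)
    · intro j hj
      simp only [Finset.mem_filter, Finset.mem_range] at hj ⊢
      omega
    · intro j hj
      simp only [Finset.mem_filter, Finset.mem_range] at hj ⊢
      omega
    · intro j hj
      simp only [Finset.mem_filter, Finset.mem_range] at hj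
      omega
    · intro j _
      simp
    · intro j _
      rfl
  have b2 := sum_ite_pow_le hx0 hx1 (show 3 * N + 1 ≤ 5 * N + 1 by omega) n
  have b3 := sum_ite_pow_le' hx0 hx1 (5 * N + 1) n
  have p3 : x ^ (3 * N + 1) = p ^ 3 * x := by rw [hp, ← pow_mul, ← pow_succ]; ring_nf
  have p5 : x ^ (5 * N + 1) = p ^ 5 * x := by rw [hp, ← pow_mul, ← pow_succ]; ring_nf
  rw [p3, p5] at b2
  rw [p5] at b3
  have h5 : 0 ≤ S * (1 - S) := mul_nonneg hS0 (by linarith)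
  calc _ ≤ 16 * S * (p / 2 * (A - g)) +
        64 * S * (1 - S) * ((p ^ 3 * x - p ^ 5 * x) / (1 - x)) + 16 * (p ^ 5 * x / (1 - x)) := by
        refine (Finset.sum_le_sum fun j _ => hterm j).trans ?_
        rw [Finset.sum_add_distrib, Finset.sum_add_distrib, ← Finset.mul_sum, ← Finset.mul_sum,
          ← Finset.mul_sum]
        have e2 := mul_le_mul_of_nonneg_left b2 (by linarith : 0 ≤ 64 * S * (1 - S))
        have e1 := mul_le_mul_of_nonneg_left b1 (by positivity : 0 ≤ 16 * S)
        linarith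
    _ = 8 * p * (S * (A - g) + S * (1 - S) * K + R) := by rw [hK, hR]; ring
    -- Writing `R = S R + (1 - S) R`, the first part is absorbed by `S g`, and `(1 - S) (R + S K) ≤
    -- (1 - S) (R + K) ≤ (1 - S) A`.
    _ ≤ 8 * p * A := by
        refine mul_le_mul_of_nonneg_left ?_ (by positivity)
        nlinarith [mul_le_mul_of_nonneg_left hRg hS0,
          mul_le_mul_of_nonneg_left hKR (sub_nonneg.mpr hS1),
          mul_nonneg (mul_nonneg (sub_nonneg.mpr hS1) (sub_nonneg.mpr hS1)) hK0]
    _ = _ := by rw [hA]; field_simp; ring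

/-- The error of Chebyshev interpolation of bounded holomorphic functions. -/
theorem norm_sub_interp_le {ρ B : ℝ} {G : ℂ → ℂ} (hρ : 1 < ρ)
    (hG : DifferentiableOn ℂ G (bernstein ρ)) (hB : ∀ z ∈ bernstein ρ, ‖G z‖ ≤ B)
    {N : ℕ} (hN : 1 ≤ N) {t : ℝ} (ht : t ∈ Icc (-1 : ℝ) 1) :
    ‖G t - ∑ k : Fin (N + 1), (chebCardinal N k t : ℂ) * G (chebNode N k : ℝ)‖ ≤
      B * √(4 * (ρ ^ (-2 : ℤ)) ^ N * (1 + ρ ^ (-2 : ℤ)) / (1 - ρ ^ (-2 : ℤ))) := by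
  obtain ⟨hx0, hx1⟩ := zpow_neg_two_bounds hρ
  have hB0 : 0 ≤ B := (norm_nonneg _).trans
    (hB _ (ofReal_mem_bernstein hρ (t := 0) (by simp)))
  by_cases h : (ρ ^ (-2 : ℤ)) ^ N ≤ 372 / 1000 ∨ N = 1 ∧ ρ ^ (-2 : ℤ) ≤ 42 / 100
  · have h1 := norm_add_interp_le hρ hG hB hN (-1) (Real.arccos t)
      (C := √(4 * (ρ ^ (-2 : ℤ)) ^ N * (1 + ρ ^ (-2 : ℤ)) / (1 - ρ ^ (-2 : ℤ))))
      (Real.sqrt_nonneg _) (fun n => by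
        rw [Real.sq_sqrt]
        · exact error_sq_sum_le hx0 hx1 hN h _ n
        · exact div_nonneg (by positivity) (by linarith))
    rw [cos_arccos_eq ht] at h1
    rw [← norm_neg]
    refine le_of_eq_of_le ?_ h1
    congr 1
    push_cast
    ring
  -- Here `x ^ N` is large and the crude estimate `‖G‖ + ‖I G‖ ≤ B (1 + Λ)` is already sufficient.
  · push Not at h
    refine (norm_sub_le _ _).trans ?_
    have h1 := norm_interp_le_lebesgueBound hρ hB hN ht
    have h2 := hB _ (ofReal_mem_bernstein hρ ht)
    refine (add_le_add h2 h1).trans ?_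
    rw [← mul_one_add]
    refine mul_le_mul_of_nonneg_left (Real.le_sqrt_of_sq_le ?_) hB0
    exact one_add_lebesgueBound_sq_le hN hx0 hx1 h.1 h.2

/-! ### Tensorized interpolation -/

/-- The tensor product of the Chebyshev interpolation operators, at the point `t`. -/
noncomputable def tensorInterp {D : ℕ} (N : Fin D → ℕ) (t : Fin D → ℝ) (F : (Fin D → ℂ) → ℂ) : ℂ :=
  ∑ k : Idx N, (∏ i, (chebCardinal (N i) (k i) (t i) : ℂ)) *
    F (fun i => (chebNode (N i) (k i) : ℂ))

theorem tensorInterp_succ {D : ℕ} (N : Fin (D + 1) → ℕ) (t : Fin (D + 1) → ℝ)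
    (F : (Fin (D + 1) → ℂ) → ℂ) :
    tensorInterp N t F = ∑ k : Fin (N 0 + 1), (chebCardinal (N 0) k (t 0) : ℂ) *
      tensorInterp (fun i => N i.succ) (fun i => t i.succ)
        (fun w => F (Fin.cons (chebNode (N 0) k : ℂ) w)) := by
  unfold tensorInterp
  rw [← (Fin.consEquiv fun i => Fin (N i + 1)).sum_comp, Fintype.sum_prod_type]
  refine Finset.sum_congr rfl fun k₀ _ => ?_
  rw [Finset.mul_sum]
  refine Finset.sum_congr rfl fun k' _ => ?_
  rw [Fin.prod_univ_succ, ← mul_assoc]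
  congr 2
  ext i
  refine Fin.cases ?_ (fun i => ?_) i <;> rfl

theorem differentiable_cons_left {D : ℕ} (w : Fin D → ℂ) :
    Differentiable ℂ fun z : ℂ => (Fin.cons z w : Fin (D + 1) → ℂ) :=
  differentiable_pi.mpr fun i => Fin.cases (by simp)
    (fun i => by simp) i

theorem differentiable_cons_right {D : ℕ} (z : ℂ) :
    Differentiable ℂ fun w : Fin D → ℂ => (Fin.cons z w : Fin (D + 1) → ℂ) :=
  differentiable_pi.mpr fun i => Fin.cases (by simp)
    (fun i => by simpa using differentiable_apply i) i

theorem cons_mem_pi {D : ℕ} {s : Fin (D + 1) → Set ℂ} {z : ℂ} {w : Fin D → ℂ} (hz : z ∈ s 0)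
    (hw : w ∈ univ.pi fun i => s i.succ) : (Fin.cons z w : Fin (D + 1) → ℂ) ∈ univ.pi s :=
  fun i _ => Fin.cases (by simpa using hz) (fun i => by simpa using hw i (mem_univ i)) i

/-- Cauchy-Schwarz for the vectors `(√a, √b)` and `(1, √c)`. -/
theorem add_sqrt_mul_sqrt_le {a b c : ℝ} (ha : 0 ≤ a) (hb : 0 ≤ b) (hc : 0 ≤ c) :
    √a + √b * √c ≤ √((a + b) * (1 + c)) := by
  refine Real.le_sqrt_of_sq_le ?_
  nlinarith [sq_nonneg (√a * √c - √b), Real.sq_sqrt ha, Real.sq_sqrt hb, Real.sq_sqrt hc,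
    mul_self_nonneg (√a * √c - √b), mul_pow (√a) (√c) 2, mul_pow (√b) (√c) 2,
    Real.sqrt_nonneg a, Real.sqrt_nonneg b, Real.sqrt_nonneg c]

/-- Induction on the dimension. Let `H z` be the interpolant in the last variables with the first
one frozen at `z`; it is holomorphic and bounded by `B √P`. The error splits into that of the
section at `t 0` and the univariate error of `H`. The two bounds are needed together, since the
operator bound controls `H`. -/
theorem tensorInterp_bounds {D : ℕ} {ρ : Fin D → ℝ} (hρ : ∀ i, 1 < ρ i) {N : Fin D → ℕ}
    (hN : ∀ i, 1 ≤ N i) {B : ℝ} {F : (Fin D → ℂ) → ℂ}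
    (hF : DifferentiableOn ℂ F (univ.pi fun i => bernstein (ρ i)))
    (hB : ∀ z ∈ univ.pi fun i => bernstein (ρ i), ‖F z‖ ≤ B) {t : Fin D → ℝ}
    (ht : ∀ i, t i ∈ Icc (-1 : ℝ) 1) :
    ‖tensorInterp N t F‖ ≤ B * √(∏ i, 2 / (1 - ρ i ^ (-2 : ℤ))) ∧
    ‖F (fun i => (t i : ℂ)) - tensorInterp N t F‖ ≤
      B * √(4 * (∑ i, (ρ i ^ (-2 : ℤ)) ^ N i) * ∏ i, 2 / (1 - ρ i ^ (-2 : ℤ))) := by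
  induction D generalizing B with
  | zero =>
    have h : tensorInterp N t F = F (fun i => (t i : ℂ)) := by
      unfold tensorInterp
      rw [Fintype.sum_unique, Finset.univ_eq_empty, Finset.prod_empty, one_mul]
      exact congrArg F (Subsingleton.elim _ _)
    rw [h]
    simpa using hB _ fun i => i.elim0
  | succ D ih =>
    set P := ∏ i : Fin D, 2 / (1 - ρ i.succ ^ (-2 : ℤ)) with hP
    have hP0 : 0 ≤ P := Finset.prod_nonneg fun i _ =>
      div_nonneg zero_le_two (by linarith [(zpow_neg_two_bounds (hρ i.succ)).2])
    obtain ⟨hx0, hx1⟩ := zpow_neg_two_bounds (hρ 0)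
    have hsec : ∀ z ∈ bernstein (ρ 0), _ := fun z hz =>
      ih (ρ := fun i => ρ i.succ) (fun i => hρ i.succ) (N := fun i => N i.succ)
        (fun i => hN i.succ) (B := B) (F := fun w => F (Fin.cons z w))
        (hF.comp (differentiable_cons_right z).differentiableOn
          fun w hw => cons_mem_pi (s := fun i => bernstein (ρ i)) hz hw)
        (fun w hw => hB _ (cons_mem_pi (s := fun i => bernstein (ρ i)) hz hw))
        (t := fun i => t i.succ) (fun i => ht i.succ)
    set H : ℂ → ℂ := fun z => tensorInterp (fun i => N i.succ) (fun i => t i.succ)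
      (fun w => F (Fin.cons z w)) with hH
    have hHd : DifferentiableOn ℂ H (bernstein (ρ 0)) := by
      refine DifferentiableOn.fun_sum fun k _ => DifferentiableOn.const_mul ?_ _
      refine hF.comp (differentiable_cons_left _).differentiableOn fun z hz =>
        cons_mem_pi (s := fun i => bernstein (ρ i)) hz fun i _ =>
          ofReal_mem_bernstein (hρ i.succ) (chebNode_mem _ _)
    have hHB : ∀ z ∈ bernstein (ρ 0), ‖H z‖ ≤ B * √P := fun z hz => (hsec z hz).1
    have hA : tensorInterp N t F = ∑ k : Fin (N 0 + 1), (chebCardinal (N 0) k (t 0) : ℂ) *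
        H (chebNode (N 0) k : ℝ) := tensorInterp_succ N t F
    have ht0 := ofReal_mem_bernstein (hρ 0) (ht 0)
    have hB0 : 0 ≤ B := (norm_nonneg _).trans (hB (fun i => (t i : ℂ)) fun i _ =>
      ofReal_mem_bernstein (hρ i) (ht i))
    have h1 := norm_interp_le (hρ 0) hHd hHB (hN 0) (ht 0)
    have h2 := norm_sub_interp_le (hρ 0) hHd hHB (hN 0) (ht 0)
    have h3 := (hsec _ ht0).2
    rw [← hA] at h1 h2
    rw [Fin.prod_univ_succ, ← hP, Fin.sum_univ_succ]
    refine ⟨h1.trans (le_of_eq ?_), ?_⟩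
    · rw [mul_assoc, ← Real.sqrt_mul hP0, mul_comm P]
    have e : F (fun i => (t i : ℂ)) - tensorInterp N t F =
        (F (Fin.cons (t 0 : ℂ) fun i => (t i.succ : ℂ)) - H (t 0 : ℝ)) +
          (H (t 0 : ℝ) - tensorInterp N t F) := by
      rw [sub_add_sub_cancel]
      congr 2
      ext i
      refine Fin.cases ?_ (fun i => ?_) i <;> rfl
    rw [e]
    refine (norm_add_le _ _).trans ((add_le_add h3 h2).trans ?_)
    rw [mul_assoc B (√P), ← mul_add]
    refine mul_le_mul_of_nonneg_left ?_ hB0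
    set x := ρ 0 ^ (-2 : ℤ) with hx
    set σ := ∑ i : Fin D, (ρ i.succ ^ (-2 : ℤ)) ^ N i.succ with hσ
    have hσ0 : 0 ≤ σ := Finset.sum_nonneg fun i _ =>
      pow_nonneg (zpow_neg_two_bounds (hρ i.succ)).1.le _
    have hx2 : 0 < 1 - x := by linarith
    have hc : 0 ≤ (1 + x) / (1 - x) := by positivity
    -- The errors are `√(4 P)` times `√σ` and `√(x ^ N₀) √c` with `c = (1 + x) / (1 - x)`; the new
    -- factor `1 + c` is exactly `2 / (1 - x)`.
    have h4 := add_sqrt_mul_sqrt_le hσ0 (pow_pos hx0 (N 0)).le hc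
    have h5 : 1 + (1 + x) / (1 - x) = 2 / (1 - x) := by field_simp; ring
    rw [h5, ← Real.sqrt_mul (by positivity)] at h4
    have h6 := mul_le_mul_of_nonneg_left h4 (Real.sqrt_nonneg (4 * P))
    rw [mul_add, ← Real.sqrt_mul (by positivity), ← Real.sqrt_mul (by positivity),
      ← Real.sqrt_mul (by positivity)] at h6
    rw [← Real.sqrt_mul hP0]
    refine le_of_eq_of_le ?_ (h6.trans (le_of_eq ?_))
    · congr 2 <;> ring
    · congr 1; ring

/-! ### Chebyshev coefficients and the Lagrange basis -/

theorem tauInv_mem {a b x : ℝ} (h : a < b) (hx : x ∈ Icc a b) : tauInv a b x ∈ Icc (-1 : ℝ) 1 := by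
  have h' : 0 < b - a := sub_pos.mpr h
  unfold tauInv
  constructor
  · have : 2 * (b - x) / (b - a) ≤ 2 := by rw [div_le_iff₀ h']; linarith [hx.1]
    linarith
  · have : 0 ≤ 2 * (b - x) / (b - a) := div_nonneg (by linarith [hx.2]) h'.le
    linarith

theorem node_mem {D : ℕ} {lo hi : Fin D → ℝ} (h : ∀ i, lo i < hi i) (N : Fin D → ℕ) (k : Idx N) :
    node lo hi N k ∈ Icc lo hi := by
  refine ⟨fun i => ?_, fun i => ?_⟩ <;> unfold node tau <;>
    nlinarith [h i, (chebNode_mem (N i) (k i)).1, (chebNode_mem (N i) (k i)).2]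

/-- Passes from the Chebyshev form used by the algorithm to the Lagrange form used by the estimates,
by expanding a product of the univariate identities `sum_T_mul_T`. -/
theorem sum_chebCoeff_mul_chebPoly {D : ℕ} (lo hi : Fin D → ℝ)
    {N : Fin D → ℕ} (hN : ∀ i, 1 ≤ N i) (v : Idx N → ℝ) {x : Fin D → ℝ} (hx : x ∈ Icc lo hi) :
    ∑ j, chebCoeff N v j * chebPoly lo hi N j x =
      ∑ k, (∏ i, chebCardinal (N i) (k i) (tauInv (lo i) (hi i) (x i))) * v k := by
  have h1 : ∀ k : Idx N, ∏ i, chebCardinal (N i) (k i) (tauInv (lo i) (hi i) (x i)) =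
      ∑ j : Idx N, ∏ i, (if 0 < (j i : ℕ) ∧ (j i : ℕ) < N i then (2 : ℝ) else 1) / (N i : ℝ) *
        trapWeight (N i) (k i) *
        (Polynomial.Chebyshev.T ℝ ((j i : ℕ) : ℤ)).eval (chebNode (N i) (k i)) *
        (Polynomial.Chebyshev.T ℝ ((j i : ℕ) : ℤ)).eval (tauInv (lo i) (hi i) (x i)) := fun k => by
    have h2 := Finset.prod_univ_sum (fun i => (Finset.univ : Finset (Fin (N i + 1))))
      (fun i j => (if 0 < (j : ℕ) ∧ (j : ℕ) < N i then (2 : ℝ) else 1) / (N i : ℝ) *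
        trapWeight (N i) (k i) *
        (Polynomial.Chebyshev.T ℝ ((j : ℕ) : ℤ)).eval (chebNode (N i) (k i)) *
        (Polynomial.Chebyshev.T ℝ ((j : ℕ) : ℤ)).eval (tauInv (lo i) (hi i) (x i)))
    rw [Fintype.piFinset_univ] at h2
    rw [← h2]
    exact Finset.prod_congr rfl fun i _ => (sum_T_mul_T (hN i) (k i) _).symm
  simp_rw [h1, Finset.sum_mul]
  rw [Finset.sum_comm]
  refine Finset.sum_congr rfl fun j _ => ?_
  unfold chebCoeff chebPoly
  rw [indicator_of_mem hx, Finset.mul_sum, Finset.sum_mul]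
  refine Finset.sum_congr rfl fun k _ => ?_
  simp only [Finset.prod_mul_distrib, trapWeight]
  ring

theorem sum_prod_abs_chebCardinal_le {D : ℕ} {lo hi : Fin D → ℝ} (h : ∀ i, lo i < hi i)
    {N : Fin D → ℕ} (hN : ∀ i, 1 ≤ N i) {x : Fin D → ℝ} (hx : x ∈ Icc lo hi) :
    ∑ k : Idx N, ∏ i, |chebCardinal (N i) (k i) (tauInv (lo i) (hi i) (x i))| ≤
      ∏ i, lebesgueBound (N i) := by
  have := Finset.prod_univ_sum (fun i => (Finset.univ : Finset (Fin (N i + 1))))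
    (fun i k => |chebCardinal (N i) k (tauInv (lo i) (hi i) (x i))|)
  rw [Fintype.piFinset_univ] at this
  rw [← this]
  refine Finset.prod_le_prod (fun i _ => Finset.sum_nonneg fun _ _ => abs_nonneg _) fun i _ => ?_
  have h1 := sum_abs_basis_le_lebesgueBound (hN i) (Real.arccos (tauInv (lo i) (hi i) (x i)))
  rwa [cos_arccos_eq (tauInv_mem (h i) ⟨hx.1 i, hx.2 i⟩)] at h1

theorem sum_prod_abs_le_lebesgueConst {D : ℕ} {lo hi : Fin D → ℝ} (h : ∀ i, lo i < hi i)
    {N : Fin D → ℕ} (hN : ∀ i, 1 ≤ N i) {x : Fin D → ℝ} (hx : x ∈ Icc lo hi) :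
    ∑ k : Idx N, ∏ i, |chebCardinal (N i) (k i) (tauInv (lo i) (hi i) (x i))| ≤
      lebesgueConst lo hi N :=
  le_csSup ⟨_, forall_mem_image.mpr fun _ hx => sum_prod_abs_chebCardinal_le h hN hx⟩
    (mem_image_of_mem _ hx)

theorem lebesgueConst_le {D : ℕ} {lo hi : Fin D → ℝ} (h : ∀ i, lo i < hi i)
    {N : Fin D → ℕ} (hN : ∀ i, 1 ≤ N i) :
    lebesgueConst lo hi N ≤ ∏ i, lebesgueBound (N i) :=
  csSup_le ((nonempty_Icc.mpr fun i => (h i).le).image _)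
    (forall_mem_image.mpr fun _ hx => sum_prod_abs_chebCardinal_le h hN hx)

theorem lebesgueConst_nonneg {D : ℕ} (lo hi : Fin D → ℝ) (N : Fin D → ℕ) :
    0 ≤ lebesgueConst lo hi N :=
  Real.sSup_nonneg (forall_mem_image.mpr fun _ _ => Finset.sum_nonneg fun _ _ =>
    Finset.prod_nonneg fun _ _ => abs_nonneg _)

/-! ### The interpolation error -/

theorem bernstein_mono {r s : ℝ} (hr : 1 ≤ r) (hrs : r ≤ s) : bernstein r ⊆ bernstein s := by
  intro z hz
  have hz' : ‖z - 1‖ + ‖z + 1‖ < r + r⁻¹ := hz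
  refine hz'.trans_le ?_
  rcases hrs.eq_or_lt with rfl | h
  · exact le_rfl
  · exact (add_inv_lt_add_inv hr h).le

theorem HasAnalyticExtension.mono {D : ℕ} {lo hi ϱ ϱ' : Fin D → ℝ} {B B' : ℝ}
    {v : (Fin D → ℝ) → ℝ} (h : HasAnalyticExtension lo hi ϱ B v) (h1 : ∀ i, 1 ≤ ϱ' i)
    (hϱ : ∀ i, ϱ' i ≤ ϱ i) (hB : B ≤ B') : HasAnalyticExtension lo hi ϱ' B' v := by
  obtain ⟨F, hF, hFv, hFB⟩ := h
  have hsub : genBernstein lo hi ϱ' ⊆ genBernstein lo hi ϱ :=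
    pi_mono fun i _ => image_mono (bernstein_mono (h1 i) (hϱ i))
  exact ⟨F, hF.mono hsub, hFv, fun z hz => (hFB z (hsub hz)).trans hB⟩

theorem epsInt_eq {D : ℕ} (ϱ : Fin D → ℝ) (N : Fin D → ℕ) (B : ℝ) :
    epsInt ϱ N B =
      B * √(4 * (∑ i, (ϱ i ^ (-2 : ℤ)) ^ N i) * ∏ i, 2 / (1 - ϱ i ^ (-2 : ℤ))) := by
  have h1 : ∏ i, 2 / (1 - ϱ i ^ (-2 : ℤ)) = 2 ^ D * ∏ i, 1 / (1 - ϱ i ^ (-2 : ℤ)) := by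
    simp_rw [← mul_one_div (2 : ℝ), Finset.prod_mul_distrib]
    simp
  have h2 : ∀ i, (ϱ i ^ (-2 : ℤ)) ^ N i = ϱ i ^ (-(2 * (N i : ℤ))) := fun i => by
    rw [← zpow_natCast, ← zpow_mul]; ring_nf
  have h3 : (2 : ℝ) ^ ((D : ℝ) / 2 + 1) = √(4 * 2 ^ D) := by
    symm
    rw [Real.sqrt_eq_iff_mul_self_eq_of_pos (by positivity), ← Real.rpow_add two_pos,
      show (D : ℝ) / 2 + 1 + (D / 2 + 1) = D + 2 by ring, Real.rpow_add two_pos,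
      Real.rpow_natCast]
    norm_num
    ring
  simp_rw [h1, h2]
  unfold epsInt
  rw [h3, ← Finset.sum_mul, mul_comm _ B, mul_assoc, ← Real.sqrt_mul (by positivity)]
  congr 2
  ring

theorem abs_sub_interp_le {D : ℕ} {lo hi : Fin D → ℝ} (h : ∀ i, lo i < hi i) {N : Fin D → ℕ}
    (hN : ∀ i, 1 ≤ N i) {ϱ : Fin D → ℝ} (hϱ : ∀ i, 1 < ϱ i) {B : ℝ} {v : (Fin D → ℝ) → ℝ}
    (hv : HasAnalyticExtension lo hi ϱ B v) {x : Fin D → ℝ} (hx : x ∈ Icc lo hi) :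
    |v x - ∑ j, chebCoeff N (fun k => v (node lo hi N k)) j * chebPoly lo hi N j x| ≤
      epsInt ϱ N B := by
  obtain ⟨F, hF, hFv, hFB⟩ := hv
  set τ : (Fin D → ℂ) → Fin D → ℂ := fun z i => tauC (lo i) (hi i) (z i) with hτ
  have hτd : Differentiable ℂ τ := differentiable_pi.mpr fun i => by
    simp only [hτ, tauC]
    fun_prop
  have hmaps : MapsTo τ (univ.pi fun i => bernstein (ϱ i)) (genBernstein lo hi ϱ) :=
    fun z hz i hi => mem_image_of_mem _ (hz i hi)
  have hτr : ∀ t : Fin D → ℝ, τ (fun i => (t i : ℂ)) =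
      fun i => ((tau (lo i) (hi i) (t i) : ℝ) : ℂ) := fun t => by
    ext i
    simp [hτ, tauC, tau]
  have key := (tensorInterp_bounds hϱ hN (F := F ∘ τ)
    (hF.differentiableOn.comp hτd.differentiableOn hmaps)
    (fun z hz => hFB _ (hmaps hz)) (t := fun i => tauInv (lo i) (hi i) (x i))
    (fun i => tauInv_mem (h i) ⟨hx.1 i, hx.2 i⟩)).2
  rw [← epsInt_eq] at key
  have e1 : (F ∘ τ) (fun i => ((tauInv (lo i) (hi i) (x i) : ℝ) : ℂ)) = (v x : ℂ) := by
    rw [Function.comp_apply, hτr]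
    simp_rw [tau_tauInv (h _)]
    exact hFv x hx
  have e2 : tensorInterp N (fun i => tauInv (lo i) (hi i) (x i)) (F ∘ τ) =
      ((∑ j, chebCoeff N (fun k => v (node lo hi N k)) j * chebPoly lo hi N j x : ℝ) : ℂ) := by
    rw [sum_chebCoeff_mul_chebPoly lo hi hN _ hx]
    unfold tensorInterp
    push_cast
    refine Finset.sum_congr rfl fun k _ => ?_
    rw [Function.comp_apply, hτr, ← hFv _ (node_mem h N k)]
    rfl
  rwa [e1, e2, ← Complex.ofReal_sub, Complex.norm_real, Real.norm_eq_abs] at key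

/-! ### Measurability and integrability -/

theorem DPP.L_nonneg {D n : ℕ} (S : DPP.{w} D n) : 0 ≤ S.L := by
  have := (abs_nonneg _).trans (S.lipschitz 1 0 0 0)
  simpa using this

theorem DPP.measurable_f {D n : ℕ} (S : DPP.{w} D n) (a : ℝ) : Measurable (S.f a) :=
  (LipschitzWith.of_dist_le' (K := S.L) fun x y => by
    simpa [Real.dist_eq] using S.lipschitz a x a y).continuous.measurable

theorem measurable_chebCoeff {D : ℕ} {N : Fin D → ℕ} {Ω' : Type*} {m : MeasurableSpace Ω'}
    {v : Ω' → Idx N → ℝ} (hv : ∀ k, Measurable fun ω => v ω k) (j : Idx N) :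
    Measurable fun ω => chebCoeff N (v ω) j :=
  (Finset.measurable_fun_sum _ fun k _ => ((hv k).const_mul _).mul_const _).const_mul _

theorem DPP.measurable_nodal {D n : ℕ} (S : DPP.{w} D n) (lo hi : Fin D → ℝ) (N : Fin D → ℕ)
    {Ω' : Type*} {mΩ' : MeasurableSpace Ω'} {G : Ω' → ℕ → Idx N → Idx N → ℝ} {m : ℕ} (hm : m ≤ n)
    (hG : ∀ v, n - m ≤ v → v < n → ∀ k j, Measurable fun ω => G ω v k j) (k : Idx N) :
    Measurable fun ω => S.nodal lo hi N (G ω) m k := by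
  induction m generalizing k with
  | zero => exact measurable_const
  | succ m ih =>
    refine (S.measurable_f _).comp (Finset.measurable_fun_sum _ fun j _ => ?_)
    exact (measurable_chebCoeff (fun k => ih (by omega)
      (fun v h1 h2 => hG v (by omega) h2) k) j).mul (hG _ le_rfl (by omega) k j)

theorem continuous_prod_eval_tauInv {D : ℕ} (lo hi : Fin D → ℝ) {N : Fin D → ℕ} (j : Idx N) :
    Continuous fun x : Fin D → ℝ =>
      ∏ i, (Polynomial.Chebyshev.T ℝ ((j i : ℕ) : ℤ)).eval (tauInv (lo i) (hi i) (x i)) := by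
  refine continuous_finsetProd _ fun i _ => (Polynomial.continuous _).comp ?_
  unfold tauInv
  fun_prop

theorem measurable_chebPoly {D : ℕ} (lo hi : Fin D → ℝ) {N : Fin D → ℕ} (j : Idx N) :
    Measurable (chebPoly lo hi N j) :=
  (continuous_prod_eval_tauInv lo hi j).measurable.indicator measurableSet_Icc

theorem integrable_chebPoly {D : ℕ} (lo hi : Fin D → ℝ) {N : Fin D → ℕ} (j : Idx N)
    (μ : Measure (Fin D → ℝ)) [IsFiniteMeasure μ] : Integrable (chebPoly lo hi N j) μ :=
  (integrable_indicator_iff measurableSet_Icc).mpr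
    ((continuous_prod_eval_tauInv lo hi j).continuousOn.integrableOn_compact isCompact_Icc)

theorem sum_chebCoeff_mul_chebPoly_node {D : ℕ} {lo hi : Fin D → ℝ} (h : ∀ i, lo i < hi i)
    {N : Fin D → ℕ} (hN : ∀ i, 1 ≤ N i) (v : Idx N → ℝ) (k : Idx N) :
    ∑ j, chebCoeff N v j * chebPoly lo hi N j (node lo hi N k) = v k := by
  rw [sum_chebCoeff_mul_chebPoly lo hi hN v (node_mem h N k), Finset.sum_eq_single k]
  · have : ∀ i, chebCardinal (N i) (k i) (tauInv (lo i) (hi i) (node lo hi N k i)) = 1 :=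
      fun i => by
        rw [node, tauInv_tau (h i)]
        exact Lagrange.eval_basis_self (chebNode_injective (hN i)).injOn (Finset.mem_univ _)
    simp only [this, Finset.prod_const_one, one_mul]
  · intro k' _ hk
    obtain ⟨i, hi'⟩ := Function.ne_iff.mp hk
    rw [Finset.prod_eq_zero (Finset.mem_univ i), zero_mul]
    rw [node, tauInv_tau (h i)]
    exact Lagrange.eval_basis_of_ne hi' (Finset.mem_univ _)
  · exact fun hk => absurd (Finset.mem_univ k) hk

theorem chebPoly_of_notMem {D : ℕ} {lo hi : Fin D → ℝ} {N : Fin D → ℕ} (j : Idx N)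
    {x : Fin D → ℝ} (hx : x ∉ Icc lo hi) : chebPoly lo hi N j x = 0 :=
  indicator_of_notMem hx _

/-! ### One step of the recursion -/

/-- The interpolation error plus the propagated error of the nodal values. -/
theorem lintegral_sub_interp_le {D : ℕ} {lo hi : Fin D → ℝ} (h : ∀ i, lo i < hi i)
    {N : Fin D → ℕ} (hN : ∀ i, 1 ≤ N i)
    {Ω' : Type*} {mΩ' : MeasurableSpace Ω'}
    {Q : Measure Ω'} [IsProbabilityMeasure Q] {v : (Fin D → ℝ) → ℝ}
    {v' : Ω' → Idx N → ℝ} (hv' : ∀ k, Measurable fun ω => v' ω k) {A η : ℝ≥0∞}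
    {x : Fin D → ℝ} (hx : x ∈ Icc lo hi)
    (hA : ‖v x - ∑ j, chebCoeff N (fun k => v (node lo hi N k)) j * chebPoly lo hi N j x‖ₑ ≤ A)
    (hη : ∀ k, ∫⁻ ω, ‖v (node lo hi N k) - v' ω k‖ₑ ∂Q ≤ η) :
    ∫⁻ ω, ‖v x - ∑ j, chebCoeff N (v' ω) j * chebPoly lo hi N j x‖ₑ ∂Q ≤
      A + ENNReal.ofReal (lebesgueConst lo hi N) * η := by
  have hpt : ∀ ω, ‖v x - ∑ j, chebCoeff N (v' ω) j * chebPoly lo hi N j x‖ₑ ≤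
      A + ∑ k, ‖∏ i, chebCardinal (N i) (k i) (tauInv (lo i) (hi i) (x i))‖ₑ *
        ‖v (node lo hi N k) - v' ω k‖ₑ := fun ω => by
    rw [← sub_add_sub_cancel _
      (∑ j, chebCoeff N (fun k => v (node lo hi N k)) j * chebPoly lo hi N j x)]
    refine (enorm_add_le _ _).trans (add_le_add hA ?_)
    rw [sum_chebCoeff_mul_chebPoly lo hi hN _ hx, sum_chebCoeff_mul_chebPoly lo hi hN _ hx,
      ← Finset.sum_sub_distrib]
    refine (enorm_sum_le _ _).trans (Finset.sum_le_sum fun k _ => ?_)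
    rw [← mul_sub, enorm_mul]
  refine (lintegral_mono hpt).trans ?_
  rw [lintegral_add_left measurable_const, lintegral_const, measure_univ, mul_one]
  refine add_le_add le_rfl ?_
  have hm : ∀ k, Measurable fun ω => ‖v (node lo hi N k) - v' ω k‖ₑ := fun k =>
    (measurable_const.sub (hv' k)).enorm
  rw [lintegral_finsetSum _ fun k _ => (hm k).const_mul _]
  calc _ ≤ ∑ k : Idx N,
        ‖∏ i, chebCardinal (N i) (k i) (tauInv (lo i) (hi i) (x i))‖ₑ * η := by
        refine Finset.sum_le_sum fun k _ => ?_
        rw [lintegral_const_mul' _ _ enorm_ne_top]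
        gcongr
        exact hη k
    _ = ENNReal.ofReal (∑ k : Idx N,
        ∏ i, |chebCardinal (N i) (k i) (tauInv (lo i) (hi i) (x i))|) * η := by
        rw [← Finset.sum_mul, ENNReal.ofReal_sum_of_nonneg fun k _ =>
          Finset.prod_nonneg fun _ _ => abs_nonneg _]
        congr 1
        refine Finset.sum_congr rfl fun k _ => ?_
        rw [Real.enorm_eq_ofReal_abs, Finset.abs_prod]
    _ ≤ _ := by
        gcongr
        exact sum_prod_abs_le_lebesgueConst h hN hx

/-- Condition (GM*) for polynomials which are not normalized. -/
theorem DPP.GMStar.lintegral_le {D n : ℕ} {S : DPP.{w} D n} {lo hi : Fin D → ℝ} (h : ∀ i, lo i < hi i)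
    {N : Fin D → ℕ} (hN : ∀ i, 1 ≤ N i)
    {Ω' : Type w} {mΩ' : MeasurableSpace Ω'}
    {Q : Measure Ω'}
    {Γ : ℕ → Idx N → Ω' → (chebSpace lo hi N →ₗ[ℝ] ℝ)} {δ : ℝ}
    (hG : S.GMStar lo hi N Q Γ δ) {u : ℕ} (hu : u < n) (k : Idx N) {v : Ω' → Idx N → ℝ}
    (hv : ∀ k, Measurable[laterSigma n lo hi N Γ u] fun ω => v ω k)
    (hv' : ∀ k, Measurable fun ω => v ω k) {s : ℝ≥0∞} (hs : s ≠ ⊤)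
    (hvs : ∀ x ∈ Icc lo hi, ∫⁻ ω, ‖∑ j, chebCoeff N (v ω) j * chebPoly lo hi N j x‖ₑ ∂Q ≤ s) :
    ∫⁻ ω, ‖S.condExp u (fun y => ∑ j, chebCoeff N (v ω) j * chebPoly lo hi N j y)
        (node lo hi N k) - Γ u k ω (∑ j, chebCoeff N (v ω) j • chebElem lo hi N j)‖ₑ ∂Q ≤
      ENNReal.ofReal δ * s := by
  set r : ℝ≥0∞ := ⨆ x ∈ Icc lo hi,
    ∫⁻ ω, ‖∑ j, chebCoeff N (v ω) j * chebPoly lo hi N j x‖ₑ ∂Q with hr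
  have hrs : r ≤ s := iSup₂_le hvs
  rcases eq_or_ne r 0 with h0 | h0
  -- If the norm vanishes, normalization is impossible; but evaluation at the nodes shows that the
  -- nodal values, and with them all coefficients, vanish almost surely.
  · have hzero : ∀ᵐ ω ∂Q, ∀ k, v ω k = 0 := ae_all_iff.mpr fun k' => by
      have h1 : ∫⁻ ω, ‖v ω k'‖ₑ ∂Q = 0 := by
        refine le_antisymm ?_ (bot_le)
        rw [← h0]
        refine le_trans (le_of_eq ?_) (le_iSup₂ (node lo hi N k') (node_mem h N k'))
        simp_rw [sum_chebCoeff_mul_chebPoly_node h hN]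
      filter_upwards [(lintegral_eq_zero_iff (hv' k').enorm).mp h1] with ω hω
      simpa using hω
    refine le_of_eq_of_le (lintegral_eq_zero_of_ae_eq_zero ?_) (bot_le)
    filter_upwards [hzero] with ω hω
    have : v ω = 0 := funext hω
    simp [this, chebCoeff, DPP.condExp]
  · have hrt : r ≠ ⊤ := ne_top_of_le_ne_top hs hrs
    have hr0 : 0 < r.toReal := ENNReal.toReal_pos h0 hrt
    set c : ℝ := r.toReal⁻¹ with hc
    have hce : ‖c‖ₑ = r⁻¹ := by
      rw [Real.enorm_eq_ofReal (inv_nonneg.mpr hr0.le), ENNReal.ofReal_inv_of_pos hr0,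
        ENNReal.ofReal_toReal hrt]
    have hmul : ∀ ω x, ∑ j, c * chebCoeff N (v ω) j * chebPoly lo hi N j x =
        c * ∑ j, chebCoeff N (v ω) j * chebPoly lo hi N j x := fun ω x => by
      rw [Finset.mul_sum]; exact Finset.sum_congr rfl fun _ _ => mul_assoc _ _ _
    have h1 := hG.2 u hu k (fun j ω => c * chebCoeff N (v ω) j)
      (fun j => (measurable_chebCoeff hv j).const_mul c) (by
        simp_rw [hmul, enorm_mul, lintegral_const_mul' _ _ enorm_ne_top, ← ENNReal.mul_iSup]
        rw [hce, ← hr, ENNReal.inv_mul_cancel h0 hrt])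
    have h2 : ∀ ω, S.condExp u (fun y => ∑ j, c * chebCoeff N (v ω) j * chebPoly lo hi N j y)
        (node lo hi N k) - Γ u k ω (∑ j, (c * chebCoeff N (v ω) j) • chebElem lo hi N j) =
        c * (S.condExp u (fun y => ∑ j, chebCoeff N (v ω) j * chebPoly lo hi N j y)
        (node lo hi N k) - Γ u k ω (∑ j, chebCoeff N (v ω) j • chebElem lo hi N j)) := fun ω => by
      simp_rw [mul_smul, ← Finset.smul_sum, map_smul, hmul, DPP.condExp, integral_const_mul]
      rw [smul_eq_mul, mul_sub]
    simp_rw [h2, enorm_mul, lintegral_const_mul' _ _ enorm_ne_top] at h1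
    rw [hce, ENNReal.inv_mul_le_iff h0 hrt, mul_comm] at h1
    exact h1.trans (by gcongr)

/-- The propagation of the error of the value function through conditional expectations. -/
theorem DPP.lintegral_condExp_sub_le {D n : ℕ} (S : DPP.{w} D n) {lo hi : Fin D → ℝ} {N : Fin D → ℕ}
    {Ω' : Type*} {mΩ' : MeasurableSpace Ω'}
    {Q : Measure Ω'} [IsProbabilityMeasure Q] {εtr : ℝ} {u : ℕ} (hu : u < n)
    (x : Fin D → ℝ)
    (hT : |S.condExp u ((Icc lo hi)ᶜ.indicator (S.V (u + 1))) x| ≤ εtr)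
    {v : Ω' → Idx N → ℝ} (hv : ∀ k, Measurable fun ω => v ω k) {e : ℝ≥0∞}
    (he : ∀ y ∈ Icc lo hi, ∫⁻ ω, ‖S.V (u + 1) y -
      ∑ j, chebCoeff N (v ω) j * chebPoly lo hi N j y‖ₑ ∂Q ≤ e) :
    ∫⁻ ω, ‖S.condExp u (S.V (u + 1)) x -
        S.condExp u (fun y => ∑ j, chebCoeff N (v ω) j * chebPoly lo hi N j y) x‖ₑ ∂Q ≤
      ENNReal.ofReal εtr + e := by
  have := S.markov.kernel_prob (S.t u) (S.t (u + 1))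
  set μ := S.κ (S.t u) (S.t (u + 1)) x with hμ
  have hV : Integrable (S.V (u + 1)) μ := S.V_integrable u hu x
  have hp : ∀ ω, Integrable (fun y => ∑ j, chebCoeff N (v ω) j * chebPoly lo hi N j y) μ :=
    fun ω => integrable_finsetSum _ fun j _ => (integrable_chebPoly lo hi j μ).const_mul _
  have hpt : ∀ ω, ‖S.condExp u (S.V (u + 1)) x -
        S.condExp u (fun y => ∑ j, chebCoeff N (v ω) j * chebPoly lo hi N j y) x‖ₑ ≤
      ENNReal.ofReal εtr + ∫⁻ y, (Icc lo hi).indicator (fun y => ‖S.V (u + 1) y -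
        ∑ j, chebCoeff N (v ω) j * chebPoly lo hi N j y‖ₑ) y ∂μ := fun ω => by
    -- The polynomials vanish outside the box, so there the difference is `V` alone, whose signed
    -- integral is the truncation error.
    have e1 : S.condExp u (S.V (u + 1)) x -
        S.condExp u (fun y => ∑ j, chebCoeff N (v ω) j * chebPoly lo hi N j y) x =
        S.condExp u ((Icc lo hi)ᶜ.indicator (S.V (u + 1))) x +
          ∫ y, (Icc lo hi).indicator (fun y => S.V (u + 1) y -
            ∑ j, chebCoeff N (v ω) j * chebPoly lo hi N j y) y ∂μ := by
      have h1 : Integrable ((Icc lo hi).indicator (fun y => S.V (u + 1) y -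
          ∑ j, chebCoeff N (v ω) j * chebPoly lo hi N j y)) μ :=
        (hV.sub (hp ω)).indicator measurableSet_Icc
      unfold DPP.condExp
      rw [← hμ, ← integral_sub hV (hp ω), ← integral_add (hV.indicator measurableSet_Icc.compl) h1]
      refine integral_congr_ae (ae_of_all _ fun y => ?_)
      by_cases hy : y ∈ Icc lo hi
      · simp [hy]
      · simp [hy, chebPoly_of_notMem _ hy]
    rw [e1]
    refine (enorm_add_le _ _).trans (add_le_add ?_ ?_)
    · rw [Real.enorm_eq_ofReal_abs]
      exact ENNReal.ofReal_le_ofReal hT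
    · refine (enorm_integral_le_lintegral_enorm _).trans (le_of_eq (lintegral_congr fun y => ?_))
      exact enorm_indicator_eq_indicator_enorm _ _
  refine (lintegral_mono hpt).trans ?_
  rw [lintegral_add_left measurable_const, lintegral_const, measure_univ, mul_one]
  refine add_le_add le_rfl ?_
  -- Tonelli: the error hypothesis bounds the expectation over `Q` separately for each `y` of the
  -- box.
  rw [lintegral_lintegral_swap]
  · calc _ ≤ ∫⁻ _, e ∂μ := by
          refine lintegral_mono fun y => ?_
          by_cases hy : y ∈ Icc lo hi
          · simpa [hy] using he y hy
          · simp [hy]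
      _ = e := by rw [lintegral_const, measure_univ, mul_one]
  · have h1 : AEMeasurable (fun z : Ω' × (Fin D → ℝ) => ‖S.V (u + 1) z.2 -
        ∑ j, chebCoeff N (v z.1) j * chebPoly lo hi N j z.2‖ₑ) (Q.prod μ) := by
      refine AEMeasurable.enorm (AEMeasurable.sub ?_ (Measurable.aemeasurable ?_))
      · exact hV.aemeasurable.comp_quasiMeasurePreserving Measure.quasiMeasurePreserving_snd
      · exact Finset.measurable_fun_sum _ fun j _ =>
          ((measurable_chebCoeff hv j).comp measurable_fst).mul
            ((measurable_chebPoly lo hi j).comp measurable_snd)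
    exact h1.indicator (measurable_snd measurableSet_Icc)

/-! ### Bounds for the data -/

theorem rhoMin_le {D n : ℕ} (ϱ : ℕ → Fin D → ℝ) {u : ℕ} (hu : u ∈ Icc 1 n) (i : Fin D) :
    rhoMin n ϱ i ≤ ϱ u i :=
  csInf_le ((finite_Icc 1 n).image _).bddBelow (mem_image_of_mem (fun u => ϱ u i) hu)

theorem one_lt_rhoMin {D n : ℕ} (hn : 1 ≤ n) {ϱ : ℕ → Fin D → ℝ}
    (hϱ : ∀ u ∈ Icc 1 n, ∀ i, 1 < ϱ u i) (i : Fin D) : 1 < rhoMin n ϱ i :=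
  (((finite_Icc 1 n).image _).lt_csInf_iff ((nonempty_Icc.mpr hn).image _)).mpr
    (forall_mem_image.mpr fun u hu => hϱ u hu i)

theorem le_bMax {n : ℕ} (B : ℕ → ℝ) {u : ℕ} (hu : u ∈ Icc 1 n) : B u ≤ bMax n B :=
  le_csSup ((finite_Icc 1 n).image _).bddAbove (mem_image_of_mem B hu)

theorem DPP.Regular.hasAnalyticExtension {D n : ℕ} {S : DPP.{w} D n} {lo hi : Fin D → ℝ}
    {ϱ : ℕ → Fin D → ℝ} {B : ℕ → ℝ} (hR : S.Regular lo hi ϱ B) (hn : 1 ≤ n)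
    (hϱ : ∀ u ∈ Icc 1 n, ∀ i, 1 < ϱ u i) {u : ℕ} (hu : u ∈ Icc 1 n) :
    HasAnalyticExtension lo hi (rhoMin n ϱ) (bMax n B) (S.V u) :=
  (hR u hu).mono (fun i => (one_lt_rhoMin hn hϱ i).le) (rhoMin_le ϱ hu) (le_bMax B hu)

theorem HasAnalyticExtension.abs_le {D : ℕ} {lo hi ϱ : Fin D → ℝ} (h : ∀ i, lo i < hi i)
    (hϱ : ∀ i, 1 < ϱ i) {B : ℝ} {v : (Fin D → ℝ) → ℝ} (hv : HasAnalyticExtension lo hi ϱ B v)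
    {x : Fin D → ℝ} (hx : x ∈ Icc lo hi) : |v x| ≤ B := by
  obtain ⟨F, -, hFv, hFB⟩ := hv
  have h1 := hFB (fun i => (x i : ℂ)) fun i _ =>
    ⟨(tauInv (lo i) (hi i) (x i) : ℝ),
      ofReal_mem_bernstein (hϱ i) (tauInv_mem (h i) ⟨hx.1 i, hx.2 i⟩), by
        refine Eq.trans ?_ (congrArg Complex.ofReal (tau_tauInv (h i) (x i)))
        simp [tauC, tau]⟩
  rwa [hFv x hx, Complex.norm_real, Real.norm_eq_abs] at h1

/-- The auxiliary bound `W` is needed because the real `sSup` of an unbounded set is `0`, and then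
`vMax` would bound nothing. -/
theorem abs_le_sSup_vMax {D n : ℕ} {S : DPP.{w} D n} {lo hi : Fin D → ℝ} {W : ℝ}
    (hW : ∀ j ∈ Icc 1 n, ∀ x ∈ Icc lo hi, |S.V j x| ≤ W) {u : ℕ} (hu : 1 ≤ u) {j : ℕ}
    (hj : j ∈ Icc u n) {x : Fin D → ℝ} (hx : x ∈ Icc lo hi) : |S.V j x| ≤ S.vMax lo hi u := by
  have h1 : |S.V j x| ≤ sSup ((fun x => |S.V j x|) '' Icc lo hi) :=
    le_csSup ⟨W, forall_mem_image.mpr fun y hy => hW j ⟨hu.trans hj.1, hj.2⟩ y hy⟩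
      (mem_image_of_mem (fun x => |S.V j x|) hx)
  exact h1.trans (le_csSup ((finite_Icc u n).image _).bddAbove
    (mem_image_of_mem (fun j => sSup ((fun x => |S.V j x|) '' Icc lo hi)) hj))

theorem DPP.vMax_le {D n : ℕ} {S : DPP.{w} D n} {lo hi : Fin D → ℝ} (h : ∀ i, lo i < hi i) {W : ℝ}
    (hW : ∀ j ∈ Icc 1 n, ∀ x ∈ Icc lo hi, |S.V j x| ≤ W) {u : ℕ} (hu : u ∈ Icc 1 n) :
    S.vMax lo hi u ≤ W :=
  csSup_le ((nonempty_Icc.mpr hu.2).image _) (forall_mem_image.mpr fun j hj =>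
    csSup_le ((nonempty_Icc.mpr fun i => (h i).le).image _)
      (forall_mem_image.mpr fun x hx => hW j ⟨hu.1.trans hj.1, hj.2⟩ x hx))

/-! ### The recursion -/

theorem measurable_laterSigma {D n : ℕ} {lo hi : Fin D → ℝ} {N : Fin D → ℕ} {Ω' : Type w}
    (Γ : ℕ → Idx N → Ω' → (chebSpace lo hi N →ₗ[ℝ] ℝ)) {u v : ℕ} (hv : v ∈ Ioo u n) (k j : Idx N) :
    Measurable[laterSigma n lo hi N Γ u] fun ω => Γ v k ω (chebElem lo hi N j) :=
  measurable_iff_comap_le.mpr (le_iSup₂_of_le v hv (le_iSup_of_le k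
    (le_iSup (fun j => MeasurableSpace.comap (fun ω => Γ v k ω (chebElem lo hi N j))
      inferInstance) j)))

theorem DPP.condExp_sum {D n : ℕ} (S : DPP.{w} D n) (lo hi : Fin D → ℝ) {N : Fin D → ℕ} (u : ℕ)
    (c : Idx N → ℝ) (x : Fin D → ℝ) :
    S.condExp u (fun y => ∑ j, c j * chebPoly lo hi N j y) x =
      ∑ j, c j * S.condExp u (chebPoly lo hi N j) x := by
  have := S.markov.kernel_prob (S.t u) (S.t (u + 1))
  unfold DPP.condExp
  rw [integral_finsetSum _ fun j _ => (integrable_chebPoly lo hi j _).const_mul _]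
  simp_rw [integral_const_mul]

/-- The recursive estimate for the error at the Chebyshev points. -/
theorem DPP.GMStar.lintegral_nodal_le {D n : ℕ} {S : DPP.{w} D n} {lo hi : Fin D → ℝ}
    (h : ∀ i, lo i < hi i) {N : Fin D → ℕ} (hN : ∀ i, 1 ≤ N i) {εtr δ W b : ℝ} (hδ : 0 ≤ δ)
    (hεtr : 0 ≤ εtr) (hb : 0 ≤ b) (hW0 : 0 ≤ W)
    (hT : S.Trunc lo hi N εtr) {Ω' : Type w} {mΩ' : MeasurableSpace Ω'} {Q : Measure Ω'}
    [IsProbabilityMeasure Q] {Γ : ℕ → Idx N → Ω' → (chebSpace lo hi N →ₗ[ℝ] ℝ)}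
    (hG : S.GMStar lo hi N Q Γ δ) {m : ℕ} (hm : m + 1 ≤ n)
    (hW : ∀ x ∈ Icc lo hi, |S.V (n - m) x| ≤ W)
    (hme : ∀ x ∈ Icc lo hi, ∫⁻ ω, ‖S.V (n - m) x - ∑ j, chebCoeff N (S.nodal lo hi N
      (fun u k j => Γ u k ω (chebElem lo hi N j)) m) j * chebPoly lo hi N j x‖ₑ ∂Q ≤
        ENNReal.ofReal b) (k : Idx N) :
    ∫⁻ ω, ‖S.V (n - (m + 1)) (node lo hi N k) - S.nodal lo hi N
      (fun u k j => Γ u k ω (chebElem lo hi N j)) (m + 1) k‖ₑ ∂Q ≤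
        ENNReal.ofReal (S.L * ((1 + δ) * b + (εtr + δ * W))) := by
  obtain ⟨u, hu⟩ : ∃ u, u = n - (m + 1) := ⟨_, rfl⟩
  have hun : u < n := by omega
  have hum : n - m = u + 1 := by omega
  rw [hum] at hW hme
  set v : Ω' → Idx N → ℝ := fun ω =>
    S.nodal lo hi N (fun u k j => Γ u k ω (chebElem lo hi N j)) m with hv
  have hvm : ∀ k, Measurable fun ω => v ω k := fun k =>
    S.measurable_nodal lo hi N (G := fun ω u k j => Γ u k ω (chebElem lo hi N j)) (by omega)
      (fun t _ ht k j => hG.1 t ht k _) k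
  -- After `m` steps the algorithm has used only operators at times `v ≥ n - m = u + 1`, so the
  -- coefficients are admissible in (GM*) at time `u`.
  have hvl : ∀ k, Measurable[laterSigma n lo hi N Γ u] fun ω => v ω k := fun k =>
    S.measurable_nodal lo hi N (G := fun ω u k j => Γ u k ω (chebElem lo hi N j)) (by omega)
      (fun t ht ht' k j => measurable_laterSigma Γ ⟨by omega, ht'⟩ k j) k
  -- (GM*) is relative to the size of the approximating polynomial, which is at most its error plus
  -- `|V|`; this produces the terms `δ b` and `δ W`.
  have hbound : ∀ x ∈ Icc lo hi, ∫⁻ ω, ‖∑ j, chebCoeff N (v ω) j * chebPoly lo hi N j x‖ₑ ∂Q ≤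
      ENNReal.ofReal (b + W) := fun x hx => by
    calc _ ≤ ∫⁻ ω, (‖S.V (u + 1) x - ∑ j, chebCoeff N (v ω) j * chebPoly lo hi N j x‖ₑ +
          ENNReal.ofReal W) ∂Q := by
          refine lintegral_mono fun ω => ?_
          rw [← enorm_neg, show ∀ a c : ℝ, -c = (a - c) + (-a) from fun a c => by ring]
          refine (enorm_add_le _ _).trans (add_le_add (le_refl ‖S.V (u + 1) x - _‖ₑ) ?_)
          rw [enorm_neg, Real.enorm_eq_ofReal_abs]
          exact ENNReal.ofReal_le_ofReal (hW x hx)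
      _ ≤ _ := by
          rw [lintegral_add_right _ measurable_const, lintegral_const, measure_univ, mul_one,
            ENNReal.ofReal_add hb hW0]
          exact add_le_add (hme x hx) le_rfl
  have h1 := S.lintegral_condExp_sub_le hun (node lo hi N k) (hT u hun k) hvm hme
  have h2 := hG.lintegral_le h hN hun k hvl hvm ENNReal.ofReal_ne_top hbound
  have hpt : ∀ ω, ‖S.V u (node lo hi N k) - S.nodal lo hi N
      (fun u k j => Γ u k ω (chebElem lo hi N j)) (m + 1) k‖ₑ ≤
      ENNReal.ofReal S.L * (‖S.condExp u (S.V (u + 1)) (node lo hi N k) -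
        S.condExp u (fun y => ∑ j, chebCoeff N (v ω) j * chebPoly lo hi N j y)
          (node lo hi N k)‖ₑ +
        ‖S.condExp u (fun y => ∑ j, chebCoeff N (v ω) j * chebPoly lo hi N j y)
          (node lo hi N k) - Γ u k ω (∑ j, chebCoeff N (v ω) j • chebElem lo hi N j)‖ₑ) :=
    fun ω => by
      have e1 : S.nodal lo hi N (fun u k j => Γ u k ω (chebElem lo hi N j)) (m + 1) k =
          S.f (S.g (S.t u) (node lo hi N k))
            (Γ u k ω (∑ j, chebCoeff N (v ω) j • chebElem lo hi N j)) := by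
        rw [DPP.nodal, hu, map_sum]
        simp_rw [map_smul, smul_eq_mul]
        rfl
      rw [e1, S.V_step u hun]
      refine le_trans ?_ (mul_le_mul_right (enorm_add_le _ _) _)
      rw [sub_add_sub_cancel, Real.enorm_eq_ofReal_abs, Real.enorm_eq_ofReal_abs,
        ← ENNReal.ofReal_mul S.L_nonneg]
      refine ENNReal.ofReal_le_ofReal ((S.lipschitz _ _ _ _).trans (le_of_eq ?_))
      rw [sub_self, abs_zero, zero_add]
      rfl
  rw [← hu]
  refine (lintegral_mono hpt).trans ?_
  have hmeas : Measurable fun ω => ‖S.condExp u (S.V (u + 1)) (node lo hi N k) -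
        S.condExp u (fun y => ∑ j, chebCoeff N (v ω) j * chebPoly lo hi N j y)
          (node lo hi N k)‖ₑ := by
    simp_rw [S.condExp_sum lo hi]
    exact (measurable_const.sub (Finset.measurable_fun_sum _ fun j _ =>
      (measurable_chebCoeff hvm j).mul_const _)).enorm
  rw [lintegral_const_mul' _ _ ENNReal.ofReal_ne_top, lintegral_add_left hmeas]
  refine (mul_le_mul_right (add_le_add h1 h2) _).trans (le_of_eq ?_)
  rw [← ENNReal.ofReal_add hεtr hb, ← ENNReal.ofReal_mul hδ,
    ← ENNReal.ofReal_add (by positivity) (by positivity), ← ENNReal.ofReal_mul S.L_nonneg]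
  congr 1
  ring

theorem DPP.Trunc.nonneg {D n : ℕ} {S : DPP.{w} D n} {lo hi : Fin D → ℝ} {N : Fin D → ℕ}
    {εtr : ℝ} (hT : S.Trunc lo hi N εtr) (hn : 1 ≤ n) : 0 ≤ εtr :=
  (abs_nonneg _).trans (hT 0 hn fun _ => 0)

theorem DPP.GMStar.errorStar_le {D n : ℕ} (hn : 1 ≤ n) {ϱ : ℕ → Fin D → ℝ}
    (hϱ : ∀ u ∈ Icc 1 n, ∀ i, 1 < ϱ u i) {B : ℕ → ℝ} {S : DPP.{w} D n} {lo hi : Fin D → ℝ}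
    (h : ∀ i, lo i < hi i) {N : Fin D → ℕ} (hN : ∀ i, 1 ≤ N i) {εtr δ : ℝ} (hδ : 0 ≤ δ)
    (hR : S.Regular lo hi ϱ B) (hT : S.Trunc lo hi N εtr) {Ω' : Type w}
    {mΩ' : MeasurableSpace Ω'} {Q : Measure Ω'} [IsProbabilityMeasure Q]
    {Γ : ℕ → Idx N → Ω' → (chebSpace lo hi N →ₗ[ℝ] ℝ)} (hG : S.GMStar lo hi N Q Γ δ) {u : ℕ}
    (hu : u ∈ Icc 1 n) :
    S.errorStar lo hi N Q Γ u ≤ ENNReal.ofReal (S.bound lo hi N ϱ B εtr δ u) := by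
  set A := epsInt (rhoMin n ϱ) N (bMax n B) with hA
  set W := S.vMax lo hi u with hW
  set E := εtr + δ * W with hE
  set C := max 2 (lebesgueConst lo hi N * S.L * (1 + δ)) with hC
  have hεtr := hT.nonneg hn
  have hext : ∀ j ∈ Icc 1 n, HasAnalyticExtension lo hi (rhoMin n ϱ) (bMax n B) (S.V j) :=
    fun j hj => hR.hasAnalyticExtension hn hϱ hj
  have hint : ∀ j ∈ Icc 1 n, ∀ x ∈ Icc lo hi, |S.V j x - ∑ i, chebCoeff N
      (fun k => S.V j (node lo hi N k)) i * chebPoly lo hi N i x| ≤ A := fun j hj x hx =>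
    abs_sub_interp_le h hN (one_lt_rhoMin hn hϱ) (hext j hj) hx
  have hVW : ∀ j ∈ Icc u n, ∀ x ∈ Icc lo hi, |S.V j x| ≤ W := fun j hj x hx =>
    abs_le_sSup_vMax (fun j hj x hx => (hext j hj).abs_le h (one_lt_rhoMin hn hϱ) hx) hu.1 hj hx
  have hlo : lo ∈ Icc lo hi := ⟨le_rfl, fun i => (h i).le⟩
  have hA0 : 0 ≤ A := (abs_nonneg _).trans (hint u hu lo hlo)
  have hW0 : 0 ≤ W := (abs_nonneg _).trans (hVW u ⟨le_rfl, hu.2⟩ lo hlo)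
  have hE0 : 0 ≤ E := by positivity
  have hC2 : 2 ≤ C := le_max_left _ _
  have hC' : lebesgueConst lo hi N * S.L * (1 + δ) ≤ C := le_max_right _ _
  have hpow : ∀ m : ℕ, 2 ≤ C ^ (m + 1) := fun m =>
    hC2.trans (le_self_pow₀ (by linarith) (Nat.succ_ne_zero m))
  have hb : ∀ m : ℕ, 0 ≤ (A + E) * (C ^ (m + 1) - 1) - E := fun m => by
    nlinarith [mul_nonneg (add_nonneg hA0 hE0) (sub_nonneg.mpr (hpow m))]
  -- The sequence `b_m = (A + E) (C ^ (m + 1) - 1) - E` dominates the recursion `b ↦ A + C (b + E)`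
  -- with `b_0 ≥ A`. Start and step each have the slack `(A + E) (C - 2)`, so `C ≥ 2` is exactly
  -- what is required.
  have main : ∀ m ≤ n - u, ∀ x ∈ Icc lo hi, ∫⁻ ω, ‖S.V (n - m) x - ∑ j, chebCoeff N
      (S.nodal lo hi N (fun u k j => Γ u k ω (chebElem lo hi N j)) m) j *
        chebPoly lo hi N j x‖ₑ ∂Q ≤ ENNReal.ofReal ((A + E) * (C ^ (m + 1) - 1) - E) := by
    intro m
    induction m with
    | zero =>
      intro _ x hx
      have := hu.1
      have h1 := hint n ⟨hn, le_rfl⟩ x hx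
      have h2 : (fun k => S.V n (node lo hi N k)) = fun k => S.g (S.t n) (node lo hi N k) :=
        funext fun k => S.V_last _
      simp only [DPP.nodal, Nat.sub_zero, lintegral_const, measure_univ, mul_one]
      rw [h2] at h1
      rw [Real.enorm_eq_ofReal_abs]
      refine ENNReal.ofReal_le_ofReal (h1.trans ?_)
      rw [zero_add, pow_one]
      nlinarith [mul_nonneg (add_nonneg hA0 hE0) (sub_nonneg.mpr hC2)]
    | succ m ih =>
      intro hm x hx
      have hu1 := hu.1
      have hmn : m + 1 ≤ n := by omega
      set b := (A + E) * (C ^ (m + 1) - 1) - E with hbdef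
      have hstep := hG.lintegral_nodal_le h hN hδ hεtr (hb m) hW0 hT hmn
        (fun x hx => hVW (n - m) ⟨by omega, by omega⟩ x hx) (ih (by omega))
      have hfin := lintegral_sub_interp_le h hN (Q := Q) (v := S.V (n - (m + 1)))
        (v' := fun ω => S.nodal lo hi N (fun u k j => Γ u k ω (chebElem lo hi N j)) (m + 1))
        (fun k => S.measurable_nodal lo hi N
          (G := fun ω u k j => Γ u k ω (chebElem lo hi N j)) hmn
          (fun t _ ht k j => hG.1 t ht k _) k) hx (A := ENNReal.ofReal A)
        (by
          rw [Real.enorm_eq_ofReal_abs]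
          exact ENNReal.ofReal_le_ofReal (hint _ ⟨by omega, by omega⟩ x hx)) hstep
      refine hfin.trans ?_
      have hL := S.L_nonneg
      have hΛ := lebesgueConst_nonneg lo hi N
      have hb0 := hb m
      rw [← hbdef] at hb0
      rw [← ENNReal.ofReal_mul hΛ, ← ENNReal.ofReal_add hA0 (by positivity)]
      refine ENNReal.ofReal_le_ofReal ?_
      have h1 : lebesgueConst lo hi N * S.L * (1 + δ) * b ≤ C * b := by gcongr
      have h2 : lebesgueConst lo hi N * S.L ≤ C :=
        le_trans (le_mul_of_one_le_right (by positivity) (by linarith)) hC'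
      have h3 : lebesgueConst lo hi N * S.L * E ≤ C * E := by gcongr
      have h4 : C * b + C * E = (A + E) * (C ^ (m + 1 + 1) - C) := by rw [hbdef]; ring
      nlinarith [mul_nonneg (add_nonneg hA0 hE0) (sub_nonneg.mpr hC2)]
  have hfinal : (A + E) * (C ^ (n - u + 1) - 1) - E ≤ S.bound lo hi N ϱ B εtr δ u := by
    have e : n + 1 - u = n - u + 1 := by have := hu.2; omega
    rw [DPP.bound, ← hA, ← hW, ← hC, e, add_assoc, ← hE]
    nlinarith
  refine iSup₂_le fun x hx => le_trans ?_ (ENNReal.ofReal_le_ofReal hfinal)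
  have := main (n - u) le_rfl x hx
  rwa [Nat.sub_sub_self hu.2] at this

/-! ### Deterministic operators as random operators on a one-point space -/

/-- Under a Dirac measure expectations are evaluations, so random coefficients are mere numbers and
the measurability conditions carry no information. -/
theorem DPP.GM.gmStar {D n : ℕ} {S : DPP.{w} D n} {lo hi : Fin D → ℝ} {N : Fin D → ℕ}
    {Γ : ℕ → Idx N → (chebSpace lo hi N →ₗ[ℝ] ℝ)} {δ : ℝ} (hG : S.GM lo hi N Γ δ) :
    S.GMStar lo hi N (Measure.dirac PUnit.unit.{w + 1}) (fun u k _ => Γ u k) δ := by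
  refine ⟨fun u _ k p => measurable_const, fun u hu k a _ ha => ?_⟩
  have hcoe : ((∑ j, a j PUnit.unit • chebElem lo hi N j : chebSpace lo hi N) :
      (Fin D → ℝ) → ℝ) = fun x => ∑ j, a j PUnit.unit * chebPoly lo hi N j x := by
    ext x
    simp [chebElem]
  simp only [lintegral_dirac] at ha ⊢
  have h1 := hG u hu k (∑ j, a j PUnit.unit • chebElem lo hi N j) (by rw [hcoe]; exact ha)
  rw [hcoe] at h1
  rw [Real.enorm_eq_ofReal_abs]
  exact ENNReal.ofReal_le_ofReal h1

theorem DPP.errorStar_dirac {D n : ℕ} (S : DPP.{w} D n) (lo hi : Fin D → ℝ) (N : Fin D → ℕ)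
    (Γ : ℕ → Idx N → (chebSpace lo hi N →ₗ[ℝ] ℝ)) (u : ℕ) :
    S.errorStar lo hi N (Measure.dirac PUnit.unit.{w + 1}) (fun u k _ => Γ u k) u =
      S.error lo hi N Γ u := by
  simp only [DPP.errorStar, DPP.error, lintegral_dirac]

theorem DPP.GM.error_le {D n : ℕ} (hn : 1 ≤ n) {ϱ : ℕ → Fin D → ℝ}
    (hϱ : ∀ u ∈ Icc 1 n, ∀ i, 1 < ϱ u i) {B : ℕ → ℝ} {S : DPP.{w} D n} {lo hi : Fin D → ℝ}
    (h : ∀ i, lo i < hi i) {N : Fin D → ℕ} (hN : ∀ i, 1 ≤ N i) {εtr δ : ℝ} (hδ : 0 ≤ δ)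
    (hR : S.Regular lo hi ϱ B) (hT : S.Trunc lo hi N εtr)
    {Γ : ℕ → Idx N → (chebSpace lo hi N →ₗ[ℝ] ℝ)} (hG : S.GM lo hi N Γ δ) {u : ℕ}
    (hu : u ∈ Icc 1 n) :
    S.error lo hi N Γ u ≤ ENNReal.ofReal (S.bound lo hi N ϱ B εtr δ u) := by
  rw [← S.errorStar_dirac]
  exact hG.gmStar.errorStar_le hn hϱ h hN hδ hR hT hu

/-! ### Logarithmic growth and geometric decay -/

theorem half_le_log {N : ℕ} (hN : 2 ≤ N) : 1 / 2 ≤ Real.log N := by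
  have h1 : Real.log 2 ≤ Real.log N :=
    Real.log_le_log two_pos (by exact_mod_cast hN)
  linarith [Real.log_two_gt_d9]

theorem lebesgueBound_le_log {N : ℕ} (hN : 2 ≤ N) : lebesgueBound N ≤ 4 * Real.log N := by
  have h1 : ∑ k ∈ Finset.range N, 1 / (2 * k + 1 : ℝ) ≤ 1 + Real.log N := by
    refine le_trans ?_ (harmonic_le_one_add_log N)
    unfold harmonic
    push_cast
    refine Finset.sum_le_sum fun k _ => ?_
    rw [one_div]
    exact inv_anti₀ (by positivity) (by linarith [(Nat.cast_nonneg k : (0 : ℝ) ≤ k)])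
  have h2 := lebesgueBound_le hN
  have h3 := half_le_log hN
  linarith

theorem max_lebesgueConst_le {D : ℕ} {lo hi : Fin D → ℝ} (h : ∀ i, lo i < hi i) {N : ℕ}
    (hN : 2 ≤ N) {c δ : ℝ} (hδ : 0 ≤ δ) (hδc : δ ≤ c) :
    max 2 (lebesgueConst lo hi (fun _ => N) * 1 * (1 + δ)) ≤
      (2 * 2 ^ D + 4 ^ D * (1 + c)) * Real.log N ^ D := by
  have hl := half_le_log hN
  have hl0 : 0 ≤ Real.log N := by linarith
  have h1 : lebesgueConst lo hi (fun _ => N) ≤ 4 ^ D * Real.log N ^ D := by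
    refine (lebesgueConst_le h fun _ => one_le_two.trans hN).trans ?_
    rw [Finset.prod_const, Finset.card_univ, Fintype.card_fin, ← mul_pow]
    exact pow_le_pow_left₀ (zero_le_one.trans (one_le_lebesgueBound (one_le_two.trans hN)))
      (lebesgueBound_le_log hN) D
  have h2 : 1 ≤ 2 ^ D * Real.log N ^ D := by
    rw [← mul_pow]; exact one_le_pow₀ (by linarith)
  have h3 : 0 ≤ 4 ^ D * Real.log N ^ D := by positivity
  have h4 : 0 ≤ 4 ^ D * Real.log N ^ D * (1 + c) := mul_nonneg h3 (by linarith)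
  rw [mul_one]
  refine max_le (by linarith) ?_
  have := mul_le_mul h1 (show 1 + δ ≤ 1 + c by linarith) (by linarith) h3
  linarith

theorem epsInt_const_le {D : ℕ} (hD : 1 ≤ D) {ϱ : Fin D → ℝ} (hϱ : ∀ i, 1 < ϱ i) (N : ℕ)
    {B B' : ℝ} (hB0 : 0 ≤ B') (hB : B ≤ B') :
    epsInt ϱ (fun _ => N) B ≤
      B' * √(4 * D * ∏ i, 2 / (1 - ϱ i ^ (-2 : ℤ))) * (⨅ i, ϱ i) ^ (-(N : ℤ)) := by
  have : Nonempty (Fin D) := ⟨⟨0, hD⟩⟩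
  obtain ⟨i₀, hi₀⟩ := exists_eq_ciInf_of_finite (f := ϱ)
  set r := ⨅ i, ϱ i with hr
  have hr1 : 1 < r := hi₀ ▸ hϱ i₀
  have hP : 0 ≤ ∏ i, 2 / (1 - ϱ i ^ (-2 : ℤ)) := Finset.prod_nonneg fun i _ =>
    div_nonneg zero_le_two (by linarith [(zpow_neg_two_bounds (hϱ i)).2])
  have hsum : ∑ i, (ϱ i ^ (-2 : ℤ)) ^ N ≤ D * (r ^ (-(N : ℤ))) ^ 2 := by
    calc _ ≤ ∑ _i : Fin D, (r ^ (-(N : ℤ))) ^ 2 := by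
          refine Finset.sum_le_sum fun i _ => ?_
          have h1 : (r ^ (-(N : ℤ))) ^ 2 = (r ^ (-2 : ℤ)) ^ N := by
            rw [← zpow_natCast, ← zpow_natCast, ← zpow_mul, ← zpow_mul]
            push_cast
            ring_nf
          rw [h1]
          refine pow_le_pow_left₀ (zpow_neg_two_bounds (hϱ i)).1.le ?_ N
          have h2 : r ≤ ϱ i := ciInf_le (finite_range ϱ).bddBelow i
          rw [zpow_neg, zpow_neg]
          refine inv_anti₀ (by positivity) ?_
          exact_mod_cast pow_le_pow_left₀ (by linarith) h2 2
      _ = _ := by simp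
  rw [epsInt_eq, mul_assoc B', ← Real.sqrt_sq (by positivity : 0 ≤ r ^ (-(N : ℤ))),
    ← Real.sqrt_mul (by positivity)]
  refine (mul_le_mul_of_nonneg_right hB (Real.sqrt_nonneg _)).trans ?_
  refine mul_le_mul_of_nonneg_left (Real.sqrt_le_sqrt ?_) hB0
  have := mul_le_mul_of_nonneg_right hsum hP
  linarith

/-- The error bound in terms of `N` and `δ`, with constants that depend on the data only. -/
theorem exists_bound_le {D n : ℕ} (hD : 1 ≤ D) (hn : 1 ≤ n) {ϱ : ℕ → Fin D → ℝ}
    (hϱ : ∀ u ∈ Icc 1 n, ∀ i, 1 < ϱ u i) (B : ℕ → ℝ) {c : ℝ} (hc : 0 < c) :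
    ∃ c₁ c₂ : ℝ, 0 < c₁ ∧ 0 < c₂ ∧ ∀ (S : DPP.{w} D n) (lo hi : Fin D → ℝ) (N : ℕ) (δ : ℝ),
      (∀ i, lo i < hi i) → 2 ≤ N → 0 ≤ δ → δ ≤ c → S.L = 1 → S.Regular lo hi ϱ B →
      ∀ u ∈ Icc 1 n, S.bound lo hi (fun _ => N) ϱ B 0 δ u ≤
        c₁ * (⨅ i, rhoMin n ϱ i) ^ (-(N : ℤ)) * Real.log N ^ (D * n) +
          c₂ * Real.log N ^ (D * n) * δ := by
  have hρ := one_lt_rhoMin hn hϱ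
  -- A strictly positive majorant of `bMax`, so that both constants are positive; it bounds `V̄` as
  -- well.
  set b := |bMax n B| + 1 with hb
  have hb0 : 0 < b := by positivity
  have hbB : bMax n B ≤ b := by linarith [le_abs_self (bMax n B)]
  set P := ∏ i, 2 / (1 - rhoMin n ϱ i ^ (-2 : ℤ)) with hP
  have hP0 : 0 < P := Finset.prod_pos fun i _ =>
    div_pos two_pos (by linarith [(zpow_neg_two_bounds (hρ i)).2])
  set K : ℝ := 2 * 2 ^ D + 4 ^ D * (1 + c) with hK
  have hK0 : 0 < K := by positivity
  have hD0 : (0 : ℝ) < D := by exact_mod_cast hD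
  refine ⟨b * √(4 * D * P) * K ^ n, b * K ^ n, by positivity, by positivity, ?_⟩
  intro S lo hi N δ h hN hδ hδc hL hR u hu
  have hA := epsInt_const_le hD hρ N hb0.le hbB
  rw [← hP] at hA
  have hV : S.vMax lo hi u ≤ b := DPP.vMax_le h (fun j hj x hx =>
    ((hR.hasAnalyticExtension hn hϱ hj).abs_le h hρ hx).trans hbB) hu
  have hC := max_lebesgueConst_le h hN hδ hδc
  have hl0 : 0 ≤ Real.log N := by linarith [half_le_log hN]
  have hρ0 : 0 ≤ ⨅ i, rhoMin n ϱ i := Real.iInf_nonneg fun i => by linarith [hρ i]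
  unfold DPP.bound
  rw [hL, add_zero]
  set C := max 2 (lebesgueConst lo hi (fun _ => N) * 1 * (1 + δ)) with hCdef
  have hC1 : 1 ≤ C := one_le_two.trans (le_max_left _ _)
  -- Because `u ≥ 1` and `C ≥ 1`, the exponent may be raised to `n`; with `C ≤ K log(N) ^ D` this
  -- gives the power `D * n` of the logarithm.
  have hCn : C ^ (n + 1 - u) ≤ K ^ n * Real.log N ^ (D * n) := by
    rw [pow_mul, ← mul_pow]
    have := hu.1
    exact (pow_le_pow_right₀ hC1 (by omega)).trans
      (pow_le_pow_left₀ (zero_le_one.trans hC1) hC n)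
  have hsum : epsInt (rhoMin n ϱ) (fun _ => N) (bMax n B) + δ * S.vMax lo hi u ≤
      b * √(4 * D * P) * (⨅ i, rhoMin n ϱ i) ^ (-(N : ℤ)) + δ * b := by gcongr
  refine (mul_le_mul hsum hCn (pow_nonneg (zero_le_one.trans hC1) _) (by positivity)).trans
    (le_of_eq (by ring))

end ChebDP

theorem corollary3p4 (D n : ℕ) (hD : 1 ≤ D) (hn : 1 ≤ n)
    (ϱ : ℕ → Fin D → ℝ) (hϱ : ∀ u ∈ Set.Icc 1 n, ∀ i, 1 < ϱ u i) (B : ℕ → ℝ) :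
    -- the general error bound
    (∀ (S : ChebDP.DPP.{w} D n) (lo hi : Fin D → ℝ) (N : Fin D → ℕ) (εtr δ : ℝ),
      (∀ i, lo i < hi i) → (∀ i, 1 ≤ N i) → 0 ≤ δ →
      S.Regular lo hi ϱ B → S.Trunc lo hi N εtr →
      (∀ Γ : ℕ → ChebDP.Idx N → (ChebDP.chebSpace lo hi N →ₗ[ℝ] ℝ), S.GM lo hi N Γ δ →
        ∀ u ∈ Set.Icc 1 n,
          S.error lo hi N Γ u ≤ ENNReal.ofReal (S.bound lo hi N ϱ B εtr δ u)) ∧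
      (∀ (Ω' : Type w) (mΩ' : MeasurableSpace Ω') (Q : Measure Ω') (_ : IsProbabilityMeasure Q)
        (Γ : ℕ → ChebDP.Idx N → Ω' → (ChebDP.chebSpace lo hi N →ₗ[ℝ] ℝ)),
        S.GMStar lo hi N Q Γ δ → ∀ u ∈ Set.Icc 1 n,
          S.errorStar lo hi N Q Γ u ≤ ENNReal.ofReal (S.bound lo hi N ϱ B εtr δ u))) ∧
    -- the simplified bound under (GM*) with an error of order `M ^ (-1/2)`
    (∀ c : ℝ, 0 < c → ∃ c₁ c₂ : ℝ, 0 < c₁ ∧ 0 < c₂ ∧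
      ∀ (S : ChebDP.DPP.{w} D n) (lo hi : Fin D → ℝ) (N M : ℕ) (δ : ℝ),
        (∀ i, lo i < hi i) → 2 ≤ N → 1 ≤ M → 0 ≤ δ → δ ≤ c / √(M : ℝ) → S.L = 1 →
        S.Regular lo hi ϱ B → S.Trunc lo hi (fun _ => N) 0 →
        ∀ (Ω' : Type w) (mΩ' : MeasurableSpace Ω') (Q : Measure Ω') (_ : IsProbabilityMeasure Q)
          (Γ : ℕ → ChebDP.Idx (fun _ : Fin D => N) → Ω' →
            (ChebDP.chebSpace lo hi (fun _ => N) →ₗ[ℝ] ℝ)),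
          S.GMStar lo hi (fun _ => N) Q Γ δ → ∀ u ∈ Set.Icc 1 n,
            S.errorStar lo hi (fun _ => N) Q Γ u ≤ ENNReal.ofReal
              (c₁ * (⨅ i, ChebDP.rhoMin n ϱ i) ^ (-(N : ℤ)) * Real.log N ^ (D * n) +
                c₂ * Real.log N ^ (D * n) * (M : ℝ) ^ (-(1 / 2 : ℝ)))) ∧
    -- the simplified bound under (GM)
    (∀ c : ℝ, 0 < c → ∃ c₁ c₂ : ℝ, 0 < c₁ ∧ 0 < c₂ ∧
      ∀ (S : ChebDP.DPP.{w} D n) (lo hi : Fin D → ℝ) (N : ℕ) (δ : ℝ),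
        (∀ i, lo i < hi i) → 2 ≤ N → 0 ≤ δ → δ ≤ c → S.L = 1 →
        S.Regular lo hi ϱ B → S.Trunc lo hi (fun _ => N) 0 →
        ∀ Γ : ℕ → ChebDP.Idx (fun _ : Fin D => N) →
            (ChebDP.chebSpace lo hi (fun _ => N) →ₗ[ℝ] ℝ),
          S.GM lo hi (fun _ => N) Γ δ → ∀ u ∈ Set.Icc 1 n,
            S.error lo hi (fun _ => N) Γ u ≤ ENNReal.ofReal
              (c₁ * (⨅ i, ChebDP.rhoMin n ϱ i) ^ (-(N : ℤ)) * Real.log N ^ (D * n) +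
                c₂ * Real.log N ^ (D * n) * δ)) := by
  refine ⟨fun S lo hi N εtr δ h hN hδ hR hT => ⟨fun Γ hG u hu => ?_, ?_⟩,
    fun c hc => ?_, fun c hc => ?_⟩
  · exact hG.error_le hn hϱ h hN hδ hR hT hu
  · intro Ω' mΩ' Q _ Γ hG u hu
    exact hG.errorStar_le hn hϱ h hN hδ hR hT hu
  · obtain ⟨c₁, c₂, hc₁, hc₂, hbd⟩ := ChebDP.exists_bound_le hD hn hϱ B hc
    -- The bound is linear in `δ ≤ c / √M`, so `c` goes into the second constant; `M ≥ 1` yields the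
    -- condition `δ ≤ c`.
    refine ⟨c₁, c₂ * c, hc₁, mul_pos hc₂ hc, ?_⟩
    intro S lo hi N M δ h hN hM hδ hδM hL hR hT Ω' mΩ' Q _ Γ hG u hu
    have hM1 : 1 ≤ √(M : ℝ) := Real.one_le_sqrt.mpr (by exact_mod_cast hM)
    have hδc : δ ≤ c := hδM.trans (div_le_self hc.le hM1)
    refine (hG.errorStar_le hn hϱ h (fun _ => one_le_two.trans hN) hδ hR hT hu).trans
      (ENNReal.ofReal_le_ofReal ((hbd S lo hi N δ h hN hδ hδc hL hR u hu).trans ?_))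
    have hlog : 0 ≤ Real.log N ^ (D * n) :=
      pow_nonneg (by linarith [ChebDP.half_le_log hN]) _
    have h1 := mul_le_mul_of_nonneg_left hδM (mul_nonneg hc₂.le hlog)
    have h2 : (M : ℝ) ^ (-(1 / 2 : ℝ)) = (√(M : ℝ))⁻¹ := by
      rw [Real.rpow_neg (Nat.cast_nonneg M), Real.sqrt_eq_rpow]
    rw [h2]
    refine add_le_add le_rfl (h1.trans (le_of_eq ?_))
    ring
  · obtain ⟨c₁, c₂, hc₁, hc₂, hbd⟩ := ChebDP.exists_bound_le hD hn hϱ B hc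
    refine ⟨c₁, c₂, hc₁, hc₂, ?_⟩
    intro S lo hi N δ h hN hδ hδc hL hR hT Γ hG u hu
    exact (hG.error_le hn hϱ h (fun _ => one_le_two.trans hN) hδ hR hT hu).trans
      (ENNReal.ofReal_le_ofReal (hbd S lo hi N δ h hN hδ hδc hL hR u hu))
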